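/- Let $n\ge 1$, $0<\gamma<1$, $2\gamma<n$ and $\frac{n}{n-2\gamma}<p<\frac{n+2\gamma}{n-2\gamma}$. Put $$A=2^{2\gamma}\frac{\Gamma(\gamma+\frac{\gamma}{p-1})\,\Gamma(\frac n2-\frac{\gamma}{p-1})}{\Gamma(\frac{\gamma}{p-1})\,\Gamma(\frac n2-\gamma-\frac{\gamma}{p-1})},\qquad \Lambda_{n,\gamma}=2^{2\gamma}\left(\frac{\Gamma(\frac{n+2\gamma}{4})}{\Gamma(\frac{n-2\gamma}{4})}\right)^2,$$ so that $r^{-2\gamma/(p-1)}$ solves $(-\Delta)^\gamma u=Au^p$ in $\mathbb R^n\setminus\{0\}$. Let $u_*=u_*(r)\ge 0$ be a radial solution of $(-\Delta)^\gamma u_*=Au_*^p$ in $\mathbb R^n\setminus\{0\}$, continuous for $r>0$, with $u_*=(1+o(1))r^{-\frac{2\gamma}{p-1}}$ as $r\to0$ and $u_*=(1+o(1))r^{-(n-2\gamma)}$ as $r\to\infty$. With $r=e^{-t}$ set $\mathcal V_*(t)=pA\,\big(r^{\frac{2\gamma}{p-1}}u_*(r)\big)^{p-1}$, and for $w=w(t)$,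 with $\phi(x)=r^{-\frac{n-2\gamma}{2}}w(t)$, $r=|x|=e^{-t}$, set $$\mathcal L_*w=r^{\frac{n+2\gamma}{2}}\Big((-\Delta)^\gamma\phi-\frac{\mathcal V_*}{r^{2\gamma}}\phi\Big).$$ Equations in $\mathbb R^n\setminus\{0\}$ are understood in the sense of distributions. Fix $\kappa$ with $0\le\kappa<\Lambda_{n,\gamma}$ (in the stable case $pA<\Lambda_{n,\gamma}$ one may take $\kappa=pA$), and let $$\Theta_0(z)=2^{2\gamma}\frac{\Gamma(\frac n4+\frac\gamma2+\frac{zi}{2})\,\Gamma(\frac n4+\frac\gamma2-\frac{zi}{2})}{\Gamma(\frac n4-\frac\gamma2+\frac{zi}{2})\,\Gamma(\frac n4-\frac\gamma2-\frac{zi}{2})}.$$ Assume that all poles of $1/(\Theta_0-\kappa)$ lie on the imaginary axis, and let $0<\sigma_0<\sigma_1<\cdots$ be the increasing enumeration of those $\sigma>0$ for which $i\sigma$ is a pole. Let $c_j=\mathrm{Re}\,\big(i/\Theta_0'(i\sigma_j)\big)$, the coefficient of $e^{-\sigma_j|t|}$ in the Green's function $\frac1{2\pi}\int_{\mathbb R}\frac{e^{i\xi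 t}}{\Theta_0(\xi)-\kappa}\,d\xi=\sum_j c_je^{-\sigma_j|t|}$. Let $w,\tilde w$ be two continuous functions of $t\in\mathbb R$ that solve $\mathcal L_*w=0$, $\mathcal L_*\tilde w=0$ and satisfy $w=O(e^{-\alpha|t|})$, $\tilde w=O(e^{-\tilde\alpha|t|})$ as $|t|\to\infty$ for some $\alpha,\tilde\alpha>-\sigma_0$. For $j\ge0$ put $$w_j(t)=\int_{\mathbb R}e^{-\sigma_j|t-t'|}\,(\mathcal V_*(t')-\kappa)\,w(t')\,dt',$$ and define $\tilde w_j$ in the same way from $\tilde w$. Then these integrals converge absolutely, all $w_j,\tilde w_j$ are differentiable, the series $$\mathcal W[w,\tilde w](t)=\sum_{j=0}^\infty\frac{c_j}{\sigma_j}\,\big(w_j\tilde w_j'-w_j'\tilde w_j\big)(t)$$ converges absolutely for every $t\in\mathbb R$, and $\mathcal W[w,\tilde w]$ is differentiable with $\mathcal W[w,\tilde w]'(t)=0$ for every $t\in\mathbb R$. -/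

import Mathlib

open Real Set Filter Topology MeasureTheory Asymptotics
open scoped FourierTransform ContDiff

noncomputable section

namespace NonlocalODE

/-- Euclidean space `ℝⁿ`. -/
abbrev E (n : ℕ) : Type := EuclideanSpace ℝ (Fin n)

/-- The fractional Laplacian `(-Δ)^γ η`, the Fourier multiplier with symbol `|ξ|^{2γ}`.  Mathlib's
Fourier transform uses the character `exp (-2πi⟨x, k⟩)`, so the frequency is `ξ = 2πk`. -/
def fracLaplacian {n : ℕ} (γ : ℝ) (η : E n → ℂ) : E n → ℂ :=
  𝓕⁻ (fun k : E n => (((2 * π * ‖k‖) ^ (2 * γ) : ℝ) : ℂ) * 𝓕 η k)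

/-- Test functions on `ℝⁿ ∖ {0}`: smooth, with compact support away from the origin. -/
structure IsPuncturedTestFunction {n : ℕ} (η : E n → ℂ) : Prop where
  smooth : ContDiff ℝ ∞ η
  compact : HasCompactSupport η
  away : (0 : E n) ∉ tsupport η

/-- `(-Δ)^γ φ = f` in `ℝⁿ ∖ {0}`, in the sense of distributions.  The integrability of
`φ / (1 + |x|)^{n + 2γ}` is the usual condition under which `(-Δ)^γ φ` makes sense. -/
structure SolvesFracLaplacian {n : ℕ} (γ : ℝ) (φ f : E n → ℝ) : Prop where
  integrable : Integrable (fun x => φ x / (1 + ‖x‖) ^ ((n : ℝ) + 2 * γ))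
  locallyIntegrable : LocallyIntegrableOn f {0}ᶜ
  weak : ∀ η : E n → ℂ, IsPuncturedTestFunction η →
    ∫ x, (φ x : ℂ) * fracLaplacian γ η x = ∫ x, (f x : ℂ) * η x

/-- The Hardy constant `Λ_{n,γ}`. -/
def hardyConst (n : ℕ) (γ : ℝ) : ℝ :=
  2 ^ (2 * γ) * (Real.Gamma ((n + 2 * γ) / 4) / Real.Gamma ((n - 2 * γ) / 4)) ^ 2

/-- The constant `A_{n,p,γ}` for which `r^{-2γ/(p-1)}` solves `(-Δ)^γ u = A u^p` in
`ℝⁿ ∖ {0}`. -/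
def constA (n : ℕ) (p γ : ℝ) : ℝ :=
  2 ^ (2 * γ) * (Real.Gamma (γ + γ / (p - 1)) * Real.Gamma (n / 2 - γ / (p - 1))) /
    (Real.Gamma (γ / (p - 1)) * Real.Gamma (n / 2 - γ - γ / (p - 1)))

/-- The fast-decaying radial singular solution `u_* = u_*(r)` of `(-Δ)^γ u = A u^p`, with
`u_* = (1 + o(1)) r^{-2γ/(p-1)}` as `r → 0` and `u_* = (1 + o(1)) r^{-(n-2γ)}` as `r → ∞`. -/
structure IsFastDecaySolution (n : ℕ) (γ p : ℝ) (u : ℝ → ℝ) : Prop where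
  continuousOn : ContinuousOn u (Ioi 0)
  nonneg : ∀ r, 0 < r → 0 ≤ u r
  solves : SolvesFracLaplacian γ (fun x : E n => u ‖x‖) (fun x : E n => constA n p γ * u ‖x‖ ^ p)
  at_zero : Tendsto (fun r => u r * r ^ (2 * γ / (p - 1))) (𝓝[>] 0) (𝓝 1)
  at_infty : Tendsto (fun r => u r * r ^ ((n : ℝ) - 2 * γ)) atTop (𝓝 1)

/-- The potential `𝒱_*(t) = p A v_*(t)^{p-1}`, where `v_*(t) = r^{2γ/(p-1)} u_*(r)`,
`r = e^{-t}`. -/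
def potential (n : ℕ) (γ p : ℝ) (u : ℝ → ℝ) (t : ℝ) : ℝ :=
  p * constA n p γ * ((rexp (-t)) ^ (2 * γ / (p - 1)) * u (rexp (-t))) ^ (p - 1)

/-- The radial function `φ(x) = r^{-(n-2γ)/2} w(t)` on `ℝⁿ`, where `r = |x| = e^{-t}`. -/
def fromCylinder (n : ℕ) (γ : ℝ) (w : ℝ → ℝ) (x : E n) : ℝ :=
  ‖x‖ ^ (-(((n : ℝ) - 2 * γ) / 2)) * w (-Real.log ‖x‖)

/-- `𝓛_* w = 0` for `w = w(t)`, where `𝓛_* w = r^{(n+2γ)/2} L_* φ` with `φ = r^{-(n-2γ)/2} w` and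
`L_* φ = (-Δ)^γ φ - r^{-2γ} 𝒱_* φ`. -/
def SolvesLStar (n : ℕ) (γ p : ℝ) (u w : ℝ → ℝ) : Prop :=
  SolvesFracLaplacian γ (fromCylinder n γ w) (fun x : E n =>
    ‖x‖ ^ (-(2 * γ)) * potential n γ p u (-Real.log ‖x‖) * fromCylinder n γ w x)

/-- The symbol `Θ₀(z)` of the conformal fractional Laplacian `P_γ^{(0)}` on radial functions.
Here `A₀ = n/4 + γ/2` and `B₀ = n/4 - γ/2`. -/
def symbol (n : ℕ) (γ : ℝ) (z : ℂ) : ℂ :=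
  ((2 ^ (2 * γ) : ℝ) : ℂ) *
    (Complex.Gamma (n / 4 + γ / 2 + z * Complex.I / 2) *
      Complex.Gamma (n / 4 + γ / 2 - z * Complex.I / 2)) /
    (Complex.Gamma (n / 4 - γ / 2 + z * Complex.I / 2) *
      Complex.Gamma (n / 4 - γ / 2 - z * Complex.I / 2))

/-- `z` is a pole of the meromorphic function `1 / (Θ₀ - κ)`. -/
def IsPole (n : ℕ) (γ κ : ℝ) (z : ℂ) : Prop :=
  meromorphicOrderAt (fun ζ => (symbol n γ ζ - κ)⁻¹) z < 0

/-- The sequence `σ₀ < σ₁ < ⋯` of all `s > 0` such that `i s` is a pole of `1 / (Θ₀ - κ)`, in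
increasing order. -/
def sigma (n : ℕ) (γ κ : ℝ) : ℕ → ℝ
  | 0 => sInf {s : ℝ | 0 < s ∧ IsPole n γ κ (s * Complex.I)}
  | j + 1 => sInf {s : ℝ | sigma n γ κ j < s ∧ IsPole n γ κ (s * Complex.I)}

/-- The coefficient `c_j` of `e^{-σ_j |t|}` in the Green's function
`𝒢(t) = (2π)⁻¹ ∫ e^{iξt} / (Θ₀(ξ) - κ) dξ = ∑ⱼ c_j e^{-σ_j |t|}` of `P_γ^{(0)} - κ`, that is, `i`
times the residue of `1 / (Θ₀ - κ)` at its simple pole `i σ_j`. -/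
def coeff (n : ℕ) (γ κ : ℝ) (j : ℕ) : ℝ :=
  (Complex.I / deriv (symbol n γ) (sigma n γ κ j * Complex.I)).re

/-- The right-hand side `h = (𝒱_* - κ) w`: the equation `𝓛_* w = 0` reads
`P_γ^{(0)} w - κ w = h`. -/
def source (n : ℕ) (γ p κ : ℝ) (u w : ℝ → ℝ) (t : ℝ) : ℝ :=
  (potential n γ p u t - κ) * w t

/-- The component `w_j(t) = ∫ e^{-σ_j |t - t'|} h(t') dt'` of `w`. -/
def component (n : ℕ) (γ p κ : ℝ) (u w : ℝ → ℝ) (j : ℕ) (t : ℝ) : ℝ :=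
  ∫ s, rexp (-(sigma n γ κ j * |t - s|)) * source n γ p κ u w s

/-- The Wronskian `𝒲_j[w, w̃] = w_j w̃_j' - w_j' w̃_j`. -/
def wronskianAt (n : ℕ) (γ p κ : ℝ) (u w₁ w₂ : ℝ → ℝ) (j : ℕ) (t : ℝ) : ℝ :=
  component n γ p κ u w₁ j t * deriv (component n γ p κ u w₂ j) t -
    deriv (component n γ p κ u w₁ j) t * component n γ p κ u w₂ j t

/-- The weighted Wronskian `𝒲[w, w̃] = ∑ⱼ (c_j / σ_j) 𝒲_j[w, w̃]`. -/
def wronskian (n : ℕ) (γ p κ : ℝ) (u w₁ w₂ : ℝ → ℝ) (t : ℝ) : ℝ :=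
  ∑' j, coeff n γ κ j / sigma n γ κ j * wronskianAt n γ p κ u w₁ w₂ j t

/-- A radial solution of `𝓛_* w = 0` with `w = O(e^{-α|t|})` as `|t| → ∞` for some `α > -σ₀`: the
solutions (possibly growing) to which the decomposition into the components `w_j` applies. -/
structure IsAdmissibleSolution (n : ℕ) (γ p κ : ℝ) (u w : ℝ → ℝ) : Prop where
  continuous : Continuous w
  solves : SolvesLStar n γ p u w
  growth : ∃ α : ℝ, -sigma n γ κ 0 < α ∧ w =O[cocompact ℝ] fun t => rexp (-(α * |t|))

end NonlocalODE

end

/-! Up to the factor `2σ`, `e^{-σ|t|}` is the Green's function of `σ² - d²/dt²`. Hence the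
components satisfy `w_j'' = σ_j² w_j - 2σ_j h` with `h = (𝒱_* - κ) w`, and `(c_j/σ_j) 𝒲_j' = -2 (c_j
w_j h̃ - h c_j w̃_j)`. Summation over `j` sees only `∑ c_j w_j`. Once this is known to equal `w`,
and likewise for `w̃`, the derivative is `-2 (w h̃ - h w̃)`. It vanishes because `h` and `h̃` arise
from `w` and `w̃` by the same multiplication. The work lies in the representation `w = ∑ c_j w_j`
(`eq_greenConv_source`) and in the convergence of the series.

Spectral side. In the variable `x = -z²`, `1/Θ₀` is a series `m(x) = ∑ a_k/(l_k - x)` with `a_k > 0`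
(`inv_symbol`): each Gamma quotient is a Beta integral, expanded by the binomial series, and the
product of the two quotients is again of this form. Such an `m` increases from `-∞` to `+∞` between
consecutive nodes, and `m(0) = 1/Λ < 1/κ`. For `κ > 0` the equation `m = 1/κ` therefore has one root
`μ_j` in each gap, and `σ_j = √μ_j`; for `κ = 0` the nodes themselves are the `σ_j²`. With `v = 1/κ`
one has `1/(Θ₀ - κ) = v m/(v - m)`. Its partial fractions are obtained without contour integrals, by
a matrix identity for finite sums and a monotone limit (`hasSum_partialFractions`). The outcome,
`isSpectral`, includes `c_j ≥ 0` and `∑ c_j/σ_j < ∞`, from which every absolute convergence follows.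

Analytic side. The equation holds only in the weak sense, so the Green's function is first applied
to test functions `ψ`. Mellin transforms of pairings with Gaussians show that the conformal
fractional Laplacian `P` of radial functions is the Fourier multiplier `Θ₀`
(`integral_fracLaplacian_mul_cpow`). Moreover `Pψ` is `O(e^{-(n/2+γ)|t|})`, a rate above `σ_0`, and
so can be paired with a `w` that grows more slowly than `e^{σ_0|t|}`. Fourier uniqueness gives `G *
(P - κ)ψ = ψ` (`greenConv_eq`). Testing the equation against all translates of `ψ` moves `G` to the
other factor (`integral_mul_greenConv`), whence `∫ w ψ = ∫ (G * h) ψ`. -/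

noncomputable section

namespace NonlocalODE

/-! ### Cauchy series with nonnegative weights: regularity and monotonicity between nodes. -/

/-- The Cauchy-type series `∑ b_k / (s_k - x)`. -/
def cauchySum (b s : ℕ → ℝ) (x : ℂ) : ℂ := ∑' k, (b k : ℂ) / ((s k : ℂ) - x)

/-- The restriction of `cauchySum` to the real line. -/
def cauchySumReal (b s : ℕ → ℝ) (x : ℝ) : ℝ := ∑' k, b k / (s k - x)

/-- Nodes `0 < s_0 < s_1 < ⋯ → ∞` and weights `b_k ≥ 0` for which `∑ b_k / s_k` converges. -/
structure IsCauchyData (b s : ℕ → ℝ) : Prop where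
  strictMono : StrictMono s
  pos : ∀ k, 0 < s k
  tendsto : Tendsto s atTop atTop
  nonneg : ∀ k, 0 ≤ b k
  summable : Summable fun k => b k / s k

namespace IsCauchyData

variable {b s : ℕ → ℝ}

/-- Supplies majorants by multiples of `b k / s k` for termwise limits and derivatives. When `s k ≥
2‖x₀‖`, the ratio of `s k` to its distance from `x₀` is at most `2`, and only finitely many nodes
remain. A node equal to `x₀` is exempt, so that the bound also serves to compute residues. -/
theorem exists_lower_bound_of_ne (h : IsCauchyData b s) (x₀ : ℂ) :
    ∃ r > 0, ∃ c > 0, ∀ x, dist x x₀ < r → ∀ k, x₀ ≠ s k → c * s k ≤ ‖(s k : ℂ) - x‖ := by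
  have hpos : ∀ k, x₀ ≠ s k → 0 < ‖(s k : ℂ) - x₀‖ := fun k hx =>
    norm_pos_iff.2 (sub_ne_zero.2 hx.symm)
  have h1 : ∀ᶠ k in atTop, s k / ‖(s k : ℂ) - x₀‖ ≤ 2 := by
    filter_upwards [h.tendsto.eventually_ge_atTop (2 * ‖x₀‖)] with k hk
    rcases eq_or_ne x₀ (s k) with hx | hx
    · simp [hx]
    rw [div_le_iff₀ (hpos k hx)]
    have := norm_sub_norm_le (s k : ℂ) x₀
    rw [Complex.norm_real, Real.norm_of_nonneg (h.pos k).le] at this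
    linarith
  obtain ⟨N, hN⟩ := eventually_atTop.1 h1
  obtain ⟨C, hC1, hC⟩ : ∃ C, 0 < C ∧ ∀ k, s k / ‖(s k : ℂ) - x₀‖ ≤ C := by
    refine ⟨2 + ∑ k ∈ Finset.range N, s k / ‖(s k : ℂ) - x₀‖, ?_, fun k => ?_⟩
    · have : 0 ≤ ∑ k ∈ Finset.range N, s k / ‖(s k : ℂ) - x₀‖ :=
        Finset.sum_nonneg fun k _ => div_nonneg (h.pos k).le (norm_nonneg _)
      linarith
    · have h0 : ∀ k ∈ Finset.range N, 0 ≤ s k / ‖(s k : ℂ) - x₀‖ :=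
        fun k _ => div_nonneg (h.pos k).le (norm_nonneg _)
      rcases lt_or_ge k N with hk | hk
      · have := Finset.single_le_sum h0 (Finset.mem_range.2 hk)
        linarith
      · have := Finset.sum_nonneg h0
        linarith [hN k hk]
  -- Moving `x` by less than `s 0 / (2 * C)` costs at most half of `s k / C`, because `s 0` is the
  -- smallest node.
  refine ⟨s 0 / (2 * C), div_pos (h.pos 0) (by positivity), 1 / (2 * C), by positivity,
    fun x hxr k hk => ?_⟩
  have h2 : s k / C ≤ ‖(s k : ℂ) - x₀‖ := by
    have := hC k
    rw [div_le_iff₀ (hpos k hk)] at this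
    rw [div_le_iff₀ hC1]
    linarith
  have h3 : ‖(s k : ℂ) - x₀‖ ≤ ‖(s k : ℂ) - x‖ + dist x x₀ := by
    rw [dist_eq_norm]
    simpa using norm_add_le ((s k : ℂ) - x) (x - x₀)
  have h4 : s 0 / (2 * C) ≤ s k / (2 * C) := by
    have := h.strictMono.monotone (Nat.zero_le k)
    gcongr
  have h5 : s k / C = s k / (2 * C) + s k / (2 * C) := by field_simp; norm_num
  have h6 : 1 / (2 * C) * s k = s k / (2 * C) := by ring
  linarith

theorem exists_lower_bound (h : IsCauchyData b s) {x₀ : ℂ} (hx : ∀ k, x₀ ≠ s k) :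
    ∃ r > 0, ∃ c > 0, ∀ x, dist x x₀ < r → ∀ k, c * s k ≤ ‖(s k : ℂ) - x‖ := by
  obtain ⟨r, hr, c, hc, hb⟩ := h.exists_lower_bound_of_ne x₀
  exact ⟨r, hr, c, hc, fun x hxr k => hb x hxr k (hx k)⟩

theorem summable_norm (h : IsCauchyData b s) {x : ℂ} (hx : ∀ k, x ≠ s k) :
    Summable fun k => ‖(b k : ℂ) / ((s k : ℂ) - x)‖ := by
  obtain ⟨r, hr, c, hc, hb⟩ := h.exists_lower_bound hx
  refine Summable.of_nonneg_of_le (fun _ => norm_nonneg _) (fun k => ?_) (h.summable.mul_left (1 / c))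
  have := hb x (by simpa using hr) k
  have hk := h.pos k
  rw [norm_div, Complex.norm_real, Real.norm_of_nonneg (h.nonneg k)]
  calc b k / ‖(s k : ℂ) - x‖ ≤ b k / (c * s k) := by
        have := h.nonneg k
        gcongr
    _ = 1 / c * (b k / s k) := by field_simp

theorem hasDerivAt (h : IsCauchyData b s) {x : ℂ} (hx : ∀ k, x ≠ s k) :
    HasDerivAt (cauchySum b s) (∑' k, (b k : ℂ) / ((s k : ℂ) - x) ^ 2) x := by
  obtain ⟨r, hr, c, hc, hb⟩ := h.exists_lower_bound hx
  have hs0 := h.pos 0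
  refine hasDerivAt_tsum_of_isPreconnected (t := Metric.ball x r)
    (u := fun k => 1 / (c ^ 2 * s 0) * (b k / s k))
    (h.summable.mul_left _) Metric.isOpen_ball (convex_ball x r).isPreconnected
    (g := fun k y => (b k : ℂ) / ((s k : ℂ) - y)) (g' := fun k y => (b k : ℂ) / ((s k : ℂ) - y) ^ 2)
    (fun k y hy => ?_) (fun k y hy => ?_) (Metric.mem_ball_self hr)
    (h.summable_norm hx).of_norm (Metric.mem_ball_self hr)
  · have h1 := hb y hy k
    have h2 : (s k : ℂ) - y ≠ 0 := norm_pos_iff.1 (lt_of_lt_of_le (mul_pos hc (h.pos k)) h1)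
    have := (((hasDerivAt_id y).const_sub (s k : ℂ)).inv h2).const_mul (b k : ℂ)
    simp only [div_eq_mul_inv, id] at this ⊢
    refine this.congr_deriv ?_
    simp
  · have h1 := hb y hy k
    have hk := h.pos k
    have hbk := h.nonneg k
    rw [norm_div, Complex.norm_real, Real.norm_of_nonneg hbk, norm_pow]
    have h4 : s 0 ≤ s k := h.strictMono.monotone (Nat.zero_le k)
    calc b k / ‖(s k : ℂ) - y‖ ^ 2 ≤ b k / (c * s k) ^ 2 := by gcongr
      _ ≤ b k / (c ^ 2 * (s 0 * s k)) := by
        rw [mul_pow, pow_two (s k)]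
        gcongr
      _ = 1 / (c ^ 2 * s 0) * (b k / s k) := by field_simp

theorem summable_real (h : IsCauchyData b s) {x : ℝ} (hx : ∀ k, x ≠ s k) :
    Summable fun k => b k / (s k - x) := by
  have := (h.summable_norm (x := (x : ℂ)) (fun k => by exact_mod_cast hx k)).of_norm
  rw [← Complex.summable_ofReal]
  simpa using this

theorem summable_sq (h : IsCauchyData b s) {x : ℝ} (hx : ∀ k, x ≠ s k) :
    Summable fun k => b k / (s k - x) ^ 2 := by
  obtain ⟨r, hr, c, hc, hb⟩ := h.exists_lower_bound (x₀ := (x : ℂ))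
    (fun k => by exact_mod_cast hx k)
  have hl0 := h.pos 0
  refine Summable.of_nonneg_of_le (fun k => div_nonneg (h.nonneg k) (sq_nonneg _)) (fun k => ?_)
    (h.summable.mul_left (1 / (c ^ 2 * s 0)))
  have h1 := hb (x : ℂ) (by simpa using hr) k
  rw [← Complex.ofReal_sub, Complex.norm_real, Real.norm_eq_abs] at h1
  have hk := h.pos k
  have h4 : s 0 ≤ s k := h.strictMono.monotone (Nat.zero_le k)
  have h5 := h.nonneg k
  rw [← sq_abs]
  calc b k / |s k - x| ^ 2 ≤ b k / (c * s k) ^ 2 := by gcongr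
    _ ≤ b k / (c ^ 2 * (s 0 * s k)) := by
      rw [mul_pow, pow_two (s k)]
      gcongr
    _ = 1 / (c ^ 2 * s 0) * (b k / s k) := by field_simp

theorem tsum_sq_pos (h : IsCauchyData b s) (hb : ∀ k, 0 < b k) {x : ℝ} (hx : ∀ k, x ≠ s k) :
    0 < ∑' k, b k / (s k - x) ^ 2 := by
  refine (h.summable_sq hx).tsum_pos (fun k => div_nonneg (hb k).le (sq_nonneg _)) 0
    (div_pos (hb 0) ?_)
  have := sub_ne_zero.2 (hx 0).symm
  positivity

theorem ofReal (x : ℝ) : cauchySum b s x = cauchySumReal b s x := by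
  simp [cauchySum, cauchySumReal, Complex.ofReal_tsum]

theorem continuousAt_real (h : IsCauchyData b s) {x : ℝ} (hx : ∀ k, x ≠ s k) :
    ContinuousAt (cauchySumReal b s) x := by
  have h1 := (h.hasDerivAt (x := (x : ℂ)) (fun k => by exact_mod_cast hx k)).continuousAt
  have h2 : ContinuousAt (fun y : ℝ => (cauchySum b s y).re) x :=
    Complex.continuous_re.continuousAt.comp (h1.comp Complex.continuous_ofReal.continuousAt)
  simpa [ofReal] using h2

/-- `x` and `y` are not separated by any node. -/
theorem div_le_div_gap {c l x y : ℝ} (hc : 0 ≤ c) (hxy : x ≤ y) (h : y < l ∨ l < x) :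
    c / (l - x) ≤ c / (l - y) := by
  rcases h with h | h
  · have : 0 < l - y := by linarith
    gcongr
  · rw [← neg_sub x l, ← neg_sub y l, div_neg, div_neg, neg_le_neg_iff]
    have : 0 < x - l := by linarith
    gcongr

theorem monotone_gap (h : IsCauchyData b s) {x y : ℝ} (hxy : x ≤ y)
    (hg : ∀ k, y < s k ∨ s k < x) : cauchySumReal b s x ≤ cauchySumReal b s y := by
  refine Summable.tsum_le_tsum (fun k => div_le_div_gap (h.nonneg k) hxy (hg k))
    (h.summable_real fun k => ?_) (h.summable_real fun k => ?_)
  · rcases hg k with h | h <;> intro h' <;> linarith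
  · rcases hg k with h | h <;> intro h' <;> linarith

theorem strictMono_gap (h : IsCauchyData b s) {x y : ℝ} (hxy : x < y)
    (hg : ∀ k, y < s k ∨ s k < x) {i : ℕ} (hi : 0 < b i) :
    cauchySumReal b s x < cauchySumReal b s y := by
  refine Summable.tsum_lt_tsum (i := i) (fun k => div_le_div_gap (h.nonneg k) hxy.le (hg k)) ?_
    (h.summable_real fun k => ?_) (h.summable_real fun k => ?_)
  · rcases hg i with h | h
    · have : 0 < s i - y := by linarith
      gcongr
    · rw [← neg_sub x, ← neg_sub y, div_neg, div_neg, neg_lt_neg_iff]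
      have : 0 < x - s i := by linarith
      gcongr
  · rcases hg k with h | h <;> intro h' <;> linarith
  · rcases hg k with h | h <;> intro h' <;> linarith

/-- Increments of `cauchySumReal` across a gap dominate those of any single term. -/
theorem sub_le_sub_gap (h : IsCauchyData b s) {x y : ℝ} (hxy : x ≤ y)
    (hg : ∀ k, y < s k ∨ s k < x) (i : ℕ) :
    b i / (s i - y) - b i / (s i - x) ≤ cauchySumReal b s y - cauchySumReal b s x := by
  have hx := h.summable_real (x := x) fun k => by
    rcases hg k with h | h <;> intro h' <;> linarith
  have hy := h.summable_real (x := y) fun k => by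
    rcases hg k with h | h <;> intro h' <;> linarith
  unfold cauchySumReal
  rw [← hy.tsum_sub hx]
  exact (hy.sub hx).le_tsum i fun k _ => sub_nonneg.2 (div_le_div_gap (h.nonneg k) hxy (hg k))

theorem cauchySumReal_nonneg (h : IsCauchyData b s) {x : ℝ} (hx : x < s 0) :
    0 ≤ cauchySumReal b s x :=
  tsum_nonneg fun k => div_nonneg (h.nonneg k)
    (by have := h.strictMono.monotone (Nat.zero_le k); linarith)

theorem gap_of_lt (h : IsCauchyData b s) {j : ℕ} {x y : ℝ} (hx : ∀ k < j, s k < x) (hy : y < s j)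
    (k : ℕ) : y < s k ∨ s k < x := by
  rcases lt_or_ge k j with hk | hk
  · exact Or.inr (hx k hk)
  · exact Or.inl (hy.trans_le (h.strictMono.monotone hk))

/-- The single term with node `s j` tends to `+∞` there, and by `sub_le_sub_gap` the whole sum grows
at least as much as that term. -/
theorem exists_gt_level (h : IsCauchyData b s) {j : ℕ} (hj : 0 < b j) {x : ℝ}
    (hx : ∀ k < j, s k < x) (hxj : x < s j) (v : ℝ) :
    ∃ y, x < y ∧ y < s j ∧ v < cauchySumReal b s y := by
  have h1 : Tendsto (fun y => b j / (s j - y) - b j / (s j - x) + cauchySumReal b s x)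
      (𝓝[<] (s j)) atTop := by
    refine tendsto_atTop_add_const_right _ _ (tendsto_atTop_add_const_right _ _ ?_)
    have : Tendsto (fun y => s j - y) (𝓝[<] (s j)) (𝓝[>] 0) := by
      refine tendsto_nhdsWithin_iff.2 ⟨?_, ?_⟩
      · have : Tendsto (fun y => s j - y) (𝓝 (s j)) (𝓝 (s j - s j)) :=
          tendsto_const_nhds.sub tendsto_id
        rw [sub_self] at this
        exact this.mono_left nhdsWithin_le_nhds
      · filter_upwards [self_mem_nhdsWithin] with y hy
        simpa using hy
    simpa [div_eq_mul_inv] using (tendsto_inv_nhdsGT_zero.comp this).const_mul_atTop hj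
  have h2 : ∀ᶠ y in 𝓝[<] (s j), x < y :=
    (eventually_gt_nhds hxj).filter_mono nhdsWithin_le_nhds
  obtain ⟨y, hy1, hy2, hy3⟩ :=
    ((h1.eventually_gt_atTop v).and (h2.and self_mem_nhdsWithin)).exists
  refine ⟨y, hy2, hy3, ?_⟩
  have := h.sub_le_sub_gap hy2.le (h.gap_of_lt hx hy3) j
  linarith

theorem exists_lt_level (h : IsCauchyData b s) {j : ℕ} (hj : 0 < b j) {x : ℝ}
    (hx : s j < x) (hxj : x < s (j + 1)) (v : ℝ) :
    ∃ y, s j < y ∧ y < x ∧ cauchySumReal b s y < v := by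
  have h1 : Tendsto (fun y => b j / (s j - y) - b j / (s j - x) + cauchySumReal b s x)
      (𝓝[>] (s j)) atBot := by
    refine tendsto_atBot_add_const_right _ _ (tendsto_atBot_add_const_right _ _ ?_)
    have : Tendsto (fun y => s j - y) (𝓝[>] (s j)) (𝓝[<] 0) := by
      refine tendsto_nhdsWithin_iff.2 ⟨?_, ?_⟩
      · have : Tendsto (fun y => s j - y) (𝓝 (s j)) (𝓝 (s j - s j)) :=
          tendsto_const_nhds.sub tendsto_id
        rw [sub_self] at this
        exact this.mono_left nhdsWithin_le_nhds
      · filter_upwards [self_mem_nhdsWithin] with y hy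
        simpa using hy
    simpa [div_eq_mul_inv] using (tendsto_inv_nhdsLT_zero.comp this).const_mul_atBot hj
  have h2 : ∀ᶠ y in 𝓝[>] (s j), y < x :=
    (eventually_lt_nhds hx).filter_mono nhdsWithin_le_nhds
  obtain ⟨y, hy1, hy2, hy3⟩ :=
    ((h1.eventually_lt_atBot v).and (h2.and self_mem_nhdsWithin)).exists
  refine ⟨y, hy3, hy2, ?_⟩
  have := h.sub_le_sub_gap hy2.le (h.gap_of_lt (j := j + 1) (fun k hk =>
    (h.strictMono.monotone (Nat.lt_succ_iff.1 hk)).trans_lt hy3) hxj) j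
  linarith

/-- A value above `m (x₀)` is attained between `x₀` and the next node. -/
theorem exists_root (h : IsCauchyData b s) {j : ℕ} (hj : 0 < b j) {x₀ v : ℝ}
    (hx : ∀ k < j, s k < x₀) (hxj : x₀ < s j) (hv : cauchySumReal b s x₀ < v) :
    ∃ y, x₀ < y ∧ y < s j ∧ cauchySumReal b s y = v := by
  obtain ⟨z, hz1, hz2, hz3⟩ := h.exists_gt_level hj hx hxj v
  have hc : ContinuousOn (cauchySumReal b s) (Icc x₀ z) := fun y hy =>
    (h.continuousAt_real fun k hk => by
      rcases h.gap_of_lt hx hz2 k with h' | h' <;> [linarith [hy.2]; linarith [hy.1]]).continuousWithinAt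
  obtain ⟨y, hy, rfl⟩ := intermediate_value_Ioo hz1.le hc ⟨hv, hz3⟩
  exact ⟨y, hy.1, hy.2.trans hz2, rfl⟩

end IsCauchyData

/-! ### Roots of `m = v` and partial fractions of `v m / (v - m)`. -/

/-- Partial fractions of `v m / (v - m)` for a finite sum `m (x) = ∑ a_k / (p_k - x)`, when all the
solutions `μ_j` of `m = v` are known. -/
theorem sum_partialFractions {N : ℕ} (a p μ : Fin N → ℝ) (ha : ∀ k, 0 < a k)
    (hμ : Function.Injective μ) (hp : ∀ k j, p k ≠ μ j) {v : ℝ}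
    (hroot : ∀ j, ∑ k, a k / (p k - μ j) = v) {x : ℝ} (hx : ∀ k, p k ≠ x) (hxμ : ∀ j, μ j ≠ x) :
    ∑ k, a k / (p k - x) =
      ∑ j, v * (v - ∑ k, a k / (p k - x)) / ((μ j - x) * ∑ k, a k / (p k - μ j) ^ 2) := by
  -- Subtracting `m (y)` from `m (μ j) = v` term by term brings out the factor `μ j - y`.
  have hcross : ∀ (j : Fin N) (y : ℝ), (∀ k, p k ≠ y) → μ j ≠ y →
      ∑ k, a k / ((p k - μ j) * (p k - y)) = (v - ∑ k, a k / (p k - y)) / (μ j - y) := by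
    intro j y hy hjy
    rw [← hroot j, ← Finset.sum_sub_distrib, Finset.sum_div]
    refine Finset.sum_congr rfl fun k _ => ?_
    have h1 := sub_ne_zero.2 (hp k j)
    have h2 := sub_ne_zero.2 (hy k)
    have h3 := sub_ne_zero.2 hjy
    field_simp
    ring
  have hD : ∀ j, 0 < ∑ k, a k / (p k - μ j) ^ 2 := fun j => by
    have : (Finset.univ : Finset (Fin N)).Nonempty := ⟨j, Finset.mem_univ _⟩
    refine Finset.sum_pos (fun k _ => div_pos (ha k) ?_) this
    have := sub_ne_zero.2 (hp k j)
    positivity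
  -- `Q` is a Cauchy matrix. By `hcross` at `y = μ i` the off-diagonal entries of `P * Q` vanish,
  -- and the denominators of `P` normalise the diagonal.
  let P : Matrix (Fin N) (Fin N) ℝ := fun j k =>
    a k / ((p k - μ j) * ∑ k, a k / (p k - μ j) ^ 2)
  let Q : Matrix (Fin N) (Fin N) ℝ := fun k j => 1 / (p k - μ j)
  have hPQ : P * Q = 1 := by
    ext j i
    rw [Matrix.mul_apply]
    have : ∀ k, P j k * Q k i =
        a k / ((p k - μ j) * (p k - μ i)) / ∑ k, a k / (p k - μ j) ^ 2 := by
      intro k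
      have h1 := sub_ne_zero.2 (hp k j)
      have h2 := sub_ne_zero.2 (hp k i)
      have h3 := (hD j).ne'
      simp only [P, Q]
      field_simp
    rw [Finset.sum_congr rfl fun k _ => this k, ← Finset.sum_div]
    rcases eq_or_ne j i with rfl | hji
    · rw [Matrix.one_apply_eq]
      simp_rw [← pow_two]
      exact div_self (hD j).ne'
    · rw [Matrix.one_apply_ne hji, hcross j (μ i) (fun k => hp k i) (hμ.ne hji), hroot i]
      simp
  -- A left inverse of a square matrix is also a right inverse, so `Q * P` may be inserted into `a
  -- ⬝ᵥ r`. Then `a` times `Q` is constantly `v` by `hroot`, and `P` applied to `r` is given by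
  -- `hcross` at `y = x`.
  have hQP : Q * P = 1 := mul_eq_one_comm.1 hPQ
  let r : Fin N → ℝ := fun k => 1 / (p k - x)
  have key : a ⬝ᵥ r = (Matrix.vecMul a Q) ⬝ᵥ (P.mulVec r) := by
    rw [← Matrix.dotProduct_mulVec, Matrix.mulVec_mulVec, hQP, Matrix.one_mulVec]
  have h1 : a ⬝ᵥ r = ∑ k, a k / (p k - x) := by
    simp only [dotProduct, r]
    exact Finset.sum_congr rfl fun k _ => by ring
  refine (h1.symm.trans key).trans (Finset.sum_congr rfl fun j _ => ?_)
  have h2 : Matrix.vecMul a Q j = v := by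
    rw [← hroot j]
    simp only [Matrix.vecMul, dotProduct, Q]
    exact Finset.sum_congr rfl fun k _ => by ring
  have h3 : P.mulVec r j =
      (v - ∑ k, a k / (p k - x)) / (μ j - x) / ∑ k, a k / (p k - μ j) ^ 2 := by
    rw [← hcross j x hx (hxμ j), Finset.sum_div]
    simp only [Matrix.mulVec, dotProduct, P, r]
    refine Finset.sum_congr rfl fun k _ => ?_
    have h1 := sub_ne_zero.2 (hp k j)
    have h2 := sub_ne_zero.2 (hx k)
    have h3 := (hD j).ne'
    field_simp
  rw [h2, h3]
  have h4 := sub_ne_zero.2 (hxμ j)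
  have h5 := (hD j).ne'
  field_simp

namespace IsCauchyData

variable {a l : ℕ → ℝ}

/-- The weights of the first `N` terms. -/
def truncate (a : ℕ → ℝ) (N k : ℕ) : ℝ := if k < N then a k else 0

theorem truncate_le (h : IsCauchyData a l) (N k : ℕ) : truncate a N k ≤ a k := by
  unfold truncate
  split_ifs
  · exact le_rfl
  · exact h.nonneg k

theorem truncate_nonneg (h : IsCauchyData a l) (N k : ℕ) : 0 ≤ truncate a N k := by
  unfold truncate
  split_ifs
  · exact h.nonneg k
  · exact le_rfl

/-- All nodes are kept and the weights from `N` on become zero. This is why `IsCauchyData` requires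
only nonnegative weights: the lemmas on gaps then apply to truncations. -/
theorem truncated (h : IsCauchyData a l) (N : ℕ) : IsCauchyData (truncate a N) l where
  strictMono := h.strictMono
  pos := h.pos
  tendsto := h.tendsto
  nonneg := h.truncate_nonneg N
  summable := Summable.of_nonneg_of_le (fun k => div_nonneg (h.truncate_nonneg N k) (h.pos k).le)
    (fun k => div_le_div_of_nonneg_right (h.truncate_le N k) (h.pos k).le) h.summable

theorem tsum_truncate (N : ℕ) (f : ℕ → ℝ) :
    ∑' k, truncate a N k / f k = ∑ k ∈ Finset.range N, a k / f k := by
  rw [tsum_eq_sum (s := Finset.range N)]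
  · refine Finset.sum_congr rfl fun k hk => ?_
    rw [truncate, if_pos (Finset.mem_range.1 hk)]
  · intro k hk
    rw [truncate, if_neg (fun h => hk (Finset.mem_range.2 h)), zero_div]

theorem tendsto_truncate (h : IsCauchyData a l) {x : ℝ} (hx : ∀ k, x ≠ l k) :
    Tendsto (fun N => cauchySumReal (truncate a N) l x) atTop (𝓝 (cauchySumReal a l x)) := by
  simp only [cauchySumReal, tsum_truncate]
  exact (h.summable_real hx).hasSum.tendsto_sum_nat

theorem truncate_sum_le (h : IsCauchyData a l) {x : ℝ} {N : ℕ} (hx : ∀ k, x ≠ l k)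
    (hN : x < l N) : cauchySumReal (truncate a N) l x ≤ cauchySumReal a l x := by
  refine Summable.tsum_le_tsum (fun k => ?_) ((h.truncated N).summable_real hx) (h.summable_real hx)
  unfold truncate
  split_ifs with hk
  · exact le_rfl
  · rw [zero_div]
    have := h.strictMono.monotone (not_lt.1 hk)
    exact div_nonneg (h.nonneg k) (by linarith)

/-- Intermediate values: `m` tends to `-∞` at the left node of the gap and to `+∞` at the right one;
the first gap starts from `0`, where `m < v` by assumption. Positivity is asked only up to index
`j`, so that truncations qualify. -/
theorem exists_root_gap (h : IsCauchyData a l) {v : ℝ} (hv : cauchySumReal a l 0 < v) (j : ℕ)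
    (ha : ∀ k ≤ j, 0 < a k) :
    ∃ y, 0 < y ∧ (∀ k < j, l k < y) ∧ y < l j ∧ cauchySumReal a l y = v := by
  cases j with
  | zero =>
    obtain ⟨y, h1, h2, h3⟩ := h.exists_root (ha 0 le_rfl) (x₀ := 0) (by simp) (h.pos 0) hv
    exact ⟨y, h1, by simp, h2, h3⟩
  | succ j =>
    have hj := h.strictMono (Nat.lt_succ_self j)
    obtain ⟨x, hx1, hx2, hx3⟩ := h.exists_lt_level (ha j (Nat.le_succ j))
      (x := (l j + l (j + 1)) / 2) (by linarith) (by linarith) v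
    have hk : ∀ k < j + 1, l k < x := fun k hk =>
      (h.strictMono.monotone (Nat.lt_succ_iff.1 hk)).trans_lt hx1
    obtain ⟨y, h1, h2, h3⟩ := h.exists_root (ha (j + 1) le_rfl) hk (by linarith) hx3
    exact ⟨y, (h.pos j).trans (hx1.trans h1), fun k hk' => (hk k hk').trans h1, h2, h3⟩

/-- The solutions `μ_0 < l_0 < μ_1 < l_1 < ⋯` of `m = v`. -/
structure IsRootSeq (a l : ℕ → ℝ) (v : ℝ) (μ : ℕ → ℝ) : Prop where
  pos : ∀ j, 0 < μ j
  gt : ∀ j, ∀ k < j, l k < μ j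
  lt : ∀ j, μ j < l j
  root : ∀ j, cauchySumReal a l (μ j) = v

theorem exists_isRootSeq (h : IsCauchyData a l) (ha : ∀ k, 0 < a k) {v : ℝ}
    (hv : cauchySumReal a l 0 < v) : ∃ μ, IsRootSeq a l v μ := by
  choose μ h1 h2 h3 h4 using fun j => h.exists_root_gap hv j fun k _ => ha k
  exact ⟨μ, h1, h2, h3, h4⟩

namespace IsRootSeq

variable {v : ℝ} {μ : ℕ → ℝ}

theorem gap (hμ : IsRootSeq a l v μ) (h : IsCauchyData a l) (j k : ℕ) : μ j ≠ l k := by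
  rcases h.gap_of_lt (hμ.gt j) (hμ.lt j) k with h | h
  · exact h.ne
  · exact h.ne'

theorem strictMono (hμ : IsRootSeq a l v μ) : StrictMono μ :=
  strictMono_nat_of_lt_succ fun j => (hμ.lt j).trans (hμ.gt (j + 1) j (Nat.lt_succ_self j))

/-- Every positive solution of `m = v` is in the sequence. -/
theorem exists_eq (hμ : IsRootSeq a l v μ) (h : IsCauchyData a l) (ha : ∀ k, 0 < a k) {x : ℝ}
    (hx : ∀ k, x ≠ l k) (hxv : cauchySumReal a l x = v) : ∃ j, x = μ j := by
  classical
  have hex : ∃ j, x < l j := (h.tendsto.eventually_gt_atTop x).exists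
  set j := Nat.find hex with hj
  have h1 : x < l j := Nat.find_spec hex
  have h2 : ∀ k < j, l k < x := fun k hk =>
    lt_of_le_of_ne (not_lt.1 (Nat.find_min hex hk)) (hx k).symm
  refine ⟨j, ?_⟩
  rcases lt_trichotomy x (μ j) with hlt | heq | hgt
  · have := h.strictMono_gap hlt (h.gap_of_lt h2 (hμ.lt j)) (ha 0)
    rw [hxv, hμ.root j] at this
    exact absurd this (lt_irrefl _)
  · exact heq
  · have := h.strictMono_gap hgt (h.gap_of_lt (hμ.gt j) h1) (ha 0)
    rw [hxv, hμ.root j] at this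
    exact absurd this (lt_irrefl _)

end IsRootSeq

theorem exists_truncated_roots (h : IsCauchyData a l) (ha : ∀ k, 0 < a k) {v : ℝ}
    (hv : cauchySumReal a l 0 < v) (N : ℕ) :
    ∃ μ : ℕ → ℝ, ∀ j < N, 0 < μ j ∧ (∀ k < j, l k < μ j) ∧ μ j < l j ∧
      cauchySumReal (truncate a N) l (μ j) = v := by
  have : ∀ j, ∃ y, j < N → 0 < y ∧ (∀ k < j, l k < y) ∧ y < l j ∧
      cauchySumReal (truncate a N) l y = v := by
    intro j
    by_cases hj : j < N
    · obtain ⟨y, hy⟩ := (h.truncated N).exists_root_gap (v := v)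
        ((h.truncate_sum_le (fun k => (h.pos k).ne) (h.pos N)).trans_lt hv) j fun k hk => by
          rw [truncate, if_pos (hk.trans_lt hj)]
          exact ha k
      exact ⟨y, fun _ => hy⟩
    · exact ⟨0, fun h => absurd h hj⟩
  choose μ hμ using this
  exact ⟨μ, hμ⟩

/-- The truncation lies below `m` to the left of `l N`, so its root is not smaller than `μ j`.
Slightly to the right of `μ j` the limit exceeds `v`, hence so do late truncations, and their roots
lie further left. -/
theorem tendsto_truncated_root (h : IsCauchyData a l) (ha : ∀ k, 0 < a k) {v : ℝ} {μ : ℕ → ℝ}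
    (hμ : IsRootSeq a l v μ) {ν : ℕ → ℕ → ℝ}
    (hν : ∀ N, ∀ j < N, 0 < ν N j ∧ (∀ k < j, l k < ν N j) ∧ ν N j < l j ∧
      cauchySumReal (truncate a N) l (ν N j) = v) (j : ℕ) :
    Tendsto (fun N => ν N j) atTop (𝓝 (μ j)) := by
  have htr : ∀ N, j < N → 0 < truncate a N j := fun N hN => by
    rw [truncate, if_pos hN]
    exact ha j
  refine tendsto_order.2 ⟨fun x hx => ?_, fun x hx => ?_⟩
  · filter_upwards [eventually_gt_atTop j] with N hN
    obtain ⟨h1, h2, h3, h4⟩ := hν N j hN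
    refine hx.trans_le (not_lt.1 fun hlt => ?_)
    have h5 := (h.truncated N).strictMono_gap hlt (h.gap_of_lt h2 (hμ.lt j)) (htr N hN)
    have h6 := h.truncate_sum_le (N := N) (hμ.gap h j) ((hμ.lt j).trans (h.strictMono hN))
    rw [hμ.root j] at h6
    linarith
  · have hlj := hμ.lt j
    set y := min x ((μ j + l j) / 2) with hy
    have hy1 : μ j < y := lt_min hx (by linarith)
    have hy2 : y < l j := (min_le_right _ _).trans_lt (by linarith)
    have hyx : y ≤ x := min_le_left _ _
    have hm := h.strictMono_gap hy1 (h.gap_of_lt (hμ.gt j) hy2) (ha 0)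
    rw [hμ.root j] at hm
    have hyl : ∀ k, y ≠ l k := fun k => by
      rcases h.gap_of_lt (hμ.gt j) hy2 k with h' | h'
      · exact h'.ne
      · exact (h'.trans hy1).ne'
    filter_upwards [eventually_gt_atTop j, (h.tendsto_truncate hyl).eventually_const_lt hm]
      with N hN hN2
    obtain ⟨h1, h2, h3, h4⟩ := hν N j hN
    refine lt_of_lt_of_le (not_le.1 fun hle => ?_) hyx
    have h5 := (h.truncated N).monotone_gap hle
      (h.gap_of_lt (fun k hk => (hμ.gt j k hk).trans hy1) h3)
    linarith

theorem tendsto_truncated_deriv (h : IsCauchyData a l) {v : ℝ} {μ : ℕ → ℝ}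
    (hμ : IsRootSeq a l v μ) {y : ℕ → ℝ} {j : ℕ} (hy : Tendsto y atTop (𝓝 (μ j))) :
    Tendsto (fun N => ∑' k, truncate a N k / (l k - y N) ^ 2) atTop
      (𝓝 (∑' k, a k / (l k - μ j) ^ 2)) := by
  obtain ⟨r, hr, c, hc, hb⟩ := h.exists_lower_bound (x₀ := (μ j : ℂ))
    (fun k => by exact_mod_cast hμ.gap h j k)
  have hl0 := h.pos 0
  refine tendsto_tsum_of_dominated_convergence (bound := fun k => 1 / (c ^ 2 * l 0) * (a k / l k))
    (h.summable.mul_left _) (fun k => ?_) ?_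
  · have h1 : Tendsto (fun N => truncate a N k) atTop (𝓝 (a k)) :=
      tendsto_const_nhds.congr' (by
        filter_upwards [eventually_gt_atTop k] with N hN
        rw [truncate, if_pos hN])
    exact h1.div ((tendsto_const_nhds.sub hy).pow 2)
      (pow_ne_zero 2 (sub_ne_zero.2 (hμ.gap h j k).symm))
  · filter_upwards [hy.eventually (Metric.ball_mem_nhds _ hr)] with N hN k
    have h1 := hb (y N : ℂ) (by simpa [Complex.dist_eq, ← Complex.ofReal_sub, Real.dist_eq] using hN) k
    rw [← Complex.ofReal_sub, Complex.norm_real] at h1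
    have hk := h.pos k
    have h4 : l 0 ≤ l k := h.strictMono.monotone (Nat.zero_le k)
    have h5 := h.nonneg k
    rw [norm_div, Real.norm_of_nonneg (h.truncate_nonneg N k), norm_pow]
    calc truncate a N k / ‖l k - y N‖ ^ 2 ≤ a k / (c * l k) ^ 2 := by
          have := h.truncate_le N k
          gcongr
      _ ≤ a k / (c ^ 2 * (l 0 * l k)) := by
        rw [mul_pow, pow_two (l k)]
        gcongr
      _ = 1 / (c ^ 2 * l 0) * (a k / l k) := by field_simp

theorem level_mono {v s t : ℝ} (hs : 0 ≤ s) (hst : s ≤ t) (ht : t < v) :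
    v * s / (v - s) ≤ v * t / (v - t) := by
  have : 0 ≤ v * t := mul_nonneg (by linarith) (by linarith)
  have : 0 < v - t := by linarith
  have : 0 < v := by linarith
  gcongr

theorem tendsto_atBot_zero (h : IsCauchyData a l) :
    Tendsto (fun J => cauchySumReal a l (-l J)) atTop (𝓝 0) := by
  have : Tendsto (fun J => ∑' k, a k / (l k - -l J)) atTop (𝓝 (∑' _ : ℕ, (0 : ℝ))) := by
    refine tendsto_tsum_of_dominated_convergence h.summable (fun k => ?_) (.of_forall fun J k => ?_)
    · have : Tendsto (fun J => l k - -l J) atTop atTop := by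
        simpa using tendsto_atTop_add_const_left _ (l k) h.tendsto
      exact this.const_div_atTop (a k)
    · have h1 := h.pos k
      have h2 := h.pos J
      have h3 := h.nonneg k
      rw [Real.norm_of_nonneg (div_nonneg h3 (by linarith))]
      gcongr
      linarith
  simpa [cauchySumReal] using this

/-- Partial fractions of `v m / (v - m)` on the negative half-line. -/
theorem hasSum_partialFractions (h : IsCauchyData a l) (ha : ∀ k, 0 < a k) {v : ℝ} {μ : ℕ → ℝ}
    (hv : cauchySumReal a l 0 < v) (hμ : IsRootSeq a l v μ) {y : ℝ} (hy : 0 ≤ y) :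
    HasSum (fun j => v ^ 2 / (∑' k, a k / (l k - μ j) ^ 2) / (μ j + y))
      (v * cauchySumReal a l (-y) / (v - cauchySumReal a l (-y))) := by
  choose ν hν using h.exists_truncated_roots ha hv
  have hneg : ∀ z : ℝ, 0 ≤ z → ∀ k, -z ≠ l k := fun z hz k => by
    have := h.pos k
    intro h'
    linarith
  have hmv : ∀ z : ℝ, 0 ≤ z → cauchySumReal a l (-z) < v := fun z hz =>
    (h.monotone_gap (by linarith) fun k => Or.inl (h.pos k)).trans_lt hv
  set F : ℝ → ℝ := fun z => v * cauchySumReal a l (-z) / (v - cauchySumReal a l (-z)) with hF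
  set D : ℕ → ℕ → ℝ := fun N j => ∑ k ∈ Finset.range N, a k / (l k - ν N j) ^ 2 with hDdef
  have hνl : ∀ N, ∀ j < N, ∀ k, l k ≠ ν N j := fun N j hj k => by
    obtain ⟨h1, h2, h3, h4⟩ := hν N j hj
    rcases h.gap_of_lt h2 h3 k with h' | h'
    · exact h'.ne'
    · exact h'.ne
  have hD : ∀ N, ∀ j < N, 0 < D N j := fun N j hj => by
    refine Finset.sum_pos (fun k _ => div_pos (ha k) ?_) ⟨j, Finset.mem_range.2 hj⟩
    have := sub_ne_zero.2 (hνl N j hj k)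
    positivity
  have hfin : ∀ N, ∀ z : ℝ, 0 ≤ z → ∑ j ∈ Finset.range N, v ^ 2 / D N j / (ν N j + z) =
      v * cauchySumReal (truncate a N) l (-z) / (v - cauchySumReal (truncate a N) l (-z)) := by
    intro N z hz
    have hN := (h.truncate_sum_le (N := N) (hneg z hz) (by linarith [h.pos N])).trans_lt (hmv z hz)
    have key := sum_partialFractions (N := N) (fun k => a k) (fun k => l k) (fun j => ν N j)
      (fun k => ha k) (fun i j hij => ?_) (fun k j => hνl N j j.2 k) (v := v) (fun j => ?_)
      (x := -z) (fun k => (hneg z hz k).symm) (fun j => ?_)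
    · simp only [cauchySumReal, tsum_truncate] at hN ⊢
      rw [eq_div_iff (by linarith), Finset.sum_mul]
      rw [Finset.sum_range (fun k => a k / (l k - -z)), Finset.sum_range]
      rw [Finset.sum_range (fun k => a k / (l k - -z))] at hN
      conv_rhs => rw [key, Finset.mul_sum]
      refine Finset.sum_congr rfl fun j _ => ?_
      have h1 := (hD N j j.2).ne'
      have h2 : ν N j + z ≠ 0 := by linarith [(hν N j j.2).1]
      simp only [hDdef] at h1 ⊢
      rw [Finset.sum_range] at h1 ⊢
      rw [sub_neg_eq_add]
      field_simp
    · by_contra hne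
      have hlt : ∀ i j : Fin N, i < j → ν N i < ν N j := fun i j hij =>
        (hν N i i.2).2.2.1.trans ((hν N j j.2).2.1 i hij)
      rcases lt_or_gt_of_ne hne with h' | h'
      · exact (hlt _ _ h').ne hij
      · exact (hlt _ _ h').ne hij.symm
    · have := (hν N j j.2).2.2.2
      simp only [cauchySumReal, tsum_truncate] at this
      rw [Finset.sum_range] at this
      exact this
    · have := (hν N j j.2).1
      intro h'
      linarith
  have hterm : ∀ N, ∀ j < N, ∀ z : ℝ, 0 ≤ z → 0 ≤ v ^ 2 / D N j / (ν N j + z) := by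
    intro N j hj z hz
    have h1 := hD N j hj
    have h2 := (hν N j hj).1
    positivity
  -- The truncated sum is at most `m`, and `s ↦ v s / (v - s)` is increasing below `v`.
  have hFN : ∀ N, ∀ z : ℝ, 0 ≤ z → ∑ j ∈ Finset.range N, v ^ 2 / D N j / (ν N j + z) ≤ F z := by
    intro N z hz
    rw [hfin N z hz]
    exact level_mono ((h.truncated N).cauchySumReal_nonneg (by linarith [h.pos 0]))
      (h.truncate_sum_le (hneg z hz) (by linarith [h.pos N])) (hmv z hz)
  have hlimD : ∀ j, Tendsto (fun N => D N j) atTop (𝓝 (∑' k, a k / (l k - μ j) ^ 2)) := fun j => by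
    simpa only [tsum_truncate] using
      h.tendsto_truncated_deriv hμ (h.tendsto_truncated_root ha hμ hν j)
  have hDpos : ∀ j, 0 < ∑' k, a k / (l k - μ j) ^ 2 := fun j => h.tsum_sq_pos ha (hμ.gap h j)
  have hlim : ∀ J, Tendsto (fun N => ∑ j ∈ Finset.range J, v ^ 2 / D N j / (ν N j + y)) atTop
      (𝓝 (∑ j ∈ Finset.range J, v ^ 2 / (∑' k, a k / (l k - μ j) ^ 2) / (μ j + y))) := fun J =>
    tendsto_finsetSum _ fun j _ => (tendsto_const_nhds.div (hlimD j) (hDpos j).ne').div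
      ((h.tendsto_truncated_root ha hμ hν j).add_const y) (by linarith [hμ.pos j])
  have hlimF : Tendsto (fun N => ∑ j ∈ Finset.range N, v ^ 2 / D N j / (ν N j + y)) atTop
      (𝓝 (F y)) := by
    refine Tendsto.congr (fun N => (hfin N y hy).symm) ?_
    have := h.tendsto_truncate (hneg y hy)
    exact (this.const_mul v).div (this.const_sub v) (by linarith [hmv y hy])
  have hupper : ∀ J, ∑ j ∈ Finset.range J, v ^ 2 / (∑' k, a k / (l k - μ j) ^ 2) / (μ j + y) ≤
      F y := fun J => by
    refine le_of_tendsto (hlim J) ?_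
    filter_upwards [eventually_ge_atTop J] with N hN
    refine le_trans (Finset.sum_le_sum_of_subset_of_nonneg (Finset.range_mono hN)
      fun j hj _ => hterm N j (Finset.mem_range.1 hj) y hy) (hFN N y hy)
  -- Tail estimate, uniform in `N`. For `j > J` the root is at least `l J`, so `ν + l J ≤ 2 (ν +
  -- y)`. The tail at `y` is thus at most twice the full sum at `l J`, which is at most `2 F (l J)`
  -- and tends to `0`.
  have hlower : ∀ J, F y - 2 * F (l J) ≤
      ∑ j ∈ Finset.range (J + 1), v ^ 2 / (∑' k, a k / (l k - μ j) ^ 2) / (μ j + y) := fun J => by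
    have h1 := hlimF.sub (hlim (J + 1))
    have h2 : F y - ∑ j ∈ Finset.range (J + 1),
        v ^ 2 / (∑' k, a k / (l k - μ j) ^ 2) / (μ j + y) ≤ 2 * F (l J) := by
      refine le_of_tendsto h1 ?_
      filter_upwards [eventually_ge_atTop (J + 1)] with N hN
      have hlJ := h.pos J
      rw [← Finset.sum_sdiff (Finset.range_mono hN), add_sub_cancel_right]
      refine le_trans ?_ (mul_le_mul_of_nonneg_left (hFN N (l J) hlJ.le) zero_le_two)
      rw [Finset.mul_sum]
      refine le_trans (Finset.sum_le_sum fun j hj => ?_) (Finset.sum_le_sum_of_subset_of_nonneg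
        Finset.sdiff_subset fun j hj _ =>
          mul_nonneg zero_le_two (hterm N j (Finset.mem_range.1 hj) _ hlJ.le))
      simp only [Finset.mem_sdiff, Finset.mem_range, not_lt] at hj
      obtain ⟨hν1, hν2, -, -⟩ := hν N j hj.1
      have hνJ := hν2 J (by omega)
      have hDj := hD N j hj.1
      rw [← mul_div_assoc, div_le_div_iff₀ (by linarith) (by linarith)]
      have h3 : 0 ≤ v ^ 2 / D N j := by positivity
      nlinarith
    linarith
  have hFlim : Tendsto (fun J => F (l J)) atTop (𝓝 0) := by
    have h0 := h.tendsto_atBot_zero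
    have hv0 : 0 < v := (h.cauchySumReal_nonneg (h.pos 0)).trans_lt hv
    have h1 : Tendsto (fun J => F (l J)) atTop (𝓝 (v * 0 / (v - 0))) :=
      (h0.const_mul v).div (h0.const_sub v) (by linarith)
    simpa using h1
  have hnn : ∀ j, 0 ≤ v ^ 2 / (∑' k, a k / (l k - μ j) ^ 2) / (μ j + y) := fun j => by
    have h1 := hDpos j
    have h2 := hμ.pos j
    positivity
  rw [hasSum_iff_tendsto_nat_of_nonneg hnn, ← tendsto_add_atTop_iff_nat 1]
  refine tendsto_of_tendsto_of_tendsto_of_le_of_le (g := fun J => F y - 2 * F (l J)) ?_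
    tendsto_const_nhds hlower fun J => hupper (J + 1)
  simpa using (hFlim.const_mul 2).const_sub (F y)

end IsCauchyData

/-! ### Gamma quotients as Cauchy series. -/

/-- The Taylor coefficients of `(1 - x)^{-a}`. -/
def risingCoeff (a : ℝ) (k : ℕ) : ℝ := Ring.choose (a + k - 1) k

/-- The coefficient is the rising factorial of `a` divided by `k!`. -/
theorem risingCoeff_pos {a : ℝ} (ha : 0 < a) (k : ℕ) : 0 < risingCoeff a k := by
  have h1 : risingCoeff a k = Ring.multichoose a k := by
    rw [risingCoeff, Ring.choose]
    congr 1
    ring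
  have h2 := Ring.factorial_nsmul_multichoose_eq_ascPochhammer a k
  rw [nsmul_eq_mul, Polynomial.ascPochhammer_smeval_eq_eval, ← h1] at h2
  have h3 : (0 : ℝ) < k.factorial := by exact_mod_cast k.factorial_pos
  have h4 := ascPochhammer_pos k a ha
  rw [← h2] at h4
  exact pos_of_mul_pos_right h4 h3.le

theorem hasSum_risingCoeff (a : ℝ) {x : ℝ} (hx0 : 0 ≤ x) (hx1 : x < 1) :
    HasSum (fun k => risingCoeff a k * x ^ k) ((1 - x) ^ (-a)) := by
  have h := (one_div_one_sub_rpow_hasFPowerSeriesOnBall_zero a).hasSum (y := x) (by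
    simp [enorm_eq_nnnorm, ← NNReal.coe_lt_coe, abs_of_nonneg hx0, hx1])
  simp only [FormalMultilinearSeries.ofScalars_apply_eq, zero_add, smul_eq_mul] at h
  rw [Real.rpow_neg (by linarith), ← one_div]
  exact h

/-- The right side is the Beta integral of `x^{u-1} (1-x)^{γ-1}`. Expanding the second factor in its
binomial series, whose coefficients are positive, and integrating term by term gives the left side.
-/
theorem hasSum_beta {u γ : ℝ} (hu : 0 < u) (hγ0 : 0 < γ) (hγ1 : γ < 1) :
    HasSum (fun k : ℕ => risingCoeff (1 - γ) k / (u + k))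
      (Real.Gamma u * Real.Gamma γ / Real.Gamma (u + γ)) := by
  set ν := (volume : Measure ℝ).restrict (Ioo 0 1) with hν
  let f : ℝ → ℝ := fun x => x ^ (u - 1) * (1 - x) ^ (γ - 1)
  let F : ℕ → ℝ → ℝ := fun k x => risingCoeff (1 - γ) k * x ^ (u - 1 + k)
  have hpos : ∀ k, 0 < risingCoeff (1 - γ) k := risingCoeff_pos (by linarith)
  have hcx : ∀ x ∈ Ioo (0 : ℝ) 1, (((x : ℂ) ^ ((u : ℂ) - 1) * (1 - (x : ℂ)) ^ ((γ : ℂ) - 1))).re = f x := by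
    intro x hx
    have h1 : ((x : ℂ) ^ ((u : ℂ) - 1) * (1 - (x : ℂ)) ^ ((γ : ℂ) - 1)) = (f x : ℂ) := by
      simp only [f]
      push_cast
      rw [Complex.ofReal_cpow hx.1.le, Complex.ofReal_cpow (by linarith [hx.2])]
      push_cast
      rfl
    rw [h1, Complex.ofReal_re]
  have hconv := Complex.betaIntegral_convergent (u := u) (v := γ) (by simpa) (by simpa)
  rw [intervalIntegrable_iff_integrableOn_Ioo_of_le zero_le_one] at hconv
  have hf : Integrable f ν :=
    (hconv.re).congr ((ae_restrict_iff' measurableSet_Ioo).2 (.of_forall fun x hx => hcx x hx))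
  have hfint : ∫ x, f x ∂ν = Real.Gamma u * Real.Gamma γ / Real.Gamma (u + γ) := by
    have h1 := ProbabilityTheory.beta_eq_betaIntegralReal u γ hu hγ0
    rw [ProbabilityTheory.beta, Complex.betaIntegral,
      intervalIntegral.integral_of_le zero_le_one, integral_Ioc_eq_integral_Ioo] at h1
    rw [h1, ← RCLike.re_eq_complex_re, ← integral_re hconv]
    exact setIntegral_congr_fun measurableSet_Ioo fun x hx => (hcx x hx).symm
  have hrpow : ∀ k : ℕ, IntegrableOn (fun x : ℝ => x ^ (u - 1 + k)) (Ioo 0 1) ∧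
      ∫ x in Ioo (0 : ℝ) 1, x ^ (u - 1 + k) = 1 / (u + k) := by
    intro k
    have hk : (0 : ℝ) ≤ k := Nat.cast_nonneg k
    refine ⟨?_, ?_⟩
    · have := intervalIntegral.intervalIntegrable_rpow' (a := 0) (b := 1) (r := u - 1 + k)
        (by linarith)
      rwa [intervalIntegrable_iff_integrableOn_Ioo_of_le zero_le_one] at this
    · rw [← integral_Ioc_eq_integral_Ioo, ← intervalIntegral.integral_of_le zero_le_one,
        integral_rpow (Or.inl (by linarith))]
      rw [Real.one_rpow, Real.zero_rpow (by linarith)]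
      congr 1 <;> ring
  have hF : ∀ k, Integrable (F k) ν := fun k => (hrpow k).1.const_mul _
  have hFint : ∀ k, ∫ x, F k x ∂ν = risingCoeff (1 - γ) k / (u + k) := fun k => by
    simp only [F]
    rw [integral_const_mul, (hrpow k).2, mul_one_div]
  have hFnn : ∀ k, ∀ x ∈ Ioo (0 : ℝ) 1, 0 ≤ F k x := fun k x hx =>
    mul_nonneg (hpos k).le (Real.rpow_nonneg hx.1.le _)
  have hFsum : ∀ x ∈ Ioo (0 : ℝ) 1, HasSum (fun k => F k x) (f x) := fun x hx => by
    have := (hasSum_risingCoeff (1 - γ) hx.1.le hx.2).mul_left (x ^ (u - 1))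
    rw [neg_sub] at this
    refine this.congr_fun fun k => ?_
    simp only [F]
    rw [Real.rpow_add hx.1, Real.rpow_natCast]
    ring
  have hFnorm : ∀ k, ∫ x, ‖F k x‖ ∂ν = risingCoeff (1 - γ) k / (u + k) := fun k => by
    rw [← hFint k]
    exact setIntegral_congr_fun measurableSet_Ioo fun x hx => Real.norm_of_nonneg (hFnn k x hx)
  have hsum : Summable fun k => ∫ x, ‖F k x‖ ∂ν := by
    -- The terms are nonnegative, so every partial sum of the integrals is bounded by the Beta
    -- integral.
    refine summable_of_sum_range_le (c := ∫ x, f x ∂ν) (fun k => by positivity) fun N => ?_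
    simp_rw [hFnorm, ← hFint]
    rw [← integral_finsetSum _ fun k _ => hF k]
    refine setIntegral_mono_on (integrable_finsetSum _ fun k _ => hF k) hf measurableSet_Ioo
      fun x hx => ?_
    exact sum_le_hasSum _ (fun k _ => hFnn k x hx) (hFsum x hx)
  have h := hasSum_integral_of_summable_integral_norm hF hsum
  have h2 : ∫ x, ∑' k, F k x ∂ν = ∫ x, f x ∂ν :=
    setIntegral_congr_fun measurableSet_Ioo fun x hx => (hFsum x hx).tsum_eq
  rw [h2, hfint] at h
  simpa only [hFint] using h

theorem isCauchyData_beta {B γ : ℝ} (hB : 0 < B) (hγ0 : 0 < γ) (hγ1 : γ < 1) :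
    IsCauchyData (risingCoeff (1 - γ)) (fun k => B + k) where
  strictMono := fun i j hij => by simpa using hij
  pos k := by positivity
  tendsto := tendsto_atTop_add_const_left _ _ tendsto_natCast_atTop_atTop
  nonneg k := (risingCoeff_pos (by linarith) k).le
  summable := (hasSum_beta hB hγ0 hγ1).summable

theorem IsCauchyData.isClosed_range {b s : ℕ → ℝ} (h : IsCauchyData b s) :
    IsClosed (Set.range fun k => (s k : ℂ)) := by
  rw [← isOpen_compl_iff, Metric.isOpen_iff]
  intro x hx
  obtain ⟨r, hr, c, hc, hb⟩ := h.exists_lower_bound (x₀ := x) fun k hk => hx ⟨k, hk.symm⟩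
  refine ⟨r, hr, ?_⟩
  rintro y hy ⟨k, rfl⟩
  have := hb _ hy k
  rw [sub_self, norm_zero] at this
  exact absurd this (not_le.2 (mul_pos hc (h.pos k)))

/-- Partial fractions of the quotient `Γ(B - x) / Γ(B + γ - x)`. -/
theorem gammaQuotient_eq {B γ : ℝ} (hB : 0 < B) (hγ0 : 0 < γ) (hγ1 : γ < 1) {x : ℂ}
    (hx : ∀ k : ℕ, x ≠ ((B + k : ℝ) : ℂ)) :
    Complex.Gamma γ * (Complex.Gamma (B - x) / Complex.Gamma (B + γ - x)) =
      cauchySum (risingCoeff (1 - γ)) (fun k => B + k) x := by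
  have hd := isCauchyData_beta hB hγ0 hγ1
  let S : Set ℂ := Set.range fun k : ℕ => ((B + k : ℝ) : ℂ)
  have hS : IsClosed S := hd.isClosed_range
  -- The nodes form a countable set, and its complement in the plane is connected. The identity
  -- theorem therefore propagates the real formula to all non-nodes.
  have hconn : IsPreconnected Sᶜ := ((countable_range _).isConnected_compl_of_one_lt_rank
    (by simp [Complex.rank_real_complex])).isPreconnected
  have hmem : ∀ y ∈ Sᶜ, ∀ k : ℕ, y ≠ ((B + k : ℝ) : ℂ) := fun y hy k h => hy ⟨k, h.symm⟩
  have h1 : DifferentiableOn ℂ (fun y => Complex.Gamma γ *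
      (Complex.Gamma (B - y) / Complex.Gamma (B + γ - y))) Sᶜ := by
    intro y hy
    have h1 : DifferentiableAt ℂ (fun y => Complex.Gamma (B - y)) y := by
      refine (Complex.differentiableAt_Gamma _ fun m h => hmem y hy m ?_).comp y
        (differentiableAt_id.const_sub _)
      push_cast
      linear_combination -h
    have h2 : DifferentiableAt ℂ (fun y => (Complex.Gamma (B + γ - y))⁻¹) y :=
      (Complex.differentiable_one_div_Gamma _).comp y (differentiableAt_id.const_sub _)
    simp only [div_eq_mul_inv]
    exact ((h1.mul h2).const_mul _).differentiableWithinAt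
  have h2 : DifferentiableOn ℂ (cauchySum (risingCoeff (1 - γ)) (fun k => B + k)) Sᶜ :=
    fun y hy => (hd.hasDerivAt (hmem y hy)).differentiableAt.differentiableWithinAt
  have h0 : (0 : ℂ) ∈ Sᶜ := by
    rintro ⟨k, hk⟩
    have : B + k = 0 := Complex.ofReal_eq_zero.1 hk
    have : (0 : ℝ) ≤ k := Nat.cast_nonneg k
    linarith
  refine (h1.analyticOnNhd hS.isOpen_compl).eqOn_of_preconnected_of_frequently_eq
    (h2.analyticOnNhd hS.isOpen_compl) hconn h0 ?_ (fun ⟨k, hk⟩ => hx k hk.symm : x ∈ Sᶜ)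
  have hreal : ∀ y : ℝ, y < B → Complex.Gamma γ * (Complex.Gamma (B - y) /
      Complex.Gamma (B + γ - y)) = cauchySum (risingCoeff (1 - γ)) (fun k => B + k) y := by
    intro y hy
    have := hasSum_beta (u := B - y) (by linarith) hγ0 hγ1
    rw [IsCauchyData.ofReal, cauchySumReal]
    have h3 : (fun k : ℕ => risingCoeff (1 - γ) k / (B + k - y)) =
        fun k : ℕ => risingCoeff (1 - γ) k / (B - y + k) := by
      funext k
      congr 1
      ring
    rw [h3, this.tsum_eq]
    push_cast
    rw [← Complex.Gamma_ofReal, ← Complex.Gamma_ofReal, ← Complex.Gamma_ofReal]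
    push_cast
    rw [show (B : ℂ) - y + γ = B + γ - y by ring]
    ring
  -- Negative reals accumulating at `0`, where `hasSum_beta` applies.
  have h3 : Tendsto (fun m : ℕ => ((-1 / ((m : ℝ) + 1) : ℝ) : ℂ)) atTop (𝓝[≠] 0) := by
    refine tendsto_nhdsWithin_iff.2 ⟨?_, .of_forall fun m => ?_⟩
    · have := (tendsto_one_div_add_atTop_nhds_zero_nat (𝕜 := ℝ)).neg
      rw [neg_zero] at this
      have h4 := (Complex.continuous_ofReal.tendsto 0).comp this
      refine (h4.congr fun m => ?_)
      simp [neg_div]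
    · have : (-1 / ((m : ℝ) + 1) : ℝ) ≠ 0 := by
        have : (m : ℝ) + 1 ≠ 0 := by positivity
        simp [this]
      exact Complex.ofReal_ne_zero.2 this
  refine h3.frequently (Eventually.of_forall fun m => ?_).frequently
  refine hreal _ ?_
  have : (-1 / ((m : ℝ) + 1) : ℝ) < 0 := by
    rw [div_neg_iff]
    right
    constructor <;> [norm_num; positivity]
  linarith

/-! ### The product `m (x) m (-x)` as a Cauchy series in `x²`. -/

namespace IsCauchyData

variable {b s : ℕ → ℝ}

/-- The weights of `m (x) m (-x)` as a series in `x ^ 2`. -/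
def prodWeight (b s : ℕ → ℝ) (k : ℕ) : ℝ := 2 * b k * cauchySumReal b s (-s k) * s k

theorem cauchySumReal_neg_pos (h : IsCauchyData b s) (hb : ∀ k, 0 < b k) (k : ℕ) :
    0 < cauchySumReal b s (-s k) := by
  have hk := h.pos k
  refine (h.summable_real fun i hi => ?_).tsum_pos (fun i => ?_) 0 ?_
  · linarith [h.pos i]
  · exact div_nonneg (hb i).le (by linarith [h.pos i])
  · exact div_pos (hb 0) (by linarith [h.pos 0])

theorem prodWeight_pos (h : IsCauchyData b s) (hb : ∀ k, 0 < b k) (k : ℕ) :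
    0 < prodWeight b s k := by
  have := h.cauchySumReal_neg_pos hb k
  have := hb k
  have := h.pos k
  unfold prodWeight
  positivity

/-- Summability of the new weights comes from `m (-s k) ≤ m (0)`. -/
theorem prod (h : IsCauchyData b s) (hb : ∀ k, 0 < b k) :
    IsCauchyData (prodWeight b s) (fun k => s k ^ 2) where
  strictMono := fun i j hij => by
    have := h.strictMono hij
    have := h.pos i
    simp only
    gcongr
  pos k := pow_pos (h.pos k) 2
  tendsto := (tendsto_pow_atTop two_ne_zero).comp h.tendsto
  nonneg k := (h.prodWeight_pos hb k).le
  summable := by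
    refine Summable.of_nonneg_of_le
      (fun k => div_nonneg (h.prodWeight_pos hb k).le (sq_nonneg _)) (fun k => ?_)
      (h.summable.mul_left (2 * cauchySumReal b s 0))
    have hk := h.pos k
    have hbk := hb k
    have hle : cauchySumReal b s (-s k) ≤ cauchySumReal b s 0 :=
      h.monotone_gap (by linarith) fun i => Or.inl (h.pos i)
    calc prodWeight b s k / s k ^ 2 = 2 * cauchySumReal b s (-s k) * (b k / s k) := by
          unfold prodWeight
          field_simp
      _ ≤ _ := by gcongr

/-- In the double series, `1/((s_k - x)(s_i + x))` equals `(1/(s_k - x) + 1/(s_i + x)) / (s_k +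
s_i)`. Summing over the index absent from the fraction in `x` produces `m (-s_k)`, and the two
fractions with node `s_k` combine to `2 s_k / (s_k² - x²)`. -/
theorem mul_neg_eq (h : IsCauchyData b s) (hb : ∀ k, 0 < b k) {x : ℂ}
    (hx : ∀ k, x ^ 2 ≠ ((s k ^ 2 : ℝ) : ℂ)) :
    cauchySum b s x * cauchySum b s (-x) =
      cauchySum (prodWeight b s) (fun k => s k ^ 2) (x ^ 2) := by
  have hx1 : ∀ k, x ≠ s k := fun k hk => hx k (by rw [hk]; push_cast; rfl)
  have hx2 : ∀ k, -x ≠ s k := fun k hk => hx k (by rw [← neg_sq, hk]; push_cast; rfl)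
  have hne1 : ∀ k, (s k : ℂ) - x ≠ 0 := fun k => sub_ne_zero.2 (hx1 k).symm
  have hne2 : ∀ k, (s k : ℂ) - -x ≠ 0 := fun k => sub_ne_zero.2 (hx2 k).symm
  have hss : ∀ k i, (s k : ℂ) + s i ≠ 0 := fun k i => by
    have : s k + s i ≠ 0 := (add_pos (h.pos k) (h.pos i)).ne'
    exact_mod_cast this
  have hH : ∀ y : ℂ, (∀ k, y ≠ s k) → Summable fun p : ℕ × ℕ =>
      (b p.1 : ℂ) / (s p.1 - y) * (b p.2 / (s p.1 + s p.2)) := by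
    intro y hy
    have h1 := (h.summable_norm hy).mul_of_nonneg h.summable (fun _ => norm_nonneg _)
      (fun k => div_nonneg (hb k).le (h.pos k).le)
    refine Summable.of_norm_bounded h1 fun p => ?_
    rw [norm_mul]
    refine mul_le_mul_of_nonneg_left ?_ (norm_nonneg _)
    have := h.pos p.1
    have := h.pos p.2
    have := hb p.2
    rw [← Complex.ofReal_add, ← Complex.ofReal_div, Complex.norm_real,
      Real.norm_of_nonneg (by positivity)]
    gcongr
    linarith
  have hE : ∀ y : ℂ, (∀ k, y ≠ s k) → HasSum (fun k =>
      (b k : ℂ) / (s k - y) * (cauchySumReal b s (-s k) : ℝ)) (∑' p : ℕ × ℕ,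
      (b p.1 : ℂ) / (s p.1 - y) * (b p.2 / (s p.1 + s p.2))) := by
    intro y hy
    refine (hH y hy).hasSum.prod_fiberwise fun k => ?_
    have h1 : HasSum (fun i => b i / (s i - -s k)) (cauchySumReal b s (-s k)) :=
      (h.summable_real fun i hi => by linarith [h.pos i, h.pos k]).hasSum
    have h2 := ((Complex.hasSum_ofReal.2 h1).mul_left ((b k : ℂ) / (s k - y)))
    refine h2.congr_fun fun i => ?_
    push_cast
    rw [sub_neg_eq_add, add_comm (s i : ℂ)]
  have hx2' : ∀ k, -x ≠ s k := hx2
  rw [cauchySum, cauchySum, tsum_mul_tsum_of_summable_norm (h.summable_norm hx1)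
    (h.summable_norm hx2)]
  have hswap : ∑' p : ℕ × ℕ, (b p.2 : ℂ) / (s p.2 - -x) * (b p.1 / (s p.2 + s p.1)) =
      ∑' p : ℕ × ℕ, (b p.1 : ℂ) / (s p.1 - -x) * (b p.2 / (s p.1 + s p.2)) :=
    (Equiv.prodComm ℕ ℕ).tsum_eq fun p : ℕ × ℕ =>
      (b p.1 : ℂ) / (s p.1 - -x) * (b p.2 / (s p.1 + s p.2))
  have hHswap : Summable fun p : ℕ × ℕ =>
      (b p.2 : ℂ) / (s p.2 - -x) * (b p.1 / (s p.2 + s p.1)) :=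
    (Equiv.prodComm ℕ ℕ).summable_iff.2 (hH (-x) hx2)
  have hsplit : ∀ p : ℕ × ℕ, (b p.1 : ℂ) / (s p.1 - x) * (b p.2 / (s p.2 - -x)) =
      (b p.1 : ℂ) / (s p.1 - x) * (b p.2 / (s p.1 + s p.2)) +
        (b p.2 : ℂ) / (s p.2 - -x) * (b p.1 / (s p.2 + s p.1)) := by
    intro p
    have h1 := hne1 p.1
    have h2 := hne2 p.2
    have h3 := hss p.1 p.2
    rw [add_comm (s p.2 : ℂ)]
    field_simp
    ring
  rw [tsum_congr hsplit, (hH x hx1).tsum_add hHswap, hswap, ← (hE x hx1).tsum_eq,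
    ← (hE (-x) hx2).tsum_eq, ← (hE x hx1).summable.tsum_add (hE (-x) hx2).summable]
  refine tsum_congr fun k => ?_
  have h1 := hne1 k
  have h2 := hne2 k
  have h4 : ((s k ^ 2 : ℝ) : ℂ) - x ^ 2 = (s k - x) * (s k - -x) := by
    push_cast
    ring
  simp only [prodWeight]
  rw [h4]
  push_cast
  field_simp
  ring

theorem const_mul (h : IsCauchyData b s) {c d : ℝ} (hc : 0 < c) (hd : 0 < d) :
    IsCauchyData (fun k => c * b k) (fun k => d * s k) where
  strictMono := h.strictMono.const_mul hd
  pos k := mul_pos hd (h.pos k)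
  tendsto := h.tendsto.const_mul_atTop hd
  nonneg k := mul_nonneg hc.le (h.nonneg k)
  summable := by
    refine (h.summable.mul_left (c / d)).congr fun k => ?_
    have := (h.pos k).ne'
    field_simp

end IsCauchyData

/-! ### Partial fractions of `1/Θ₀`. -/

section Symbol

variable {n : ℕ} {γ : ℝ}

/-- The squares of the poles of `1 / Θ₀` on the positive imaginary axis. -/
def poleSq (n : ℕ) (γ : ℝ) (k : ℕ) : ℝ := 4 * ((n : ℝ) / 4 - γ / 2 + k) ^ 2

/-- The weights of the partial fractions of `1 / Θ₀`. -/
def poleWeight (n : ℕ) (γ : ℝ) (k : ℕ) : ℝ :=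
  4 / (2 ^ (2 * γ) * Real.Gamma γ ^ 2) *
    IsCauchyData.prodWeight (risingCoeff (1 - γ)) (fun k => (n : ℝ) / 4 - γ / 2 + k) k

theorem isCauchyData_pole (hγ0 : 0 < γ) (hγ1 : γ < 1) (hn : 2 * γ < n) :
    IsCauchyData (poleWeight n γ) (poleSq n γ) := by
  have h := isCauchyData_beta (B := (n : ℝ) / 4 - γ / 2) (by linarith) hγ0 hγ1
  have hg := Real.Gamma_pos_of_pos hγ0
  exact (h.prod (risingCoeff_pos (by linarith))).const_mul (by positivity) (by norm_num)

theorem poleWeight_pos (hγ0 : 0 < γ) (hγ1 : γ < 1) (hn : 2 * γ < n) (k : ℕ) :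
    0 < poleWeight n γ k := by
  have h := isCauchyData_beta (B := (n : ℝ) / 4 - γ / 2) (by linarith) hγ0 hγ1
  have hg := Real.Gamma_pos_of_pos hγ0
  exact mul_pos (by positivity) (h.prodWeight_pos (risingCoeff_pos (by linarith)) k)

/-- Partial fractions of `1 / Θ₀`. -/
theorem inv_symbol (hγ0 : 0 < γ) (hγ1 : γ < 1) (hn : 2 * γ < n) {z : ℂ}
    (hz : ∀ k, -z ^ 2 ≠ poleSq n γ k) :
    (symbol n γ z)⁻¹ = cauchySum (poleWeight n γ) (poleSq n γ) (-z ^ 2) := by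
  set B : ℝ := (n : ℝ) / 4 - γ / 2 with hB
  have hB0 : 0 < B := by linarith
  have h := isCauchyData_beta hB0 hγ0 hγ1
  -- In this variable `1/Θ₀` is, up to a constant, the product of the Gamma quotients at `x` and
  -- `-x`. Since `x² = -z²/4`, the nodes `(B + k)²` become `4 (B + k)²` in the variable `-z²`.
  set x : ℂ := z * Complex.I / 2 with hx
  have hx2 : x ^ 2 = -z ^ 2 / 4 := by
    rw [hx, div_pow, mul_pow, Complex.I_sq]
    ring
  have hxs : ∀ k : ℕ, x ^ 2 ≠ (((B + k) ^ 2 : ℝ) : ℂ) := fun k hk => hz k (by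
    rw [hx2, div_eq_iff (by norm_num : (4 : ℂ) ≠ 0)] at hk
    rw [hk, poleSq, ← hB]
    push_cast
    ring)
  have hG := (Real.Gamma_pos_of_pos hγ0).ne'
  have hG' : Complex.Gamma γ ≠ 0 := by
    rw [Complex.Gamma_ofReal]
    exact_mod_cast hG
  have h1 := gammaQuotient_eq hB0 hγ0 hγ1 (x := x) fun k hk => hxs k (by rw [hk]; push_cast; rfl)
  have h2 := gammaQuotient_eq hB0 hγ0 hγ1 (x := -x) fun k hk => hxs k (by
    rw [← neg_sq, hk]; push_cast; rfl)
  have h3 := h.mul_neg_eq (risingCoeff_pos (by linarith)) hxs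
  have h4 : cauchySum (poleWeight n γ) (poleSq n γ) (-z ^ 2) =
      ((1 / (2 ^ (2 * γ) * Real.Gamma γ ^ 2) : ℝ) : ℂ) *
      cauchySum (IsCauchyData.prodWeight (risingCoeff (1 - γ)) fun k => B + k)
        (fun k => (B + k) ^ 2) (x ^ 2) := by
    rw [cauchySum, cauchySum, ← tsum_mul_left]
    refine tsum_congr fun k => ?_
    have hne : (((B + k) ^ 2 : ℝ) : ℂ) - x ^ 2 ≠ 0 := sub_ne_zero.2 (hxs k).symm
    have h5 : (poleSq n γ k : ℂ) - -z ^ 2 = 4 * ((((B + k) ^ 2 : ℝ) : ℂ) - x ^ 2) := by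
      rw [hx2, poleSq, ← hB]
      push_cast
      ring
    rw [h5, poleWeight, ← hB]
    simp only [Complex.ofReal_mul]
    field_simp
    push_cast
    ring
  rw [h4, ← h3, ← h1, ← h2, symbol]
  have e1 : (n / 4 + γ / 2 + z * Complex.I / 2 : ℂ) = B + γ - -x := by
    rw [hB, hx]; push_cast; ring
  have e2 : (n / 4 + γ / 2 - z * Complex.I / 2 : ℂ) = B + γ - x := by
    rw [hB, hx]; push_cast; ring
  have e3 : (n / 4 - γ / 2 + z * Complex.I / 2 : ℂ) = B - -x := by
    rw [hB, hx]; push_cast; ring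
  have e4 : (n / 4 - γ / 2 - z * Complex.I / 2 : ℂ) = B - x := by
    rw [hB, hx]; push_cast; ring
  rw [e1, e2, e3, e4, Complex.Gamma_ofReal] at *
  have h2γ : ((2 ^ (2 * γ) : ℝ) : ℂ) ≠ 0 := by
    exact_mod_cast (Real.rpow_pos_of_pos two_pos _).ne'
  simp only [div_eq_mul_inv, mul_inv, inv_inv, Complex.ofReal_mul, Complex.ofReal_inv,
    Complex.ofReal_pow, one_mul]
  field_simp

/-- A Gamma factor of the denominator has a pole here. With the conventions `Γ (-k) = 0` and `a / 0
= 0` the formula returns `0`; `hasDerivAt_symbol_zero` confirms that this is the correct value and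
that the zero is simple. -/
theorem symbol_eq_zero {z : ℂ} {k : ℕ} (hz : -z ^ 2 = poleSq n γ k) : symbol n γ z = 0 := by
  have h1 : (z * Complex.I / 2 - ((n : ℂ) / 4 - γ / 2 + k)) *
      (z * Complex.I / 2 + ((n : ℂ) / 4 - γ / 2 + k)) = 0 := by
    rw [poleSq] at hz
    push_cast at hz
    linear_combination (z ^ 2 / 4) * Complex.I_sq + hz / 4
  have hΓ : Complex.Gamma (-(k : ℂ)) = 0 := Complex.Gamma_neg_nat_eq_zero k
  rcases mul_eq_zero.1 h1 with h | h
  · have : (n / 4 - γ / 2 - z * Complex.I / 2 : ℂ) = -k := by linear_combination -h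
    rw [symbol, this, hΓ, mul_zero, div_zero]
  · have : (n / 4 - γ / 2 + z * Complex.I / 2 : ℂ) = -k := by linear_combination h
    rw [symbol, this, hΓ, zero_mul, div_zero]

end Symbol

/-- The residue at a node: under dominated convergence only the term with index `k` survives. -/
theorem IsCauchyData.tendsto_sub_mul {b s : ℕ → ℝ} (h : IsCauchyData b s) (k : ℕ) :
    Tendsto (fun x => ((s k : ℂ) - x) * cauchySum b s x) (𝓝[≠] (s k : ℂ)) (𝓝 (b k)) := by
  obtain ⟨r, hr, c, hc, hb⟩ := h.exists_lower_bound_of_ne (s k : ℂ)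
  have hne : ∀ i, i ≠ k → (s k : ℂ) ≠ s i := fun i hi hik =>
    hi (h.strictMono.injective (Complex.ofReal_injective hik)).symm
  have hk0 := h.pos k
  have key : Tendsto (fun x => ∑' i, ((s k : ℂ) - x) * ((b i : ℂ) / (s i - x))) (𝓝[≠] (s k : ℂ))
      (𝓝 (∑' i, if i = k then (b i : ℂ) else 0)) := by
    refine tendsto_tsum_of_dominated_convergence (bound := fun i => (r / c + s k) * (b i / s i))
      (h.summable.mul_left _) (fun i => ?_) ?_
    · by_cases hi : i = k
      · subst hi
        rw [if_pos rfl]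
        refine tendsto_const_nhds.congr' ?_
        filter_upwards [self_mem_nhdsWithin] with x hx
        have : (s i : ℂ) - x ≠ 0 := sub_ne_zero.2 (Ne.symm hx)
        field_simp
      · rw [if_neg hi]
        have h1 : ContinuousAt (fun x => ((s k : ℂ) - x) * ((b i : ℂ) / (s i - x))) (s k : ℂ) := by
          have : (s i : ℂ) - s k ≠ 0 := sub_ne_zero.2 (hne i hi).symm
          fun_prop (disch := assumption)
        have h2 := h1.tendsto
        rw [sub_self, zero_mul] at h2
        exact h2.mono_left nhdsWithin_le_nhds
    · filter_upwards [self_mem_nhdsWithin,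
        nhdsWithin_le_nhds (Metric.ball_mem_nhds (s k : ℂ) hr)] with x hx hxr i
      have hbi := h.nonneg i
      have hsi := h.pos i
      rw [norm_mul, norm_div, Complex.norm_real, Real.norm_of_nonneg hbi]
      by_cases hi : i = k
      · subst hi
        have h3 : 0 < ‖(s i : ℂ) - x‖ := norm_pos_iff.2 (sub_ne_zero.2 (Ne.symm hx))
        rw [mul_div_cancel₀ _ h3.ne']
        have h4 : b i = s i * (b i / s i) := by field_simp
        rw [add_mul, ← h4]
        have : 0 ≤ r / c * (b i / s i) := by positivity
        linarith
      · have h3 := hb x hxr i (hne i hi)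
        have h4 : ‖(s k : ℂ) - x‖ ≤ r := by
          rw [norm_sub_rev, ← dist_eq_norm]
          exact (Metric.mem_ball.1 hxr).le
        calc ‖(s k : ℂ) - x‖ * (b i / ‖(s i : ℂ) - x‖) ≤ r * (b i / (c * s i)) := by
              gcongr
          _ = r / c * (b i / s i) := by field_simp
          _ ≤ (r / c + s k) * (b i / s i) := by
            have : 0 ≤ b i / s i := by positivity
            gcongr
            linarith
  rw [tsum_ite_eq] at key
  refine key.congr fun x => ?_
  rw [cauchySum, tsum_mul_left]

/-! ### Poles of `1/(Θ₀ - κ)` and derivatives of `Θ₀`. -/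

section Poles

variable {n : ℕ} {γ κ : ℝ}

theorem meromorphic_symbol (z : ℂ) : MeromorphicAt (symbol n γ) z := by
  have hG : ∀ (c d : ℂ), MeromorphicAt (fun z => Complex.Gamma (c + z * d)) z := fun c d =>
    (Meromorphic.Gamma (c + z * d)).comp_analyticAt (g := fun z => c + z * d) (by fun_prop)
  have h1 := fun c => hG c (Complex.I / 2)
  have h2 := fun c => hG c (-(Complex.I / 2))
  have := (((MeromorphicAt.const (((2 ^ (2 * γ) : ℝ) : ℂ)) z).mul
    ((h1 (n / 4 + γ / 2)).mul (h2 (n / 4 + γ / 2)))).div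
    ((h1 (n / 4 - γ / 2)).mul (h2 (n / 4 - γ / 2))))
  refine this.congr (Eventually.of_forall fun ζ => ?_)
  simp only [symbol, Pi.mul_apply, Pi.div_apply, mul_neg, mul_div_assoc, ← sub_eq_add_neg]

/-- Turns the order of a meromorphic function into a limit that is insensitive to the value at `z`,
where the inverse of zero would be zero. -/
theorem isPole_iff (z : ℂ) :
    IsPole n γ κ z ↔ Tendsto (fun ζ => symbol n γ ζ - κ) (𝓝[≠] z) (𝓝[≠] 0) := by
  have hm : MeromorphicAt (fun ζ => (symbol n γ ζ - κ)⁻¹) z :=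
    ((meromorphic_symbol z).sub (MeromorphicAt.const _ z)).inv
  rw [IsPole, ← tendsto_cobounded_iff_meromorphicOrderAt_neg hm]
  constructor
  · intro h
    have := tendsto_inv₀_cobounded'.comp h
    simpa [Function.comp_def] using this
  · intro h
    exact (tendsto_inv₀_nhdsNE_zero).comp h

theorem eventually_inv_symbol (hγ0 : 0 < γ) (hγ1 : γ < 1) (hn : 2 * γ < n) {z : ℂ}
    (hz : ∀ k, -z ^ 2 ≠ poleSq n γ k) : ∀ᶠ ζ : ℂ in 𝓝 z, (∀ k, -ζ ^ 2 ≠ poleSq n γ k) ∧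
      (symbol n γ ζ)⁻¹ = cauchySum (poleWeight n γ) (poleSq n γ) (-ζ ^ 2) := by
  have h := isCauchyData_pole hγ0 hγ1 hn
  have hc : ContinuousAt (fun ζ : ℂ => -ζ ^ 2) z := by fun_prop
  have := hc.eventually_mem (h.isClosed_range.isOpen_compl.mem_nhds
    (fun ⟨k, hk⟩ => hz k hk.symm : -z ^ 2 ∈ _))
  filter_upwards [this] with ζ hζ
  have hζ' : ∀ k, -ζ ^ 2 ≠ poleSq n γ k := fun k hk => hζ ⟨k, hk.symm⟩
  exact ⟨hζ', inv_symbol hγ0 hγ1 hn hζ'⟩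

/-- Chain rule for `Θ₀ (z) = 1 / m (-z²)`. -/
theorem hasDerivAt_symbol (hγ0 : 0 < γ) (hγ1 : γ < 1) (hn : 2 * γ < n) {z : ℂ}
    (hz : ∀ k, -z ^ 2 ≠ poleSq n γ k)
    (hm : cauchySum (poleWeight n γ) (poleSq n γ) (-z ^ 2) ≠ 0) :
    HasDerivAt (symbol n γ) (2 * z * (∑' k, (poleWeight n γ k : ℂ) / (poleSq n γ k - -z ^ 2) ^ 2) /
      cauchySum (poleWeight n γ) (poleSq n γ) (-z ^ 2) ^ 2) z := by
  have h := (isCauchyData_pole hγ0 hγ1 hn).hasDerivAt hz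
  have h1 : HasDerivAt (fun ζ : ℂ => -ζ ^ 2) (-(2 * z)) z := by
    simpa using! (hasDerivAt_pow 2 z).neg
  have h2 := (HasDerivAt.comp (h₂ := cauchySum (poleWeight n γ) (poleSq n γ)) z h h1).inv hm
  refine (h2.congr_deriv ?_).congr_of_eventuallyEq ?_
  · simp only [Function.comp]
    ring
  · filter_upwards [eventually_inv_symbol hγ0 hγ1 hn hz] with ζ hζ
    rw [Pi.inv_apply, Function.comp, ← hζ.2, inv_inv]

/-- With `l_k = -z²`, the slope of `Θ₀` at its zero is `(ζ + z) / ((l_k + ζ²) m (-ζ²))`, and the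
denominator tends to the residue `a_k`. -/
theorem hasDerivAt_symbol_zero (hγ0 : 0 < γ) (hγ1 : γ < 1) (hn : 2 * γ < n) {z : ℂ} {k : ℕ}
    (hz : -z ^ 2 = poleSq n γ k) :
    HasDerivAt (symbol n γ) (2 * z / poleWeight n γ k) z := by
  have h := isCauchyData_pole hγ0 hγ1 hn
  have hz0 : z ≠ 0 := by
    rintro rfl
    rw [zero_pow two_ne_zero, neg_zero] at hz
    exact (h.pos k).ne (by exact_mod_cast hz)
  have hw : (poleWeight n γ k : ℂ) ≠ 0 := by exact_mod_cast (poleWeight_pos hγ0 hγ1 hn k).ne'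
  have hsq : Tendsto (fun ζ : ℂ => -ζ ^ 2) (𝓝[≠] z) (𝓝[≠] (poleSq n γ k : ℂ)) := by
    have h1 : HasDerivAt (fun ζ : ℂ => -ζ ^ 2) (-(2 * z)) z := by
      simpa using! (hasDerivAt_pow 2 z).neg
    rw [← hz]
    exact h1.tendsto_nhdsNE (by simpa using hz0)
  have h1 := (h.tendsto_sub_mul k).comp hsq
  have h2 : Tendsto (fun ζ => ζ + z) (𝓝[≠] z) (𝓝 (z + z)) :=
    (tendsto_id.add_const z).mono_left nhdsWithin_le_nhds
  have h3 := h2.div h1 hw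
  rw [hasDerivAt_iff_tendsto_slope, ← two_mul] at *
  refine h3.congr' ?_
  have hev : ∀ᶠ ζ : ℂ in 𝓝[≠] z, ∀ i, -ζ ^ 2 ≠ poleSq n γ i := by
    obtain ⟨r, hr, c, hc, hb⟩ := h.exists_lower_bound_of_ne (poleSq n γ k : ℂ)
    filter_upwards [hsq.eventually (nhdsWithin_le_nhds (Metric.ball_mem_nhds _ hr)),
      hsq.eventually self_mem_nhdsWithin] with ζ h1 h2 i hi
    by_cases hik : (poleSq n γ k : ℂ) = poleSq n γ i
    · exact h2 (hi.trans hik.symm)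
    · have := hb _ h1 i hik
      rw [hi, sub_self, norm_zero] at this
      exact absurd this (not_le.2 (mul_pos hc (h.pos i)))
  filter_upwards [hev, self_mem_nhdsWithin] with ζ hζ hne
  have h4 : ζ - z ≠ 0 := sub_ne_zero.2 hne
  rw [slope_def_field, symbol_eq_zero hz, sub_zero, ← inv_inv (symbol n γ ζ),
    inv_symbol hγ0 hγ1 hn hζ]
  rw [← hz, Pi.div_apply, Function.comp]
  have h5 : -z ^ 2 - -ζ ^ 2 = (ζ - z) * (ζ + z) := by ring
  have h6 : ζ + z ≠ 0 := by
    intro h0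
    refine hζ k ?_
    rw [← hz, eq_neg_of_add_eq_zero_left h0, neg_sq]
  rw [h5, div_eq_mul_inv, div_eq_mul_inv, mul_inv, mul_inv]
  field_simp

theorem isPole_of_hasDerivAt {z S' : ℂ} (h : HasDerivAt (symbol n γ) S' z) (hS : S' ≠ 0)
    (hz : symbol n γ z = κ) : IsPole n γ κ z := by
  rw [isPole_iff]
  have := (h.sub_const (κ : ℂ)).tendsto_nhdsNE hS
  rwa [hz, sub_self] at this

theorem neg_sq_mul_I (s : ℝ) : -((s : ℂ) * Complex.I) ^ 2 = ((s ^ 2 : ℝ) : ℂ) := by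
  rw [mul_pow, Complex.I_sq]
  push_cast
  ring

/-- Each infimum in the recursion is attained, since an increasing enumeration provides the least
element of the set. -/
theorem sigma_eq_of_isPole_iff {τ : ℕ → ℝ} (hτ : StrictMono τ) (hpos : ∀ j, 0 < τ j)
    (h : ∀ s : ℝ, 0 < s → (IsPole n γ κ (s * Complex.I) ↔ ∃ j, s = τ j)) (j : ℕ) :
    sigma n γ κ j = τ j := by
  induction j with
  | zero =>
    refine IsLeast.csInf_eq ⟨⟨hpos 0, (h _ (hpos 0)).2 ⟨0, rfl⟩⟩, ?_⟩
    rintro s ⟨hs, hp⟩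
    obtain ⟨i, rfl⟩ := (h s hs).1 hp
    exact hτ.monotone (Nat.zero_le i)
  | succ j ih =>
    rw [sigma, ih]
    refine IsLeast.csInf_eq ⟨⟨hτ (Nat.lt_succ_self j), (h _ (hpos _)).2 ⟨j + 1, rfl⟩⟩, ?_⟩
    rintro s ⟨hs, hp⟩
    obtain ⟨i, rfl⟩ := (h s ((hpos j).trans hs)).1 hp
    exact hτ.monotone (hτ.lt_iff_lt.1 hs)

/-- The poles of `1 / (Θ₀ - κ)` and its partial fractions on the real line. -/
structure IsSpectral (n : ℕ) (γ κ : ℝ) : Prop where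
  pos : ∀ j, 0 < sigma n γ κ j
  strictMono : StrictMono (sigma n γ κ)
  le : sigma n γ κ 0 ≤ (n : ℝ) / 2 - γ
  coeff_nonneg : ∀ j, 0 ≤ coeff n γ κ j
  summable : Summable fun j => coeff n γ κ j / sigma n γ κ j
  symbol_ne : ∀ ξ : ℝ, symbol n γ ξ - κ ≠ 0
  hasSum : ∀ ξ : ℝ, HasSum (fun j =>
    ((2 * coeff n γ κ j * sigma n γ κ j / (sigma n γ κ j ^ 2 + ξ ^ 2) : ℝ) : ℂ))
    (symbol n γ ξ - κ)⁻¹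

/-- Common to `κ = 0` and `κ > 0`. The `μ j` are the squares of the `σ_j`, and `d j` is the
numerator of the fraction `d_j / (μ_j + ξ²)`, so that `c_j = d_j / (2σ_j)`. -/
theorem isSpectral_of {μ d : ℕ → ℝ} (hn : 2 * γ < n) (hμ : StrictMono μ) (hpos : ∀ j, 0 < μ j)
    (hle : μ 0 ≤ poleSq n γ 0) (hd : ∀ j, 0 ≤ d j)
    (hpole : ∀ s : ℝ, 0 < s → (IsPole n γ κ (s * Complex.I) ↔ ∃ j, s ^ 2 = μ j))
    (hderiv : ∀ (s : ℝ) j, 0 < s → s ^ 2 = μ j →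
      Complex.I / deriv (symbol n γ) (s * Complex.I) = ((d j / (2 * s) : ℝ) : ℂ))
    (hne : ∀ ξ : ℝ, symbol n γ ξ - κ ≠ 0)
    (hsum : ∀ ξ : ℝ, HasSum (fun j => ((d j / (μ j + ξ ^ 2) : ℝ) : ℂ)) (symbol n γ ξ - κ)⁻¹) :
    IsSpectral n γ κ := by
  have hσ : ∀ j, sigma n γ κ j = √(μ j) := sigma_eq_of_isPole_iff (τ := fun j => √(μ j))
    (fun i j hij => Real.sqrt_lt_sqrt (hpos i).le (hμ hij)) (fun j => Real.sqrt_pos.2 (hpos j))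
    fun s hs => by
      rw [hpole s hs]
      exact exists_congr fun j => ⟨fun h => by rw [← h, Real.sqrt_sq hs.le],
        fun h => by rw [h, Real.sq_sqrt (hpos j).le]⟩
  have hσpos : ∀ j, 0 < sigma n γ κ j := fun j => by rw [hσ]; exact Real.sqrt_pos.2 (hpos j)
  have hσsq : ∀ j, sigma n γ κ j ^ 2 = μ j := fun j => by rw [hσ, Real.sq_sqrt (hpos j).le]
  have hc : ∀ j, coeff n γ κ j = d j / (2 * sigma n γ κ j) := fun j => by
    rw [coeff, hderiv _ j (hσpos j) (hσsq j), Complex.ofReal_re]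
  have hterm : ∀ ξ : ℝ, ∀ j, 2 * coeff n γ κ j * sigma n γ κ j / (sigma n γ κ j ^ 2 + ξ ^ 2) =
      d j / (μ j + ξ ^ 2) := fun ξ j => by
    have h1 := (hσpos j).ne'
    rw [hc, hσsq]
    congr 1
    field_simp
  refine ⟨hσpos, fun i j hij => ?_, ?_, fun j => ?_, ?_, hne, fun ξ => ?_⟩
  · rw [hσ, hσ]
    exact Real.sqrt_lt_sqrt (hpos i).le (hμ hij)
  · rw [hσ]
    refine Real.sqrt_le_iff.2 ⟨by linarith, hle.trans (le_of_eq ?_)⟩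
    rw [poleSq]
    push_cast
    ring
  · rw [hc]
    exact div_nonneg (hd j) (by linarith [hσpos j])
  · have h0 := Complex.summable_ofReal.1 (hsum 0).summable
    refine (h0.div_const 2).congr fun j => ?_
    have h1 := (hσpos j).ne'
    rw [hc, ← hσsq]
    field_simp
    ring
  · simp_rw [hterm]
    exact hsum ξ

end Poles

/-! ### Spectral data for `0 ≤ κ < Λ`. -/

section Spectral

variable {n : ℕ} {γ κ : ℝ}

theorem symbol_zero : symbol n γ 0 = hardyConst n γ := by
  have h1 : (n / 4 + γ / 2 : ℂ) = (((n + 2 * γ) / 4 : ℝ) : ℂ) := by push_cast; ring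
  have h2 : (n / 4 - γ / 2 : ℂ) = (((n - 2 * γ) / 4 : ℝ) : ℂ) := by push_cast; ring
  simp only [symbol, hardyConst, zero_mul, zero_div, add_zero, sub_zero, h1, h2,
    Complex.Gamma_ofReal]
  push_cast
  ring

theorem neg_ne_poleSq (hγ0 : 0 < γ) (hγ1 : γ < 1) (hn : 2 * γ < n) (ξ : ℝ) (k : ℕ) :
    -ξ ^ 2 ≠ poleSq n γ k := by
  have := (isCauchyData_pole hγ0 hγ1 hn).pos k
  have := sq_nonneg ξ
  intro h
  linarith

theorem inv_symbol_real (hγ0 : 0 < γ) (hγ1 : γ < 1) (hn : 2 * γ < n) (ξ : ℝ) :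
    (symbol n γ ξ)⁻¹ = cauchySumReal (poleWeight n γ) (poleSq n γ) (-ξ ^ 2) := by
  rw [inv_symbol hγ0 hγ1 hn fun k => ?_, ← IsCauchyData.ofReal]
  · push_cast
    rfl
  · exact_mod_cast neg_ne_poleSq hγ0 hγ1 hn ξ k

theorem cauchySumReal_pos (hγ0 : 0 < γ) (hγ1 : γ < 1) (hn : 2 * γ < n) (ξ : ℝ) :
    0 < cauchySumReal (poleWeight n γ) (poleSq n γ) (-ξ ^ 2) := by
  have h := isCauchyData_pole hγ0 hγ1 hn
  have hξ := sq_nonneg ξ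
  refine (h.summable_real fun k => neg_ne_poleSq hγ0 hγ1 hn ξ k).tsum_pos (fun k => ?_) 0 ?_
  · exact div_nonneg (h.nonneg k) (by linarith [h.pos k])
  · exact div_pos (poleWeight_pos hγ0 hγ1 hn 0) (by linarith [h.pos 0])

/-- On the real line `m (-ξ²) ≤ m (0)`, hence `Θ₀ (ξ) ≥ Θ₀ (0) = Λ > κ`. -/
theorem symbol_real_ne (hγ0 : 0 < γ) (hγ1 : γ < 1) (hn : 2 * γ < n)
    (hκ1 : κ < hardyConst n γ) (ξ : ℝ) : symbol n γ ξ - κ ≠ 0 := by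
  have h := isCauchyData_pole hγ0 hγ1 hn
  have hpos := cauchySumReal_pos hγ0 hγ1 hn
  intro h0
  have h1 := inv_symbol_real hγ0 hγ1 hn ξ
  have h2 := inv_symbol_real hγ0 hγ1 hn 0
  have hle : cauchySumReal (poleWeight n γ) (poleSq n γ) (-ξ ^ 2) ≤
      cauchySumReal (poleWeight n γ) (poleSq n γ) (-0 ^ 2) :=
    h.monotone_gap (by nlinarith [sq_nonneg ξ]) fun i => Or.inl (by simpa using h.pos i)
  rw [sub_eq_zero.1 h0, ← Complex.ofReal_inv, Complex.ofReal_inj] at h1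
  rw [Complex.ofReal_zero, symbol_zero, ← Complex.ofReal_inv, Complex.ofReal_inj] at h2
  have h3 := hpos ξ
  rw [← h1, ← h2] at hle
  rw [← h1] at h3
  have h4 := inv_pos.1 h3
  have := (inv_lt_inv₀ (h4.trans hκ1) h4).2 hκ1
  linarith

/-- Away from the nodes `1/Θ₀` has a finite limit, so `Θ₀` cannot tend to `0`; at the nodes `Θ₀` has
a simple zero. -/
theorem isPole_zero_iff (hγ0 : 0 < γ) (hγ1 : γ < 1) (hn : 2 * γ < n) {s : ℝ} (hs : 0 < s) :
    IsPole n γ 0 (s * Complex.I) ↔ ∃ k, s ^ 2 = poleSq n γ k := by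
  have h := isCauchyData_pole hγ0 hγ1 hn
  constructor
  · intro hp
    by_contra! hne
    have hz : ∀ k, -((s : ℂ) * Complex.I) ^ 2 ≠ poleSq n γ k := fun k => by
      rw [neg_sq_mul_I]
      exact_mod_cast hne k
    rw [isPole_iff, Complex.ofReal_zero] at hp
    simp only [sub_zero] at hp
    have h1 : Tendsto (fun ζ => (symbol n γ ζ)⁻¹) (𝓝[≠] ((s : ℂ) * Complex.I))
        (𝓝 (cauchySum (poleWeight n γ) (poleSq n γ) (-((s : ℂ) * Complex.I) ^ 2))) := by
      have hc : ContinuousAt (fun ζ : ℂ => cauchySum (poleWeight n γ) (poleSq n γ) (-ζ ^ 2))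
          ((s : ℂ) * Complex.I) :=
        ContinuousAt.comp (f := fun ζ : ℂ => -ζ ^ 2) (h.hasDerivAt hz).continuousAt (by fun_prop)
      refine (hc.tendsto.mono_left nhdsWithin_le_nhds).congr' ?_
      filter_upwards [nhdsWithin_le_nhds (eventually_inv_symbol hγ0 hγ1 hn hz)] with ζ hζ
      exact hζ.2.symm
    have h2 := (hp.mono_right nhdsWithin_le_nhds).mul h1
    rw [zero_mul] at h2
    refine zero_ne_one (tendsto_nhds_unique h2 (tendsto_const_nhds.congr' ?_))
    filter_upwards [hp.eventually self_mem_nhdsWithin] with ζ hζ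
    exact (mul_inv_cancel₀ hζ).symm
  · rintro ⟨k, hk⟩
    have hz : -((s : ℂ) * Complex.I) ^ 2 = poleSq n γ k := by rw [neg_sq_mul_I, hk]
    refine isPole_of_hasDerivAt (hasDerivAt_symbol_zero hγ0 hγ1 hn hz) ?_
      (by rw [symbol_eq_zero hz, Complex.ofReal_zero])
    have hw : (poleWeight n γ k : ℂ) ≠ 0 := by exact_mod_cast (poleWeight_pos hγ0 hγ1 hn k).ne'
    have hs' : (s : ℂ) ≠ 0 := by exact_mod_cast hs.ne'
    exact div_ne_zero (mul_ne_zero two_ne_zero (mul_ne_zero hs' Complex.I_ne_zero)) hw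

theorem isSpectral_zero (hγ0 : 0 < γ) (hγ1 : γ < 1) (hn : 2 * γ < n)
    (hκ1 : 0 < hardyConst n γ) : IsSpectral n γ 0 := by
  have h := isCauchyData_pole hγ0 hγ1 hn
  refine isSpectral_of hn h.strictMono h.pos le_rfl h.nonneg (fun s hs => isPole_zero_iff hγ0 hγ1 hn hs)
    (fun s k hs hk => ?_) (symbol_real_ne hγ0 hγ1 hn hκ1) fun ξ => ?_
  · have hz : -((s : ℂ) * Complex.I) ^ 2 = poleSq n γ k := by rw [neg_sq_mul_I, hk]
    rw [(hasDerivAt_symbol_zero hγ0 hγ1 hn hz).deriv]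
    have hw : (poleWeight n γ k : ℂ) ≠ 0 := by exact_mod_cast (poleWeight_pos hγ0 hγ1 hn k).ne'
    have hs' : (s : ℂ) ≠ 0 := by exact_mod_cast hs.ne'
    have := Complex.I_ne_zero
    push_cast
    field_simp
  · rw [Complex.ofReal_zero, sub_zero, inv_symbol_real hγ0 hγ1 hn, Complex.hasSum_ofReal]
    refine (h.summable_real (neg_ne_poleSq hγ0 hγ1 hn ξ)).hasSum.congr_fun fun k => ?_
    rw [sub_neg_eq_add]

/-- The level is `v = 1/κ`; the assumption `κ < Λ` says `m (0) < v`, which puts the first root in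
`(0, l_0)`. -/
theorem isSpectral_of_pos (hγ0 : 0 < γ) (hγ1 : γ < 1) (hn : 2 * γ < n)
    (hκ0 : 0 < κ) (hκ1 : κ < hardyConst n γ) : IsSpectral n γ κ := by
  have h := isCauchyData_pole hγ0 hγ1 hn
  have hw := poleWeight_pos (n := n) hγ0 hγ1 hn
  have hv : cauchySumReal (poleWeight n γ) (poleSq n γ) 0 < κ⁻¹ := by
    have h2 := inv_symbol_real hγ0 hγ1 hn 0
    rw [Complex.ofReal_zero, symbol_zero, ← Complex.ofReal_inv, Complex.ofReal_inj,
      zero_pow two_ne_zero, neg_zero] at h2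
    rw [← h2]
    exact (inv_lt_inv₀ (hκ0.trans hκ1) hκ0).2 hκ1
  obtain ⟨μ, hμ⟩ := h.exists_isRootSeq hw hv
  set D : ℕ → ℝ := fun j => ∑' k, poleWeight n γ k / (poleSq n γ k - μ j) ^ 2 with hD
  have hzs : ∀ (s : ℝ) (x : ℝ), s ^ 2 = x → -((s : ℂ) * Complex.I) ^ 2 = x := fun s x hx => by
    rw [neg_sq_mul_I, hx]
  have hroot : ∀ (s : ℝ) j, s ^ 2 = μ j →
      (∀ k, -((s : ℂ) * Complex.I) ^ 2 ≠ poleSq n γ k) ∧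
      cauchySum (poleWeight n γ) (poleSq n γ) (-((s : ℂ) * Complex.I) ^ 2) = (κ : ℂ)⁻¹ := by
    intro s j hj
    rw [hzs s _ hj]
    refine ⟨fun k => by exact_mod_cast hμ.gap h j k, ?_⟩
    rw [IsCauchyData.ofReal, hμ.root, Complex.ofReal_inv]
  have hκ' : (κ : ℂ) ≠ 0 := by exact_mod_cast hκ0.ne'
  have hderiv : ∀ (s : ℝ) j, s ^ 2 = μ j → HasDerivAt (symbol n γ)
      (2 * ((s : ℂ) * Complex.I) * (D j : ℂ) / ((κ : ℂ)⁻¹) ^ 2) ((s : ℂ) * Complex.I) := by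
    intro s j hj
    obtain ⟨h1, h2⟩ := hroot s j hj
    refine (hasDerivAt_symbol hγ0 hγ1 hn h1 (by rw [h2]; exact inv_ne_zero hκ')).congr_deriv ?_
    rw [h2, hzs s _ hj, hD]
    push_cast
    rfl
  have hDpos : ∀ j, 0 < D j := fun j => h.tsum_sq_pos hw (hμ.gap h j)
  refine isSpectral_of (μ := μ) (d := fun j => κ⁻¹ ^ 2 / D j) hn hμ.strictMono hμ.pos (hμ.lt 0).le
    (fun j => div_nonneg (sq_nonneg _) (hDpos j).le) (fun s hs => ⟨fun hp => ?_, ?_⟩)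
    (fun s j hs hj => ?_) (symbol_real_ne hγ0 hγ1 hn hκ1) fun ξ => ?_
  · rw [isPole_iff] at hp
    have hp1 : Tendsto (symbol n γ) (𝓝[≠] ((s : ℂ) * Complex.I)) (𝓝 κ) := by
      simpa using (hp.mono_right nhdsWithin_le_nhds).add_const (κ : ℂ)
    -- `Θ₀` vanishes at the nodes, whereas it tends to `κ ≠ 0` at the pole considered. Near that
    -- pole `1/Θ₀ = m` is therefore available.
    have hs2 : ∀ k, s ^ 2 ≠ poleSq n γ k := fun k hk => by
      have h1 := (hasDerivAt_symbol_zero hγ0 hγ1 hn (hzs s _ hk)).continuousAt.tendsto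
      rw [symbol_eq_zero (hzs s _ hk)] at h1
      exact hκ' (tendsto_nhds_unique hp1 (h1.mono_left nhdsWithin_le_nhds))
    refine hμ.exists_eq h hw hs2 ?_
    have hz : ∀ k, -((s : ℂ) * Complex.I) ^ 2 ≠ poleSq n γ k := fun k => by
      rw [neg_sq_mul_I]
      exact_mod_cast hs2 k
    have hc : ContinuousAt (fun ζ : ℂ => cauchySum (poleWeight n γ) (poleSq n γ) (-ζ ^ 2))
        ((s : ℂ) * Complex.I) :=
      ContinuousAt.comp (f := fun ζ : ℂ => -ζ ^ 2) (h.hasDerivAt hz).continuousAt (by fun_prop)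
    have h1 := hc.tendsto.mono_left (nhdsWithin_le_nhds (s := {(s : ℂ) * Complex.I}ᶜ))
    have h2 := (hp1.inv₀ hκ').congr' (f₂ := fun ζ : ℂ =>
        cauchySum (poleWeight n γ) (poleSq n γ) (-ζ ^ 2)) (by
      filter_upwards [nhdsWithin_le_nhds (eventually_inv_symbol hγ0 hγ1 hn hz)] with ζ hζ
      exact hζ.2)
    have h3 := tendsto_nhds_unique h1 h2
    rw [neg_sq_mul_I, IsCauchyData.ofReal] at h3
    exact_mod_cast h3
  · rintro ⟨j, hj⟩
    obtain ⟨h1, h2⟩ := hroot s j hj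
    refine isPole_of_hasDerivAt (hderiv s j hj) ?_ ?_
    · have hs' : (s : ℂ) ≠ 0 := by exact_mod_cast hs.ne'
      have hD' : (D j : ℂ) ≠ 0 := by exact_mod_cast (hDpos j).ne'
      exact div_ne_zero (mul_ne_zero (mul_ne_zero two_ne_zero
        (mul_ne_zero hs' Complex.I_ne_zero)) hD') (pow_ne_zero 2 (inv_ne_zero hκ'))
    · rw [← inv_inj, inv_symbol hγ0 hγ1 hn h1, h2]
  · rw [(hderiv s j hj).deriv]
    have hs' : (s : ℂ) ≠ 0 := by exact_mod_cast hs.ne'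
    have hD' : (D j : ℂ) ≠ 0 := by exact_mod_cast (hDpos j).ne'
    have := Complex.I_ne_zero
    push_cast
    field_simp
  · have hm := inv_symbol_real hγ0 hγ1 hn ξ
    have hmpos := cauchySumReal_pos hγ0 hγ1 hn ξ
    have key := h.hasSum_partialFractions hw hv hμ (sq_nonneg ξ)
    have hlt : cauchySumReal (poleWeight n γ) (poleSq n γ) (-ξ ^ 2) < κ⁻¹ :=
      (h.monotone_gap (by linarith [sq_nonneg ξ]) fun k => Or.inl (h.pos k)).trans_lt hv
    rw [← Complex.hasSum_ofReal] at key
    -- With `v = κ⁻¹`, `v m / (v - m) = 1 / (m⁻¹ - κ)` and `m⁻¹ = Θ₀`.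
    convert key using 1
    have h1 : symbol n γ ξ =
        ((cauchySumReal (poleWeight n γ) (poleSq n γ) (-ξ ^ 2))⁻¹ : ℝ) := by
      rw [Complex.ofReal_inv, ← hm, inv_inv]
    rw [h1, ← Complex.ofReal_sub, ← Complex.ofReal_inv, Complex.ofReal_inj]
    set m := cauchySumReal (poleWeight n γ) (poleSq n γ) (-ξ ^ 2)
    have h2 : κ⁻¹ - m ≠ 0 := by linarith
    have h3 : m⁻¹ - κ = κ * (κ⁻¹ - m) / m := by field_simp
    rw [h3]
    field_simp

theorem isSpectral (hγ0 : 0 < γ) (hγ1 : γ < 1) (hn : 2 * γ < n)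
    (hκ0 : 0 ≤ κ) (hκ1 : κ < hardyConst n γ) : IsSpectral n γ κ := by
  rcases hκ0.eq_or_lt with rfl | hκ
  · exact isSpectral_zero hγ0 hγ1 hn hκ1
  · exact isSpectral_of_pos hγ0 hγ1 hn hκ hκ1

end Spectral

/-! ### Mellin transforms of pairings with Gaussians. -/

section GaussianMellin

variable {n : ℕ}

theorem integrableOn_rpow_mul_exp_neg {a r : ℝ} (ha : 0 < a) (hr : 0 < r) :
    IntegrableOn (fun t : ℝ => t ^ (a - 1) * rexp (-(r * t))) (Ioi 0) := by
  have := integrableOn_rpow_mul_exp_neg_mul_rpow (s := a - 1) (p := 1) (b := r) (by linarith)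
    zero_lt_one hr
  simpa using this

/-- The Mellin transform in `τ` of the pairing of `f` with the Gaussians `e^{-πτ|x|²}`. -/
theorem mellin_gaussian_pairing [Nontrivial (E n)] {f : E n → ℂ} {s : ℂ} (hs : 0 < s.re)
    (hf : AEStronglyMeasurable f) (hint : Integrable fun x => ‖f x‖ * ‖x‖ ^ (-s.re)) :
    mellin (fun τ => ∫ x, f x * ((rexp (-(π * ‖x‖ ^ 2 * τ)) : ℝ) : ℂ)) (s / 2) =
      (π : ℂ) ^ (-s / 2) * Complex.Gamma (s / 2) * ∫ x, f x * (‖x‖ : ℂ) ^ (-s) := by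
  have hs2 : 0 < (s / 2).re := by
    rw [show (s / 2).re = s.re / 2 by simp]
    linarith
  have hre : (s / 2 - 1).re = s.re / 2 - 1 := by simp
  have hne : ∀ᵐ x : E n, x ≠ 0 := by
    rw [ae_iff]
    simp
  have hr : ∀ x : E n, x ≠ 0 → 0 < π * ‖x‖ ^ 2 := fun x hx => by
    have := norm_pos_iff.2 hx
    positivity
  let K : ℝ → E n → ℂ := fun τ x =>
    (τ : ℂ) ^ (s / 2 - 1) * (f x * ((rexp (-(π * ‖x‖ ^ 2 * τ)) : ℝ) : ℂ))
  have hKnorm : ∀ τ : ℝ, 0 < τ → ∀ x, ‖K τ x‖ =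
      ‖f x‖ * (τ ^ (s.re / 2 - 1) * rexp (-(π * ‖x‖ ^ 2 * τ))) := by
    intro τ hτ x
    simp only [K]
    rw [norm_mul, norm_mul, Complex.norm_cpow_eq_rpow_re_of_pos hτ, hre, Complex.norm_real,
      Real.norm_of_nonneg (Real.exp_pos _).le]
    ring
  have hKmeas : AEStronglyMeasurable (Function.uncurry K)
      ((volume.restrict (Ioi 0)).prod (volume : Measure (E n))) := by
    have h1 : Measurable fun p : ℝ × E n => (p.1 : ℂ) ^ (s / 2 - 1) :=
      (Complex.measurable_ofReal.comp measurable_fst).pow_const _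
    have h2 : Continuous fun p : ℝ × E n => ((rexp (-(π * ‖p.2‖ ^ 2 * p.1)) : ℝ) : ℂ) := by
      fun_prop
    exact h1.aestronglyMeasurable.mul (hf.comp_snd.mul h2.aestronglyMeasurable)
  have hKint : Integrable (Function.uncurry K)
      ((volume.restrict (Ioi 0)).prod (volume : Measure (E n))) := by
    rw [integrable_prod_iff' hKmeas]
    refine ⟨?_, ?_⟩
    · filter_upwards [hne] with x hx
      have h1 := (integrableOn_rpow_mul_exp_neg (a := s.re / 2) (by linarith) (hr x hx)).const_mul
        ‖f x‖
      refine h1.mono' ?_ ((ae_restrict_iff' measurableSet_Ioi).2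
        (.of_forall fun τ hτ => (hKnorm τ hτ x).le))
      have h2 : Measurable fun τ : ℝ => (τ : ℂ) ^ (s / 2 - 1) :=
        Complex.measurable_ofReal.pow_const _
      have h3 : Continuous fun τ : ℝ => f x * ((rexp (-(π * ‖x‖ ^ 2 * τ)) : ℝ) : ℂ) := by
        fun_prop
      exact h2.aestronglyMeasurable.mul h3.aestronglyMeasurable
    · refine (hint.const_mul (π ^ (-(s.re / 2)) * Real.Gamma (s.re / 2))).congr ?_
      filter_upwards [hne] with x hx
      have h1 : ∫ τ in Ioi (0 : ℝ), ‖K τ x‖ =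
          ∫ τ in Ioi (0 : ℝ), ‖f x‖ * (τ ^ (s.re / 2 - 1) * rexp (-(π * ‖x‖ ^ 2 * τ))) :=
        setIntegral_congr_fun measurableSet_Ioi fun τ hτ => hKnorm τ hτ x
      simp only [Function.uncurry]
      rw [h1, integral_const_mul, Real.integral_rpow_mul_exp_neg_mul_Ioi (by linarith) (hr x hx)]
      have h2 := norm_pos_iff.2 hx
      have h3 : (1 / (π * ‖x‖ ^ 2)) ^ (s.re / 2) = π ^ (-(s.re / 2)) * ‖x‖ ^ (-s.re) := by
        rw [one_div, Real.inv_rpow (hr x hx).le, ← Real.rpow_neg (hr x hx).le,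
          Real.mul_rpow pi_pos.le (by positivity), ← Real.rpow_natCast, ← Real.rpow_mul h2.le]
        congr 2
        push_cast
        ring
      rw [h3]
      ring
  -- Fubini reduces the claim to `∫ τ^{s/2-1} e^{-π|x|²τ} dτ = Γ(s/2) (π|x|²)^{-s/2}`.
  have hswap := integral_integral_swap (f := K) hKint
  rw [mellin]
  calc ∫ τ in Ioi (0 : ℝ), (τ : ℂ) ^ (s / 2 - 1) •
        ∫ x, f x * ((rexp (-(π * ‖x‖ ^ 2 * τ)) : ℝ) : ℂ) = ∫ τ in Ioi (0 : ℝ), ∫ x, K τ x := by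
        refine setIntegral_congr_fun measurableSet_Ioi fun τ _ => ?_
        simp only [K, smul_eq_mul, integral_const_mul]
    _ = ∫ x, ∫ τ in Ioi (0 : ℝ), K τ x := hswap
    _ = ∫ x, (π : ℂ) ^ (-s / 2) * Complex.Gamma (s / 2) * (f x * (‖x‖ : ℂ) ^ (-s)) := by
        refine integral_congr_ae ?_
        filter_upwards [hne] with x hx
        have h1 := Complex.integral_cpow_mul_exp_neg_mul_Ioi hs2 (hr x hx)
        have h2 : ∫ τ in Ioi (0 : ℝ), K τ x = f x * ∫ τ in Ioi (0 : ℝ), (τ : ℂ) ^ (s / 2 - 1) *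
            Complex.exp (-((π * ‖x‖ ^ 2 : ℝ) * τ)) := by
          rw [← integral_const_mul]
          refine setIntegral_congr_fun measurableSet_Ioi fun τ _ => ?_
          simp only [K]
          push_cast
          ring
        have hx0 := norm_pos_iff.2 hx
        have h3 : (1 / ((π * ‖x‖ ^ 2 : ℝ) : ℂ)) ^ (s / 2) =
            (π : ℂ) ^ (-s / 2) * (‖x‖ : ℂ) ^ (-s) := by
          rw [one_div, Complex.inv_cpow _ _ (by
            rw [Complex.arg_ofReal_of_nonneg (hr x hx).le]; exact pi_pos.ne), ← Complex.cpow_neg,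
            Complex.ofReal_mul, Complex.mul_cpow_ofReal_nonneg pi_pos.le (by positivity), neg_div]
          congr 1
          have hx1 : (‖x‖ : ℂ) ≠ 0 := by exact_mod_cast hx0.ne'
          rw [Complex.cpow_def_of_ne_zero hx1, Complex.cpow_def_of_ne_zero (by
            rw [Complex.ofReal_pow]; exact pow_ne_zero 2 hx1), ← Complex.ofReal_log (by positivity),
            ← Complex.ofReal_log hx0.le, Real.log_pow]
          congr 1
          push_cast
          ring
        rw [h2, h1, h3]
        ring
    _ = _ := integral_const_mul _ _

/-- If `f` and `g` pair with Gaussians like a Fourier pair, then so do they with powers of `|x|`. -/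
theorem pairing_norm_cpow [Nontrivial (E n)] {f g : E n → ℂ} {s : ℂ} (hs : 0 < s.re)
    (hsn : s.re < n) (hf : AEStronglyMeasurable f) (hg : AEStronglyMeasurable g)
    (hfi : Integrable fun x => ‖f x‖ * ‖x‖ ^ (-s.re))
    (hgi : Integrable fun x => ‖g x‖ * ‖x‖ ^ (s.re - n))
    (hfg : ∀ τ : ℝ, 0 < τ → ∫ x, f x * ((rexp (-(π * ‖x‖ ^ 2 * τ)) : ℝ) : ℂ) =
      (τ : ℂ) ^ (-(n / 2 : ℂ)) * ∫ x, g x * ((rexp (-(π * ‖x‖ ^ 2 * τ⁻¹)) : ℝ) : ℂ)) :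
    (π : ℂ) ^ (-s / 2) * Complex.Gamma (s / 2) * ∫ x, f x * (‖x‖ : ℂ) ^ (-s) =
      (π : ℂ) ^ (-(n - s) / 2) * Complex.Gamma ((n - s) / 2) *
        ∫ x, g x * (‖x‖ : ℂ) ^ (s - n) := by
  have h1 := mellin_gaussian_pairing hs hf hfi
  have h2 := mellin_gaussian_pairing (s := n - s) (f := g) (by simpa using hsn) hg (by
    simpa using hgi)
  rw [neg_sub] at h2
  rw [← h1, neg_sub, ← h2]
  have h3 : mellin (fun τ => ∫ x, f x * ((rexp (-(π * ‖x‖ ^ 2 * τ)) : ℝ) : ℂ)) (s / 2) =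
      mellin (fun τ : ℝ => (τ : ℂ) ^ (-(n / 2 : ℂ)) •
        (fun τ : ℝ => ∫ x, g x * ((rexp (-(π * ‖x‖ ^ 2 * τ)) : ℝ) : ℂ)) τ⁻¹) (s / 2) :=
    setIntegral_congr_fun measurableSet_Ioi fun τ hτ => by
      simp only [hfg τ hτ, smul_eq_mul]
  -- The power of `τ` shifts the Mellin exponent to `(s - n)/2`, and the inversion `τ ↦ τ⁻¹` changes
  -- it to `(n - s)/2`.
  rw [h3, mellin_cpow_smul]
  refine (mellin_comp_inv
    (fun τ : ℝ => ∫ x, g x * ((rexp (-(π * ‖x‖ ^ 2 * τ)) : ℝ) : ℂ)) _).trans ?_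
  congr 1
  ring

end GaussianMellin

/-! ### The fractional Laplacian of test functions: integrability and symmetries. -/

section TestFunctions

variable {n : ℕ}

/-- In polar coordinates `a < n` handles the origin and `n < a + M` handles infinity. -/
theorem integrable_norm_rpow_mul_one_add [Nontrivial (E n)] {a M : ℝ} (ha : a < n)
    (haM : n < a + M) (hM : 0 ≤ M) :
    Integrable fun x : E n => ‖x‖ ^ (-a) * (1 + ‖x‖) ^ (-M) := by
  have hn : 1 ≤ n := by
    rcases Nat.eq_zero_or_pos n with rfl | h
    · exact absurd (inferInstance : Subsingleton (E 0)) (not_subsingleton (E 0))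
    · exact h
  have hcast : ((n - 1 : ℕ) : ℝ) = n - 1 := by
    rw [Nat.cast_sub hn, Nat.cast_one]
  rw [integrable_fun_norm_addHaar volume (f := fun r : ℝ => r ^ (-a) * (1 + r) ^ (-M)),
    finrank_euclideanSpace_fin, ← Ioc_union_Ioi_eq_Ioi zero_le_one]
  have hmeas : Measurable fun r : ℝ => r ^ (n - 1) • (r ^ (-a) * (1 + r) ^ (-M)) := by
    simp only [smul_eq_mul]
    measurability
  refine IntegrableOn.union ?_ ?_
  · have h1 : IntegrableOn (fun r : ℝ => r ^ ((n : ℝ) - 1 - a)) (Ioc 0 1) := by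
      have := intervalIntegral.intervalIntegrable_rpow' (a := 0) (b := 1)
        (r := (n : ℝ) - 1 - a) (by linarith)
      rwa [intervalIntegrable_iff_integrableOn_Ioc_of_le zero_le_one] at this
    refine h1.mono' hmeas.aestronglyMeasurable ((ae_restrict_iff' measurableSet_Ioc).2
      (.of_forall fun r hr => ?_))
    have hr0 : 0 < r := hr.1
    have h2 : (1 + r) ^ (-M) ≤ 1 := Real.rpow_le_one_of_one_le_of_nonpos (by linarith) (neg_nonpos.2 hM)
    rw [Real.norm_of_nonneg (by positivity), smul_eq_mul, ← Real.rpow_natCast, ← mul_assoc,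
      ← Real.rpow_add hr0, hcast, ← sub_eq_add_neg]
    exact mul_le_of_le_one_right (by positivity) h2
  · refine (integrableOn_Ioi_rpow_of_lt (a := (n : ℝ) - 1 - a - M) (by linarith)
      zero_lt_one).mono' hmeas.aestronglyMeasurable ((ae_restrict_iff' measurableSet_Ioi).2
      (.of_forall fun r hr => ?_))
    have hr1 : 1 < r := hr
    have hr0 : 0 < r := by linarith
    have h2 : (1 + r) ^ (-M) ≤ r ^ (-M) :=
      Real.rpow_le_rpow_of_nonpos hr0 (by linarith) (neg_nonpos.2 hM)
    rw [Real.norm_of_nonneg (by positivity), smul_eq_mul, ← Real.rpow_natCast, ← mul_assoc,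
      ← Real.rpow_add hr0, hcast, ← sub_eq_add_neg, sub_eq_add_neg _ M, Real.rpow_add hr0]
    gcongr

theorem fourier_decay {η : E n → ℂ} (hη : ContDiff ℝ ∞ η) (hc : HasCompactSupport η) (M : ℕ) :
    ∃ C, 0 ≤ C ∧ ∀ k, ‖𝓕 η k‖ ≤ C * (1 + ‖k‖) ^ (-(M : ℝ)) := by
  let f : SchwartzMap (E n) ℂ := 𝓕 (hc.toSchwartzMap hη)
  have hf : ∀ k, f k = 𝓕 η k := fun k => rfl
  obtain ⟨C, hC⟩ : ∃ C, ∀ k, (1 + ‖k‖) ^ M * ‖𝓕 η k‖ ≤ C := ⟨_, fun k => by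
    have := SchwartzMap.one_add_le_sup_seminorm_apply (𝕜 := ℝ) (m := (M, 0)) (k := M)
      (n := 0) le_rfl le_rfl f k
    rwa [norm_iteratedFDeriv_zero, hf] at this⟩
  refine ⟨C, le_trans (by positivity) (hC 0), fun k => ?_⟩
  rw [Real.rpow_neg (by positivity), Real.rpow_natCast, ← div_eq_mul_inv,
    le_div_iff₀ (by positivity), mul_comm]
  exact hC k

theorem fourier_continuous {η : E n → ℂ} (hη : ContDiff ℝ ∞ η) (hc : HasCompactSupport η) :
    Continuous (𝓕 η) :=
  (𝓕 (hc.toSchwartzMap hη) : SchwartzMap (E n) ℂ).continuous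

theorem fourier_integrable {η : E n → ℂ} (hη : ContDiff ℝ ∞ η) (hc : HasCompactSupport η) :
    Integrable (𝓕 η) :=
  (𝓕 (hc.toSchwartzMap hη) : SchwartzMap (E n) ℂ).integrable

/-- The Fourier transform of `(-Δ)^γ η`. -/
def fracSymbolMul (γ : ℝ) (η : E n → ℂ) (k : E n) : ℂ :=
  (((2 * π * ‖k‖) ^ (2 * γ) : ℝ) : ℂ) * 𝓕 η k

theorem fracLaplacian_eq (γ : ℝ) (η : E n → ℂ) : fracLaplacian γ η = 𝓕⁻ (fracSymbolMul γ η) := rfl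

variable {γ : ℝ} {η : E n → ℂ}

theorem norm_fracSymbolMul (k : E n) :
    ‖fracSymbolMul γ η k‖ = (2 * π) ^ (2 * γ) * ‖k‖ ^ (2 * γ) * ‖𝓕 η k‖ := by
  rw [fracSymbolMul, norm_mul, Complex.norm_real, Real.norm_of_nonneg (by positivity),
    Real.mul_rpow (by positivity) (norm_nonneg _)]

theorem continuous_fracSymbolMul (hγ : 0 < γ) (hη : ContDiff ℝ ∞ η) (hc : HasCompactSupport η) :
    Continuous (fracSymbolMul γ η) := by
  have h1 : Continuous fun k : E n => (2 * π * ‖k‖) ^ (2 * γ) :=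
    (continuous_const.mul continuous_norm).rpow_const fun _ => Or.inr (by linarith)
  exact (Complex.continuous_ofReal.comp h1).mul (fourier_continuous hη hc)

theorem integrable_fourier_mul_rpow [Nontrivial (E n)] (hη : ContDiff ℝ ∞ η)
    (hc : HasCompactSupport η) {b : ℝ} (hb : -(n : ℝ) < b) :
    Integrable fun k => ‖𝓕 η k‖ * ‖k‖ ^ b := by
  obtain ⟨M, hM⟩ := exists_nat_gt ((n : ℝ) + b)
  obtain ⟨C, hC0, hC⟩ := fourier_decay hη hc M
  refine ((integrable_norm_rpow_mul_one_add (a := -b) (M := M) (by linarith) (by linarith)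
    (Nat.cast_nonneg M)).const_mul C).mono' ?_ (.of_forall fun k => ?_)
  · exact (fourier_continuous hη hc).norm.aestronglyMeasurable.mul
      (measurable_norm.pow_const b).aestronglyMeasurable
  · rw [Real.norm_of_nonneg (by positivity), neg_neg]
    calc ‖𝓕 η k‖ * ‖k‖ ^ b ≤ C * (1 + ‖k‖) ^ (-(M : ℝ)) * ‖k‖ ^ b := by gcongr; exact hC k
      _ = _ := by ring

theorem integrable_fracSymbolMul_mul_rpow [Nontrivial (E n)] (hη : ContDiff ℝ ∞ η)
    (hc : HasCompactSupport η) {b : ℝ} (hb : -(n : ℝ) < 2 * γ + b) :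
    Integrable fun k => ‖fracSymbolMul γ η k‖ * ‖k‖ ^ b := by
  refine ((integrable_fourier_mul_rpow hη hc hb).const_mul ((2 * π) ^ (2 * γ))).congr ?_
  have hne : ∀ᵐ x : E n, x ≠ 0 := by
    rw [ae_iff]
    simp
  filter_upwards [hne] with k hk
  rw [norm_fracSymbolMul, Real.rpow_add (norm_pos_iff.2 hk)]
  ring

theorem integrable_fracSymbolMul [Nontrivial (E n)] (hγ : 0 < γ) (hη : ContDiff ℝ ∞ η)
    (hc : HasCompactSupport η) : Integrable (fracSymbolMul γ η) := by
  have := integrable_fracSymbolMul_mul_rpow (γ := γ) (b := 0) hη hc (by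
    have : (0 : ℝ) ≤ n := Nat.cast_nonneg n
    linarith)
  simp only [Real.rpow_zero, mul_one] at this
  exact (integrable_norm_iff (continuous_fracSymbolMul hγ hη hc).aestronglyMeasurable).1 this

theorem fracLaplacian_continuous [Nontrivial (E n)] (hγ : 0 < γ) (hη : ContDiff ℝ ∞ η)
    (hc : HasCompactSupport η) : Continuous (fracLaplacian γ η) := by
  have h1 : Continuous (𝓕 (fracSymbolMul γ η)) :=
    VectorFourier.fourierIntegral_continuous Real.continuous_fourierChar
      (by exact continuous_inner) (integrable_fracSymbolMul hγ hη hc)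
  have h2 : fracLaplacian γ η = fun x => 𝓕 (fracSymbolMul γ η) (-x) := by
    funext x
    rw [fracLaplacian_eq, Real.fourierInv_eq_fourier_neg]
  rw [h2]
  exact h1.comp continuous_neg

theorem fracLaplacian_norm_le (x : E n) :
    ‖fracLaplacian γ η x‖ ≤ ∫ k, ‖fracSymbolMul γ η k‖ := by
  rw [fracLaplacian_eq, Real.fourierInv_eq_fourier_neg]
  exact VectorFourier.norm_fourierIntegral_le_integral_norm _ _ _ _ _

theorem fracLaplacian_comp_linearIsometry (A : E n ≃ₗᵢ[ℝ] E n) :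
    fracLaplacian γ (η ∘ A) = fracLaplacian γ η ∘ A := by
  have h : fracSymbolMul γ (η ∘ A) = fracSymbolMul γ η ∘ A := by
    funext k
    simp only [fracSymbolMul, Function.comp, Real.fourier_comp_linearIsometry,
      LinearIsometryEquiv.norm_map]
  funext x
  rw [Function.comp, fracLaplacian_eq, fracLaplacian_eq, ← Real.fourierInv_comp_linearIsometry, h]

/-- The multiplier `|ξ|^{2γ}` is homogeneous of degree `2γ`. -/
theorem fracLaplacian_comp_smul {a : ℝ} (ha : 0 < a) (x : E n) :
    fracLaplacian γ (fun y => η (a • y)) x = ((a ^ (2 * γ) : ℝ) : ℂ) * fracLaplacian γ η (a • x) := by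
  have hF : ∀ k : E n, 𝓕 (fun y => η (a • y)) (a • k) = ((a ^ n)⁻¹ : ℝ) • 𝓕 η k := by
    intro k
    rw [Real.fourier_eq, Real.fourier_eq]
    have := Measure.integral_comp_smul (volume : Measure (E n))
      (fun y => Real.fourierChar (-(inner ℝ y k)) • η y) a
    rw [finrank_euclideanSpace_fin, abs_of_pos (by positivity)] at this
    rw [← this]
    refine integral_congr_ae (.of_forall fun y => ?_)
    simp only [inner_smul_left, inner_smul_right]
    simp
  rw [fracLaplacian_eq, fracLaplacian_eq, Real.fourierInv_eq, Real.fourierInv_eq]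
  have := Measure.integral_comp_smul (volume : Measure (E n))
    (fun k => Real.fourierChar (inner ℝ k x) • fracSymbolMul γ (fun y => η (a • y)) k) a
  rw [finrank_euclideanSpace_fin, abs_of_pos (by positivity)] at this
  have h1 : ∀ k : E n, Real.fourierChar (inner ℝ (a • k) x) •
      fracSymbolMul γ (fun y => η (a • y)) (a • k) = ((a ^ n)⁻¹ : ℝ) • (((a ^ (2 * γ) : ℝ) : ℂ) *
        Real.fourierChar (inner ℝ k (a • x)) • fracSymbolMul γ η k) := by
    intro k
    have h2 : 2 * π * ‖a • k‖ = a * (2 * π * ‖k‖) := by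
      rw [norm_smul, Real.norm_of_nonneg ha.le]
      ring
    rw [fracSymbolMul, fracSymbolMul, hF, h2, Real.mul_rpow ha.le (by positivity),
      real_inner_smul_left, real_inner_smul_right]
    simp only [Circle.smul_def, smul_eq_mul, Complex.real_smul]
    push_cast
    ring
  simp only [h1, integral_smul, integral_const_mul] at this
  exact (smul_right_injective ℂ (by positivity : ((a ^ n)⁻¹ : ℝ) ≠ 0) this).symm

/-- The pairings of a Fourier pair with Gaussians. -/
theorem fourier_gaussian_pairing {f : E n → ℂ} (hf : Integrable f) {τ : ℝ} (hτ : 0 < τ) :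
    ∫ x, 𝓕 f x * ((rexp (-(π * ‖x‖ ^ 2 * τ)) : ℝ) : ℂ) =
      (τ : ℂ) ^ (-(n / 2 : ℂ)) * ∫ x, f x * ((rexp (-(π * ‖x‖ ^ 2 * τ⁻¹)) : ℝ) : ℂ) := by
  have hb : 0 < ((π * τ : ℝ) : ℂ).re := by
    rw [Complex.ofReal_re]
    positivity
  have hg : Integrable fun x : E n => Complex.exp (-((π * τ : ℝ) : ℂ) * ‖x‖ ^ 2) := by
    simpa using GaussianFourier.integrable_cexp_neg_mul_sq_norm_add hb 0 (0 : E n)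
  have h1 := VectorFourier.integral_fourierIntegral_smul_eq_flip (L := innerₗ (E n))
    (μ := volume) (ν := volume) Real.continuous_fourierChar (by exact continuous_inner) hf hg
  have h2 := fourier_gaussian_innerProductSpace (V := E n) hb
  have h3 : ∀ w : E n, VectorFourier.fourierIntegral Real.fourierChar volume (innerₗ (E n)).flip
      (fun x : E n => Complex.exp (-((π * τ : ℝ) : ℂ) * ‖x‖ ^ 2)) w =
      (τ : ℂ) ^ (-(n / 2 : ℂ)) * ((rexp (-(π * ‖w‖ ^ 2 * τ⁻¹)) : ℝ) : ℂ) := by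
    intro w
    rw [flip_innerₗ]
    refine (h2 w).trans ?_
    have hπ : (π : ℂ) ≠ 0 := by exact_mod_cast pi_pos.ne'
    have hτ' : (τ : ℂ) ≠ 0 := by exact_mod_cast hτ.ne'
    rw [finrank_euclideanSpace_fin]
    congr 1
    · rw [Complex.cpow_neg, ← Complex.inv_cpow]
      · congr 1
        push_cast
        field_simp
      · rw [Complex.arg_ofReal_of_nonneg hτ.le]
        exact pi_pos.ne
    · push_cast
      congr 1
      field_simp
  simp only [smul_eq_mul, h3] at h1
  rw [← integral_const_mul]
  refine Eq.trans ?_ (h1.trans (integral_congr_ae (.of_forall fun x => by ring)))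
  refine integral_congr_ae (.of_forall fun x => ?_)
  have : ((rexp (-(π * ‖x‖ ^ 2 * τ)) : ℝ) : ℂ) = Complex.exp (-((π * τ : ℝ) : ℂ) * ‖x‖ ^ 2) := by
    push_cast
    congr 1
    ring
  simp only [this]
  rfl

end TestFunctions

/-! ### Decay of the fractional Laplacian through the heat semigroup. -/

section Decay

variable {n : ℕ} {γ : ℝ} {η : E n → ℂ}

theorem integrableOn_one_sub_exp (hγ0 : 0 < γ) (hγ1 : γ < 1) :
    IntegrableOn (fun τ : ℝ => (1 - rexp (-τ)) * τ ^ (-1 - γ)) (Ioi 0) := by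
  have hmeas : Measurable fun τ : ℝ => (1 - rexp (-τ)) * τ ^ (-1 - γ) := by measurability
  rw [← Ioc_union_Ioi_eq_Ioi zero_le_one]
  refine IntegrableOn.union ?_ ?_
  · have h1 : IntegrableOn (fun r : ℝ => r ^ (-γ)) (Ioc 0 1) := by
      have := intervalIntegral.intervalIntegrable_rpow' (a := 0) (b := 1) (r := -γ) (by linarith)
      rwa [intervalIntegrable_iff_integrableOn_Ioc_of_le zero_le_one] at this
    refine h1.mono' hmeas.aestronglyMeasurable ((ae_restrict_iff' measurableSet_Ioc).2
      (.of_forall fun r hr => ?_))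
    have hr0 : 0 < r := hr.1
    have h2 : 1 - rexp (-r) ≤ r := by linarith [Real.add_one_le_exp (-r)]
    have h3 : 0 ≤ 1 - rexp (-r) := by
      have := Real.exp_le_one_iff.2 (neg_nonpos.2 hr0.le)
      linarith
    rw [Real.norm_of_nonneg (by positivity)]
    calc (1 - rexp (-r)) * r ^ (-1 - γ) ≤ r * r ^ (-1 - γ) := by gcongr
      _ = r ^ (-γ) := by
        rw [← Real.rpow_one_add' hr0.le (by linarith)]
        congr 1
        ring
  · refine (integrableOn_Ioi_rpow_of_lt (a := -1 - γ) (by linarith) zero_lt_one).mono'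
      hmeas.aestronglyMeasurable ((ae_restrict_iff' measurableSet_Ioi).2 (.of_forall fun r hr => ?_))
    have hr0 : 0 < r := zero_lt_one.trans hr
    have h2 : 1 - rexp (-r) ≤ 1 := by linarith [Real.exp_pos (-r)]
    have h3 : 0 ≤ 1 - rexp (-r) := by
      have := Real.exp_le_one_iff.2 (neg_nonpos.2 hr0.le)
      linarith
    rw [Real.norm_of_nonneg (by positivity)]
    exact mul_le_of_le_one_left (by positivity) h2

/-- The constant in `y^γ = I⁻¹ ∫ (1 - e^{-τy}) τ^{-1-γ} dτ`. -/
def powerConst (γ : ℝ) : ℝ := ∫ τ in Ioi (0 : ℝ), (1 - rexp (-τ)) * τ ^ (-1 - γ)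

theorem powerConst_pos (hγ0 : 0 < γ) (hγ1 : γ < 1) : 0 < powerConst γ := by
  have hpos : ∀ τ ∈ Ioi (0 : ℝ), 0 < (1 - rexp (-τ)) * τ ^ (-1 - γ) := fun τ hτ => by
    have hτ0 : 0 < τ := hτ
    have := Real.exp_lt_one_iff.2 (neg_lt_zero.2 hτ0)
    exact mul_pos (by linarith) (Real.rpow_pos_of_pos hτ0 _)
  rw [powerConst, setIntegral_pos_iff_support_of_nonneg_ae
    ((ae_restrict_iff' measurableSet_Ioi).2 (.of_forall fun τ hτ => (hpos τ hτ).le))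
    (integrableOn_one_sub_exp hγ0 hγ1)]
  have h : Ioi (0 : ℝ) ⊆ Function.support fun τ : ℝ => (1 - rexp (-τ)) * τ ^ (-1 - γ) :=
    fun τ hτ => (hpos τ hτ).ne'
  rw [inter_eq_right.2 h]
  simp

theorem one_sub_exp_scaling (hγ0 : 0 < γ) (hγ1 : γ < 1) {y : ℝ} (hy : 0 ≤ y) :
    IntegrableOn (fun τ : ℝ => (1 - rexp (-(τ * y))) * τ ^ (-1 - γ)) (Ioi 0) ∧
      ∫ τ in Ioi (0 : ℝ), (1 - rexp (-(τ * y))) * τ ^ (-1 - γ) = y ^ γ * powerConst γ := by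
  rcases hy.eq_or_lt with rfl | hy
  · simp [Real.zero_rpow hγ0.ne']
  have h1 : ∀ τ ∈ Ioi (0 : ℝ), (1 - rexp (-(τ * y))) * τ ^ (-1 - γ) =
      y ^ (1 + γ) * ((1 - rexp (-(y * τ))) * (y * τ) ^ (-1 - γ)) := by
    intro τ hτ
    rw [Real.mul_rpow hy.le (le_of_lt hτ), mul_comm τ y]
    have : y ^ (1 + γ) * y ^ (-1 - γ) = 1 := by
      rw [← Real.rpow_add hy]
      simp
    linear_combination (-(1 - rexp (-(y * τ))) * τ ^ (-1 - γ)) * this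
  constructor
  · refine IntegrableOn.congr_fun ?_ (fun τ hτ => (h1 τ hτ).symm) measurableSet_Ioi
    have := (integrableOn_Ioi_comp_mul_left_iff
      (fun τ : ℝ => (1 - rexp (-τ)) * τ ^ (-1 - γ)) 0 hy).2 (by
        simpa using integrableOn_one_sub_exp hγ0 hγ1)
    exact this.const_mul _
  · rw [setIntegral_congr_fun measurableSet_Ioi h1, integral_const_mul,
      integral_comp_mul_left_Ioi (fun τ : ℝ => (1 - rexp (-τ)) * τ ^ (-1 - γ)) 0 hy, mul_zero,
      smul_eq_mul, ← powerConst, Real.rpow_add hy, Real.rpow_one]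
    field_simp

theorem integrableOn_rpow_mul_exp_inv {b : ℝ} (hb : 0 < b) {c : ℝ} (hc : 0 < c) :
    IntegrableOn (fun τ : ℝ => τ ^ (-1 - b) * rexp (-(c / τ))) (Ioi 0) := by
  have := (integrableOn_Ioi_comp_rpow_iff' (fun y : ℝ => y ^ (b - 1) * rexp (-(c * y)))
    (p := -1) (by norm_num)).2 (integrableOn_rpow_mul_exp_neg hb hc)
  refine this.congr_fun (fun τ hτ => ?_) measurableSet_Ioi
  have hτ0 : 0 < τ := hτ
  simp only [smul_eq_mul]
  rw [← Real.rpow_mul hτ0.le, ← mul_assoc, ← Real.rpow_add hτ0, Real.rpow_neg_one, div_eq_mul_inv]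
  congr 2
  ring

theorem exists_rpow_mul_exp_inv {b : ℝ} (hb : 0 < b) {c : ℝ} (hc : 0 < c) :
    ∃ C, 0 ≤ C ∧ ∀ y : ℝ, 0 < y →
      IntegrableOn (fun τ : ℝ => τ ^ (-1 - b) * rexp (-(c * y / τ))) (Ioi 0) ∧
      ∫ τ in Ioi (0 : ℝ), τ ^ (-1 - b) * rexp (-(c * y / τ)) = C * y ^ (-b) := by
  refine ⟨∫ τ in Ioi (0 : ℝ), τ ^ (-1 - b) * rexp (-(c / τ)),
    setIntegral_nonneg measurableSet_Ioi fun τ hτ =>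
      mul_nonneg (Real.rpow_nonneg (le_of_lt hτ) _) (Real.exp_pos _).le,
    fun y hy => ⟨integrableOn_rpow_mul_exp_inv hb (mul_pos hc hy), ?_⟩⟩
  have h1 : ∀ τ ∈ Ioi (0 : ℝ), τ ^ (-1 - b) * rexp (-(c * y / τ)) =
      y ^ (-1 - b) * ((y⁻¹ * τ) ^ (-1 - b) * rexp (-(c / (y⁻¹ * τ)))) := by
    intro τ hτ
    have hτ0 : 0 < τ := hτ
    rw [Real.mul_rpow (inv_pos.2 hy).le hτ0.le, Real.inv_rpow hy.le]
    have h2 : y ^ (-1 - b) ≠ 0 := (Real.rpow_pos_of_pos hy _).ne'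
    have h3 : c / (y⁻¹ * τ) = c * y / τ := by field_simp
    rw [h3]
    field_simp
  rw [setIntegral_congr_fun measurableSet_Ioi h1, integral_const_mul,
    integral_comp_mul_left_Ioi (fun τ : ℝ => τ ^ (-1 - b) * rexp (-(c / τ))) 0 (inv_pos.2 hy),
    mul_zero, inv_inv, smul_eq_mul, show -1 - b = -b - 1 by ring, Real.rpow_sub_one hy.ne']
  field_simp

/-- The heat semigroup applied to `η`. -/
def heat (η : E n → ℂ) (τ : ℝ) (x : E n) : ℂ :=
  ∫ k, ((rexp (-(τ * (2 * π * ‖k‖) ^ 2)) : ℝ) : ℂ) * (Real.fourierChar (inner ℝ k x) • 𝓕 η k)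

theorem heat_eq (hη : Integrable η) {τ : ℝ} (hτ : 0 < τ) (x : E n) :
    heat η τ x = ∫ y, (((4 * π * τ) ^ (-(n / 2 : ℝ)) * rexp (-(‖x - y‖ ^ 2 / (4 * τ))) : ℝ) : ℂ) *
      η y := by
  have hb : 0 < ((4 * π ^ 2 * τ : ℝ) : ℂ).re := by
    rw [Complex.ofReal_re]
    positivity
  have hg : Integrable fun k : E n =>
      Complex.exp (-((4 * π ^ 2 * τ : ℝ) : ℂ) * ‖k‖ ^ 2 + 2 * π * Complex.I * inner ℝ x k) :=
    GaussianFourier.integrable_cexp_neg_mul_sq_norm_add hb (2 * π * Complex.I) x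
  have h1 := VectorFourier.integral_fourierIntegral_smul_eq_flip (L := innerₗ (E n))
    (μ := volume) (ν := volume) Real.continuous_fourierChar (by exact continuous_inner) hη hg
  have h3 : ∀ y : E n, VectorFourier.fourierIntegral Real.fourierChar volume (innerₗ (E n)).flip
      (fun k : E n => Complex.exp (-((4 * π ^ 2 * τ : ℝ) : ℂ) * ‖k‖ ^ 2 +
        2 * π * Complex.I * inner ℝ x k)) y =
      (((4 * π * τ) ^ (-(n / 2 : ℝ)) * rexp (-(‖x - y‖ ^ 2 / (4 * τ))) : ℝ) : ℂ) := by
    intro y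
    rw [flip_innerₗ]
    refine (fourier_gaussian_innerProductSpace' (V := E n) hb x y).trans ?_
    rw [finrank_euclideanSpace_fin, Complex.ofReal_mul ((4 * π * τ) ^ (-(n / 2 : ℝ)))]
    congr 1
    · rw [Real.rpow_neg (by positivity), ← Real.inv_rpow (by positivity),
        Complex.ofReal_cpow (by positivity)]
      congr 1
      · push_cast
        have hπ : (π : ℂ) ≠ 0 := by exact_mod_cast pi_pos.ne'
        field_simp
      · push_cast
        rfl
    · push_cast
      congr 1
      have hπ : (π : ℂ) ≠ 0 := by exact_mod_cast pi_pos.ne'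
      field_simp
  simp only [smul_eq_mul, h3] at h1
  refine Eq.trans ?_ (h1.trans (integral_congr_ae (.of_forall fun x => mul_comm _ _)))
  refine integral_congr_ae (.of_forall fun k => ?_)
  have h4 : ((rexp (-(τ * (2 * π * ‖k‖) ^ 2)) : ℝ) : ℂ) * (Real.fourierChar (inner ℝ k x) : ℂ) =
      Complex.exp (-((4 * π ^ 2 * τ : ℝ) : ℂ) * ‖k‖ ^ 2 + 2 * π * Complex.I * inner ℝ x k) := by
    rw [Real.fourierChar_apply, Complex.exp_add]
    push_cast
    rw [real_inner_comm]
    congr 2 <;> ring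
  simp only [Circle.smul_def, smul_eq_mul, ← mul_assoc, h4]
  rw [mul_comm]
  rfl

/-- For `y` in the support `|x - y| ≥ |x|/2`, so the Gaussian exponent `|x - y|²/(4τ)` is at least
`|x|²/(16τ)`. -/
theorem norm_heat_le (hη : Integrable η) {R : ℝ} (hR : ∀ y, η y ≠ 0 → ‖y‖ ≤ R) {x : E n}
    (hx : 2 * R ≤ ‖x‖) {τ : ℝ} (hτ : 0 < τ) :
    ‖heat η τ x‖ ≤ (4 * π * τ) ^ (-(n / 2 : ℝ)) * rexp (-(16⁻¹ * ‖x‖ ^ 2 / τ)) * ∫ y, ‖η y‖ := by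
  rw [heat_eq hη hτ, ← integral_const_mul]
  refine norm_integral_le_of_norm_le (hη.norm.const_mul _) (.of_forall fun y => ?_)
  rw [norm_mul, Complex.norm_real, Real.norm_of_nonneg (by positivity)]
  by_cases hy : η y = 0
  · simp [hy]
  have h1 := hR y hy
  have h2 : ‖x‖ / 2 ≤ ‖x - y‖ := by linarith [norm_sub_norm_le x y]
  have h3 : (‖x‖ / 2) ^ 2 ≤ ‖x - y‖ ^ 2 := by gcongr
  have h4 : 16⁻¹ * ‖x‖ ^ 2 / τ ≤ ‖x - y‖ ^ 2 / (4 * τ) := by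
    calc 16⁻¹ * ‖x‖ ^ 2 / τ = (‖x‖ / 2) ^ 2 / (4 * τ) := by field_simp; ring
      _ ≤ _ := by gcongr
  have h5 := Real.exp_le_exp.2 (neg_le_neg h4)
  gcongr

/-- Write `|ξ|^{2γ}` as the integral of `(1 - e^{-τ|ξ|²}) τ^{-1-γ}` and interchange it with the
inverse Fourier transform. The `1` contributes `η x`, which vanishes outside the support, so only
the heat flow remains. -/
theorem powerConst_mul_fracLaplacian [Nontrivial (E n)] (hγ0 : 0 < γ) (hγ1 : γ < 1)
    (hη : ContDiff ℝ ∞ η) (hc : HasCompactSupport η) {x : E n} (hx : η x = 0) :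
    (powerConst γ : ℂ) * fracLaplacian γ η x =
      ∫ τ in Ioi (0 : ℝ), ((τ ^ (-1 - γ) : ℝ) : ℂ) * -heat η τ x := by
  let K : ℝ → E n → ℂ := fun τ k => (((1 - rexp (-(τ * (2 * π * ‖k‖) ^ 2))) * τ ^ (-1 - γ) : ℝ) : ℂ) *
    (Real.fourierChar (inner ℝ k x) • 𝓕 η k)
  have hχ : ∀ k : E n, ‖Real.fourierChar (inner ℝ k x) • 𝓕 η k‖ = ‖𝓕 η k‖ := fun k =>
    Circle.norm_smul _ _
  have hone : ∀ (τ : ℝ) (k : E n), 0 < τ → 0 ≤ 1 - rexp (-(τ * (2 * π * ‖k‖) ^ 2)) := by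
    intro τ k hτ
    have := Real.exp_le_one_iff.2 (neg_nonpos.2 (by positivity : 0 ≤ τ * (2 * π * ‖k‖) ^ 2))
    linarith
  have hpow : ∀ k : E n, ((2 * π * ‖k‖) ^ 2) ^ γ = (2 * π * ‖k‖) ^ (2 * γ) := fun k => by
    rw [← Real.rpow_natCast, ← Real.rpow_mul (by positivity)]
    norm_num
  have hcontχ : Continuous fun k : E n => Real.fourierChar (inner ℝ k x) • 𝓕 η k :=
    (Real.continuous_fourierChar.comp (by fun_prop)).smul (fourier_continuous hη hc)
  have hintχ : Integrable fun k : E n => Real.fourierChar (inner ℝ k x) • 𝓕 η k := by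
    rw [← integrable_norm_iff hcontχ.aestronglyMeasurable]
    simp only [hχ]
    exact (fourier_integrable hη hc).norm
  have hKmeas : AEStronglyMeasurable (Function.uncurry K)
      ((volume.restrict (Ioi 0)).prod (volume : Measure (E n))) := by
    have h1 : Measurable fun p : ℝ × E n => p.1 ^ (-1 - γ) := measurable_fst.pow_const _
    have h2 : Continuous fun p : ℝ × E n => 1 - rexp (-(p.1 * (2 * π * ‖p.2‖) ^ 2)) := by fun_prop
    exact (Complex.measurable_ofReal.comp (h2.measurable.mul h1)).aestronglyMeasurable.mul
      (hcontχ.comp continuous_snd).aestronglyMeasurable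
  have hKnorm : ∀ τ : ℝ, 0 < τ → ∀ k, ‖K τ k‖ =
      (1 - rexp (-(τ * (2 * π * ‖k‖) ^ 2))) * τ ^ (-1 - γ) * ‖𝓕 η k‖ := by
    intro τ hτ k
    simp only [K]
    rw [norm_mul, hχ, Complex.norm_real, Real.norm_of_nonneg (mul_nonneg (hone τ k hτ)
      (Real.rpow_nonneg hτ.le _))]
  have hKint : Integrable (Function.uncurry K)
      ((volume.restrict (Ioi 0)).prod (volume : Measure (E n))) := by
    rw [integrable_prod_iff' hKmeas]
    refine ⟨.of_forall fun k => ?_, ?_⟩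
    · simp only [Function.uncurry, K]
      exact (Integrable.ofReal (𝕜 := ℂ)
        (one_sub_exp_scaling hγ0 hγ1 (sq_nonneg (2 * π * ‖k‖))).1).mul_const _
    · refine ((integrable_fracSymbolMul hγ0 hη hc).norm.const_mul (powerConst γ)).congr
        (.of_forall fun k => ?_)
      have h1 : ∫ τ in Ioi (0 : ℝ), ‖K τ k‖ = ∫ τ in Ioi (0 : ℝ),
          (1 - rexp (-(τ * (2 * π * ‖k‖) ^ 2))) * τ ^ (-1 - γ) * ‖𝓕 η k‖ :=
        setIntegral_congr_fun measurableSet_Ioi fun τ hτ => hKnorm τ hτ k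
      simp only [Function.uncurry]
      rw [h1, integral_mul_const, (one_sub_exp_scaling hγ0 hγ1 (sq_nonneg _)).2, hpow,
        fracSymbolMul, norm_mul, Complex.norm_real, Real.norm_of_nonneg (by positivity)]
      ring
  have hswap := integral_integral_swap (f := K) hKint
  have hL : ∫ k, ∫ τ in Ioi (0 : ℝ), K τ k = (powerConst γ : ℂ) * fracLaplacian γ η x := by
    rw [fracLaplacian_eq, Real.fourierInv_eq, ← integral_const_mul]
    refine integral_congr_ae (.of_forall fun k => ?_)
    simp only [K]
    rw [integral_mul_const, integral_complex_ofReal, (one_sub_exp_scaling hγ0 hγ1 (sq_nonneg _)).2, hpow]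
    simp only [fracSymbolMul, Circle.smul_def, smul_eq_mul]
    push_cast
    ring
  rw [← hL, ← hswap]
  refine setIntegral_congr_fun measurableSet_Ioi fun τ hτ => ?_
  have hτ0 : 0 < τ := hτ
  have hinv : ∫ k, Real.fourierChar (inner ℝ k x) • 𝓕 η k = 0 := by
    rw [← Real.fourierInv_eq, hη.continuous.fourierInv_fourier_eq
      (hη.continuous.integrable_of_hasCompactSupport hc) (fourier_integrable hη hc), hx]
  have hK' : ∀ k, K τ k = ((τ ^ (-1 - γ) : ℝ) : ℂ) * (Real.fourierChar (inner ℝ k x) • 𝓕 η k) -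
      ((τ ^ (-1 - γ) : ℝ) : ℂ) * (((rexp (-(τ * (2 * π * ‖k‖) ^ 2)) : ℝ) : ℂ) *
        (Real.fourierChar (inner ℝ k x) • 𝓕 η k)) := by
    intro k
    simp only [K]
    push_cast
    ring
  have hint2 : Integrable fun k : E n => ((rexp (-(τ * (2 * π * ‖k‖) ^ 2)) : ℝ) : ℂ) *
      (Real.fourierChar (inner ℝ k x) • 𝓕 η k) := by
    refine hintχ.bdd_mul (c := 1) ?_ (.of_forall fun k => ?_)
    · exact Continuous.aestronglyMeasurable (by fun_prop)
    · rw [Complex.norm_real, Real.norm_of_nonneg (Real.exp_pos _).le]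
      linarith [hone τ k hτ0]
  simp only [hK']
  rw [integral_sub (hintχ.const_mul _) (hint2.const_mul _), integral_const_mul, integral_const_mul,
    hinv, heat]
  ring

/-- `(-Δ)^γ η` decays like `|x|^{-n-2γ}`. -/
theorem fracLaplacian_decay [Nontrivial (E n)] (hγ0 : 0 < γ) (hγ1 : γ < 1) (hη : ContDiff ℝ ∞ η)
    (hc : HasCompactSupport η) :
    ∃ C, 0 ≤ C ∧ ∀ x : E n, x ≠ 0 → ‖fracLaplacian γ η x‖ ≤ C * ‖x‖ ^ (-((n : ℝ) + 2 * γ)) := by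
  obtain ⟨R, hR0, hR⟩ : ∃ R, 0 < R ∧ ∀ y, η y ≠ 0 → ‖y‖ ≤ R := by
    obtain ⟨R, hR⟩ := hc.isCompact.isBounded.subset_closedBall (0 : E n)
    refine ⟨max R 1, by positivity, fun y hy => ?_⟩
    have := hR (subset_tsupport η hy)
    rw [mem_closedBall_zero_iff] at this
    exact this.trans (le_max_left _ _)
  have hI := powerConst_pos hγ0 hγ1
  have hηi : Integrable η := hη.continuous.integrable_of_hasCompactSupport hc
  have hn0 : (0 : ℝ) ≤ n := Nat.cast_nonneg n
  obtain ⟨C₁, hC₁, h₁⟩ := exists_rpow_mul_exp_inv (b := γ + n / 2) (by positivity) (c := 16⁻¹)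
    (by norm_num)
  set C₂ := ∫ k, ‖fracSymbolMul γ η k‖ with hC₂
  have hC₂0 : 0 ≤ C₂ := integral_nonneg fun k => norm_nonneg _
  have hC₃0 : 0 ≤ ∫ y, ‖η y‖ := integral_nonneg fun k => norm_nonneg _
  set D := (4 * π) ^ (-(n / 2 : ℝ)) * (∫ y, ‖η y‖) with hD
  have hD0 : 0 ≤ D := by positivity
  refine ⟨(powerConst γ)⁻¹ * (D * C₁) + C₂ * (2 * R + 1) ^ ((n : ℝ) + 2 * γ), by positivity,
    fun x hx => ?_⟩
  have hx0 : 0 < ‖x‖ := norm_pos_iff.2 hx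
  have hp : 0 ≤ ‖x‖ ^ (-((n : ℝ) + 2 * γ)) := by positivity
  -- Far away the heat bound integrates to a multiple of `(|x|²)^{-(γ + n/2)}`. Near the support
  -- boundedness suffices, because the power of `|x|` is bounded below there.
  rcases le_or_gt (2 * R + 1) ‖x‖ with hxR | hxR
  · have hηx : η x = 0 := by
      by_contra h
      linarith [hR x h]
    have h2 := powerConst_mul_fracLaplacian hγ0 hγ1 hη hc hηx
    obtain ⟨h3, h4⟩ := h₁ (‖x‖ ^ 2) (by positivity)
    have h5 : ‖∫ τ in Ioi (0 : ℝ), ((τ ^ (-1 - γ) : ℝ) : ℂ) * -heat η τ x‖ ≤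
        ∫ τ in Ioi (0 : ℝ), D * (τ ^ (-1 - (γ + n / 2)) * rexp (-(16⁻¹ * ‖x‖ ^ 2 / τ))) := by
      refine norm_integral_le_of_norm_le (h3.const_mul D)
        ((ae_restrict_iff' measurableSet_Ioi).2 (.of_forall fun τ hτ => ?_))
      have hτ0 : 0 < τ := hτ
      have h6 := norm_heat_le hηi hR (x := x) (by linarith) hτ0
      rw [norm_mul, norm_neg, Complex.norm_real, Real.norm_of_nonneg (by positivity)]
      refine (mul_le_mul_of_nonneg_left h6 (by positivity)).trans (le_of_eq ?_)
      rw [Real.mul_rpow (by positivity) hτ0.le, show -1 - (γ + n / 2) = (-1 - γ) + -(n / 2 : ℝ) by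
        ring, Real.rpow_add hτ0, hD]
      ring
    rw [← h2, norm_mul, Complex.norm_real, Real.norm_of_nonneg hI.le, integral_const_mul, h4] at h5
    have h7 : (‖x‖ ^ 2) ^ (-(γ + n / 2 : ℝ)) = ‖x‖ ^ (-((n : ℝ) + 2 * γ)) := by
      rw [← Real.rpow_natCast, ← Real.rpow_mul hx0.le]
      congr 1
      push_cast
      ring
    rw [h7] at h5
    have h8 : ‖fracLaplacian γ η x‖ ≤
        (powerConst γ)⁻¹ * (D * C₁) * ‖x‖ ^ (-((n : ℝ) + 2 * γ)) := by
      rw [mul_assoc, ← div_eq_inv_mul, le_div_iff₀ hI]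
      linarith
    have h9 : 0 ≤ C₂ * (2 * R + 1) ^ ((n : ℝ) + 2 * γ) * ‖x‖ ^ (-((n : ℝ) + 2 * γ)) := by positivity
    rw [add_mul]
    linarith
  · have h2 : ‖fracLaplacian γ η x‖ ≤ C₂ := fracLaplacian_norm_le x
    have h3 : 1 ≤ (2 * R + 1) ^ ((n : ℝ) + 2 * γ) * ‖x‖ ^ (-((n : ℝ) + 2 * γ)) := by
      rw [Real.rpow_neg hx0.le, ← div_eq_mul_inv, one_le_div (by positivity)]
      gcongr
    have h9 : 0 ≤ (powerConst γ)⁻¹ * (D * C₁) * ‖x‖ ^ (-((n : ℝ) + 2 * γ)) := by positivity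
    rw [add_mul, mul_assoc C₂]
    nlinarith

end Decay

/-! ### The symbol `Θ₀` as a Mellin multiplier. -/

section Mellin

variable {n : ℕ} {γ : ℝ} {η : E n → ℂ}

/-- Joins decay at infinity and boundedness at the origin; the power of `2` comes from `(1 + |x|)/2
≤ max 1 |x|`. -/
theorem fracLaplacian_norm_le_one_add [Nontrivial (E n)] (hγ0 : 0 < γ) (hγ1 : γ < 1)
    (hη : ContDiff ℝ ∞ η) (hc : HasCompactSupport η) :
    ∃ C, 0 ≤ C ∧ ∀ x : E n, ‖fracLaplacian γ η x‖ ≤ C * (1 + ‖x‖) ^ (-((n : ℝ) + 2 * γ)) := by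
  obtain ⟨C, hC0, hC⟩ := fracLaplacian_decay hγ0 hγ1 hη hc
  set D := ∫ k, ‖fracSymbolMul γ η k‖
  have hD0 : 0 ≤ D := integral_nonneg fun k => norm_nonneg _
  have hn0 : (0 : ℝ) ≤ n := Nat.cast_nonneg n
  refine ⟨(C + D) * 2 ^ ((n : ℝ) + 2 * γ), by positivity, fun x => ?_⟩
  have h2 : ∀ y : ℝ, 0 < y → 2 ^ ((n : ℝ) + 2 * γ) * y ^ (-((n : ℝ) + 2 * γ)) =
      (y / 2) ^ (-((n : ℝ) + 2 * γ)) := by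
    intro y hy
    rw [Real.div_rpow hy.le (by norm_num), Real.rpow_neg (by norm_num : (0 : ℝ) ≤ 2)]
    field_simp
  rw [mul_assoc, h2 _ (by positivity)]
  have hpos : 0 ≤ ((1 + ‖x‖) / 2) ^ (-((n : ℝ) + 2 * γ)) := by positivity
  rcases le_or_gt ‖x‖ 1 with hx | hx
  · have h3 : ‖fracLaplacian γ η x‖ ≤ D := fracLaplacian_norm_le x
    have h4 : 1 ≤ ((1 + ‖x‖) / 2) ^ (-((n : ℝ) + 2 * γ)) :=
      Real.one_le_rpow_of_pos_of_le_one_of_nonpos (by positivity) (by linarith) (by linarith)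
    nlinarith
  · have hx0 : 0 < ‖x‖ := by linarith
    have h4 : ‖x‖ ^ (-((n : ℝ) + 2 * γ)) ≤ ((1 + ‖x‖) / 2) ^ (-((n : ℝ) + 2 * γ)) :=
      Real.rpow_le_rpow_of_nonpos (by positivity) (by linarith) (by linarith)
    have h5 := hC x (norm_pos_iff.1 hx0)
    nlinarith

theorem integrable_fracLaplacian_mul_rpow [Nontrivial (E n)] (hγ0 : 0 < γ) (hγ1 : γ < 1)
    (hη : ContDiff ℝ ∞ η) (hc : HasCompactSupport η) {a : ℝ} (ha0 : 0 ≤ a) (ha : a < n) :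
    Integrable fun x => ‖fracLaplacian γ η x‖ * ‖x‖ ^ (-a) := by
  obtain ⟨C, -, hC⟩ := fracLaplacian_norm_le_one_add hγ0 hγ1 hη hc
  have hn0 : (0 : ℝ) ≤ n := Nat.cast_nonneg n
  refine ((integrable_norm_rpow_mul_one_add (a := a) (M := n + 2 * γ) ha (by linarith)
    (by positivity)).const_mul C).mono' ?_ (.of_forall fun x => ?_)
  · exact (fracLaplacian_continuous hγ0 hη hc).norm.aestronglyMeasurable.mul
      (measurable_norm.pow_const _).aestronglyMeasurable
  · rw [Real.norm_of_nonneg (by positivity)]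
    calc ‖fracLaplacian γ η x‖ * ‖x‖ ^ (-a) ≤
        C * (1 + ‖x‖) ^ (-((n : ℝ) + 2 * γ)) * ‖x‖ ^ (-a) := by
          gcongr
          exact hC x
      _ = _ := by ring

theorem IsPuncturedTestFunction.integrable_mul_rpow (h : IsPuncturedTestFunction η) (b : ℝ) :
    Integrable fun x => ‖η x‖ * ‖x‖ ^ b := by
  refine Continuous.integrable_of_hasCompactSupport (continuous_iff_continuousAt.2 fun x => ?_)
    h.compact.norm.mul_right
  by_cases hx : x = 0
  · subst hx
    have h1 : (fun x : E n => ‖η x‖ * ‖x‖ ^ b) =ᶠ[𝓝 0] fun _ => 0 := by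
      filter_upwards [notMem_tsupport_iff_eventuallyEq.1 h.away] with x hx
      simp [hx]
    exact continuousAt_const.congr h1.symm
  · exact h.smooth.continuous.norm.continuousAt.mul
      (continuous_norm.continuousAt.rpow_const (Or.inl (norm_ne_zero_iff.2 hx)))

theorem ae_norm_pos [Nontrivial (E n)] : ∀ᵐ x : E n, 0 < ‖x‖ := by
  simp only [norm_pos_iff]
  rw [ae_iff]
  simp

/-- The fractional Laplacian acts on the Mellin side as multiplication by the symbol. -/
theorem integral_fracLaplacian_mul_cpow [Nontrivial (E n)] (hγ0 : 0 < γ) (hγ1 : γ < 1)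
    (hn : 2 * γ < n) (h : IsPuncturedTestFunction η) (ξ : ℝ) :
    ∫ x, fracLaplacian γ η x * (‖x‖ : ℂ) ^ (-((n : ℂ) / 2 - γ + ξ * Complex.I)) =
      symbol n γ ξ * ∫ x, η x * (‖x‖ : ℂ) ^ (-((n : ℂ) / 2 + γ + ξ * Complex.I)) := by
  set s : ℂ := (n : ℂ) / 2 - γ + ξ * Complex.I with hs
  set s' : ℂ := (n : ℂ) / 2 - γ - ξ * Complex.I with hs'
  have hsre : s.re = n / 2 - γ := by simp [hs]
  have hsre' : s'.re = n / 2 - γ := by simp [hs']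
  have hF := continuous_fracSymbolMul hγ0 h.smooth h.compact
  have hFi := integrable_fracSymbolMul hγ0 h.smooth h.compact
  -- Two passages between `x` and frequency: `h1` takes `(-Δ)^γ η` at exponent `-s` to its Fourier
  -- side at `s - n`. The factor `|k|^{2γ}` changes this exponent to `-s'`, and `h2` returns from `𝓕
  -- η` to `η`. The four Gamma factors collected on the way form `Θ₀ (ξ)`.
  have h1 := pairing_norm_cpow (s := s) (f := fracLaplacian γ η) (g := fracSymbolMul γ η)
    (by rw [hsre]; linarith) (by rw [hsre]; linarith)
    (fracLaplacian_continuous hγ0 h.smooth h.compact).aestronglyMeasurable hF.aestronglyMeasurable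
    (by
      rw [hsre]
      exact integrable_fracLaplacian_mul_rpow hγ0 hγ1 h.smooth h.compact (by linarith)
        (by linarith))
    (integrable_fracSymbolMul_mul_rpow h.smooth h.compact (by rw [hsre]; linarith))
    (fun τ hτ => by
      rw [← fourier_gaussian_pairing hFi hτ, ← integral_neg_eq_self]
      refine integral_congr_ae (.of_forall fun x => ?_)
      simp only [norm_neg]
      rw [fracLaplacian_eq, Real.fourierInv_eq_fourier_neg, neg_neg])
  have h2 := pairing_norm_cpow (s := s') (f := 𝓕 η) (g := η)
    (by rw [hsre']; linarith) (by rw [hsre']; linarith)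
    (fourier_continuous h.smooth h.compact).aestronglyMeasurable
    h.smooth.continuous.aestronglyMeasurable
    (integrable_fourier_mul_rpow h.smooth h.compact (by rw [hsre']; linarith))
    (h.integrable_mul_rpow _)
    (fun τ hτ => fourier_gaussian_pairing
      (h.smooth.continuous.integrable_of_hasCompactSupport h.compact) hτ)
  have h3 : ∫ k, fracSymbolMul γ η k * (‖k‖ : ℂ) ^ (s - n) =
      (((2 * π) ^ (2 * γ) : ℝ) : ℂ) * ∫ k, 𝓕 η k * (‖k‖ : ℂ) ^ (-s') := by
    rw [← integral_const_mul]
    refine integral_congr_ae ?_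
    filter_upwards [ae_norm_pos] with k hk
    have hk' : (‖k‖ : ℂ) ≠ 0 := by exact_mod_cast hk.ne'
    have h4 : -s' = ((2 * γ : ℝ) : ℂ) + (s - n) := by
      rw [hs, hs']
      push_cast
      ring
    rw [h4, Complex.cpow_add _ _ hk', ← Complex.ofReal_cpow hk.le, fracSymbolMul,
      Real.mul_rpow (by positivity) hk.le]
    push_cast
    ring
  rw [h3] at h1
  rw [show s' - (n : ℂ) = -((n : ℂ) / 2 + γ + ξ * Complex.I) by rw [hs']; ring] at h2
  set I₁ := ∫ x, fracLaplacian γ η x * (‖x‖ : ℂ) ^ (-s)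
  set I₂ := ∫ k, 𝓕 η k * (‖k‖ : ℂ) ^ (-s')
  set I₃ := ∫ x, η x * (‖x‖ : ℂ) ^ (-((n : ℂ) / 2 + γ + ξ * Complex.I))
  have hπ : (π : ℂ) ≠ 0 := by exact_mod_cast pi_pos.ne'
  have hG1 : Complex.Gamma (s / 2) ≠ 0 := Complex.Gamma_ne_zero_of_re_pos (by
    rw [Complex.div_ofNat_re, hsre]
    linarith)
  have hG2 : Complex.Gamma (s' / 2) ≠ 0 := Complex.Gamma_ne_zero_of_re_pos (by
    rw [Complex.div_ofNat_re, hsre']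
    linarith)
  have hsym : symbol n γ ξ = ((2 ^ (2 * γ) : ℝ) : ℂ) *
      (Complex.Gamma ((n - s') / 2) * Complex.Gamma ((n - s) / 2)) /
        (Complex.Gamma (s / 2) * Complex.Gamma (s' / 2)) := by
    rw [symbol, hs, hs']
    congr 5 <;> ring
  have hpow : (((2 * π) ^ (2 * γ) : ℝ) : ℂ) * (π : ℂ) ^ (-(n - s) / 2) * (π : ℂ) ^ (-(n - s') / 2) =
      ((2 ^ (2 * γ) : ℝ) : ℂ) * ((π : ℂ) ^ (-s / 2) * (π : ℂ) ^ (-s' / 2)) := by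
    rw [Real.mul_rpow (by norm_num) pi_pos.le, Complex.ofReal_mul,
      Complex.ofReal_cpow pi_pos.le (2 * γ), mul_assoc, mul_assoc, ← Complex.cpow_add _ _ hπ,
      ← Complex.cpow_add _ _ hπ, ← Complex.cpow_add _ _ hπ]
    congr 2
    rw [hs, hs']
    push_cast
    ring
  have hne : (π : ℂ) ^ (-s / 2) * (π : ℂ) ^ (-s' / 2) ≠ 0 := by
    rw [← Complex.cpow_add _ _ hπ]
    exact (Complex.cpow_ne_zero_iff_of_exponent_ne_zero (by
      intro h0
      have := congrArg Complex.re h0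
      simp [Complex.div_ofNat_re, hsre, hsre'] at this
      linarith)).2 hπ
  have hmul : (π : ℂ) ^ (-s / 2) * (π : ℂ) ^ (-s' / 2) *
      (Complex.Gamma (s / 2) * Complex.Gamma (s' / 2) * I₁) =
      (π : ℂ) ^ (-s / 2) * (π : ℂ) ^ (-s' / 2) * (((2 ^ (2 * γ) : ℝ) : ℂ) *
        (Complex.Gamma ((n - s') / 2) * Complex.Gamma ((n - s) / 2)) * I₃) := by
    linear_combination ((π : ℂ) ^ (-s' / 2) * Complex.Gamma (s' / 2)) * h1 +
      (((2 * π) ^ (2 * γ) : ℝ) : ℂ) * ((π : ℂ) ^ (-(n - s) / 2) * Complex.Gamma ((n - s) / 2)) * h2 +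
      Complex.Gamma ((n - s) / 2) * Complex.Gamma ((n - s') / 2) * I₃ * hpow
  have hfin := mul_left_cancel₀ hne hmul
  rw [hsym, div_mul_eq_mul_div, eq_div_iff (mul_ne_zero hG1 hG2), ← hfin]
  ring

end Mellin

/-! ### Passage to the cylinder variable `t = -log r`. -/

section Cylinder

variable {n : ℕ} {γ : ℝ}

theorem integral_norm_eq_integral_exp [Nontrivial (E n)] (f : ℝ → ℂ) :
    ∫ x : E n, f ‖x‖ = ((n * (volume : Measure (E n)).real (Metric.ball 0 1) : ℝ) : ℂ) *
      ∫ t : ℝ, ((rexp (-(n * t)) : ℝ) : ℂ) * f (rexp (-t)) := by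
  have hn : 1 ≤ n := by
    rcases Nat.eq_zero_or_pos n with rfl | h
    · exact absurd (inferInstance : Subsingleton (E 0)) (not_subsingleton (E 0))
    · exact h
  have himg : (fun t : ℝ => rexp (-t)) '' univ = Ioi 0 := by
    ext y
    simp only [image_univ, mem_range, mem_Ioi]
    refine ⟨fun ⟨t, ht⟩ => ht ▸ Real.exp_pos _, fun hy => ⟨-Real.log y, ?_⟩⟩
    rw [neg_neg, Real.exp_log hy]
  have hsub : ∫ y in Ioi (0 : ℝ), y ^ (n - 1) • f y =
      ∫ t : ℝ, ((rexp (-(n * t)) : ℝ) : ℂ) * f (rexp (-t)) := by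
    rw [← himg, integral_image_eq_integral_abs_deriv_smul (f' := fun t => -rexp (-t))
      MeasurableSet.univ (fun t _ => by
        simpa using (hasDerivAt_neg t).exp)
      (fun a _ b _ hab => by simpa using hab), setIntegral_univ]
    refine integral_congr_ae (.of_forall fun t => ?_)
    simp only [abs_neg, Real.abs_exp, ← Real.exp_nat_mul, smul_smul, ← Real.exp_add]
    rw [Complex.real_smul]
    congr 4
    rw [Nat.cast_sub hn]
    push_cast
    ring
  rw [integral_fun_norm_addHaar volume f, finrank_euclideanSpace_fin, hsub]
  simp only [nsmul_eq_mul, Complex.real_smul]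
  push_cast
  ring

/-- The function `‖x‖^{-(n-2γ)/2} ψ(-log ‖x‖)`. -/
def toPunctured (n : ℕ) (γ : ℝ) (ψ : ℝ → ℂ) (x : E n) : ℂ :=
  ((‖x‖ ^ (-(((n : ℝ) - 2 * γ) / 2)) : ℝ) : ℂ) * ψ (-Real.log ‖x‖)

variable {ψ : ℝ → ℂ}

theorem toPunctured_eq_zero (hn : 2 * γ < n) {R : ℝ} (hR : ∀ t, ψ t ≠ 0 → |t| ≤ R) {x : E n}
    (hx : ‖x‖ < rexp (-R) ∨ rexp R < ‖x‖) : toPunctured n γ ψ x = 0 := by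
  rcases (norm_nonneg x).eq_or_lt with h0 | h0
  · rw [toPunctured, ← h0, Real.zero_rpow (by linarith)]
    simp
  · by_contra h
    have h1 := hR _ (right_ne_zero_of_mul h)
    rw [abs_neg, abs_le] at h1
    rcases hx with hx | hx
    · have := (Real.log_lt_iff_lt_exp h0).2 hx
      linarith
    · have := (Real.lt_log_iff_exp_lt h0).2 hx
      linarith

theorem isPuncturedTestFunction_toPunctured (hn : 2 * γ < n) (hψ : ContDiff ℝ ∞ ψ)
    (hc : HasCompactSupport ψ) : IsPuncturedTestFunction (toPunctured n γ ψ) := by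
  obtain ⟨R, hR⟩ : ∃ R, ∀ t, ψ t ≠ 0 → |t| ≤ R := by
    obtain ⟨R, hR⟩ := hc.isCompact.isBounded.subset_closedBall (0 : ℝ)
    refine ⟨R, fun t ht => ?_⟩
    simpa using hR (subset_tsupport ψ ht)
  have hev : ∀ x : E n, ‖x‖ < rexp (-R) → toPunctured n γ ψ =ᶠ[𝓝 x] 0 := fun x hx => by
    filter_upwards [(isOpen_lt continuous_norm continuous_const).mem_nhds hx] with y hy
    exact toPunctured_eq_zero hn hR (Or.inl hy)
  refine ⟨contDiff_iff_contDiffAt.2 fun x => ?_, ?_, ?_⟩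
  · by_cases hx : x = 0
    · subst hx
      exact contDiffAt_const.congr_of_eventuallyEq (hev 0 (by simpa using Real.exp_pos _))
    · have h1 : ContDiffAt ℝ ∞ (fun x : E n => ‖x‖) x := contDiffAt_norm ℝ hx
      have hx' : ‖x‖ ≠ 0 := norm_ne_zero_iff.2 hx
      exact (Complex.ofRealCLM.contDiff.contDiffAt.comp x (h1.rpow_const_of_ne hx')).mul
        (hψ.contDiffAt.comp x (h1.log hx').neg)
  · refine HasCompactSupport.intro (isCompact_closedBall (0 : E n) (rexp R)) fun x hx => ?_
    rw [mem_closedBall_zero_iff, not_le] at hx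
    exact toPunctured_eq_zero hn hR (Or.inr hx)
  · exact notMem_tsupport_iff_eventuallyEq.2 (hev 0 (by simpa using Real.exp_pos _))

/-- Translation in `t` is dilation in `x`; the exponential prefactor compensates for the power of
`‖x‖`. -/
theorem toPunctured_comp_sub (hn : 2 * γ < n) (s : ℝ) :
    toPunctured n γ (fun t => ψ (t - s)) = fun x =>
      ((rexp (s * (((n : ℝ) - 2 * γ) / 2)) : ℝ) : ℂ) * toPunctured n γ ψ (rexp s • x) := by
  funext x
  rcases (norm_nonneg x).eq_or_lt with h0 | h0
  · have h1 : (0 : ℝ) ^ (-(((n : ℝ) - 2 * γ) / 2)) = 0 := Real.zero_rpow (by linarith)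
    simp [toPunctured, norm_smul, ← h0, h1]
  · simp only [toPunctured, norm_smul, Real.norm_of_nonneg (Real.exp_pos s).le]
    rw [Real.mul_rpow (Real.exp_pos s).le h0.le, Real.log_mul (Real.exp_pos s).ne' h0.ne',
      Real.log_exp, ← Real.exp_mul, ← mul_assoc, ← Complex.ofReal_mul, ← mul_assoc, ← Real.exp_add]
    congr 2
    · rw [mul_neg, add_neg_cancel, Real.exp_zero, one_mul]
    · ring

theorem fracLaplacian_const_mul {η : E n → ℂ} (c : ℂ) :
    fracLaplacian γ (fun x => c * η x) = fun x => c * fracLaplacian γ η x := by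
  have h : fracSymbolMul γ (fun x => c * η x) = fun k => c * fracSymbolMul γ η k := by
    funext k
    simp only [fracSymbolMul, Real.fourier_eq, ← integral_const_mul]
    refine integral_congr_ae (.of_forall fun x => ?_)
    simp only [Circle.smul_def, smul_eq_mul]
    ring
  funext x
  simp only [fracLaplacian_eq, h, Real.fourierInv_eq, ← integral_const_mul]
  refine integral_congr_ae (.of_forall fun x => ?_)
  simp only [Circle.smul_def, smul_eq_mul]
  ring

/-- The reflection that exchanges `x` and `y` preserves `η` and commutes with the fractional
Laplacian. -/
theorem fracLaplacian_radial {η : E n → ℂ} (hη : ∀ x y, ‖x‖ = ‖y‖ → η x = η y) {x y : E n}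
    (hxy : ‖x‖ = ‖y‖) : fracLaplacian γ η x = fracLaplacian γ η y := by
  have h := fracLaplacian_comp_linearIsometry (γ := γ) (η := η) (Submodule.reflection (ℝ ∙ (x - y))ᗮ)
  have h2 : η ∘ (Submodule.reflection (ℝ ∙ (x - y))ᗮ) = η := by
    funext z
    exact hη _ _ (LinearIsometryEquiv.norm_map _ _)
  rw [h2] at h
  have h3 := congrFun h x
  rwa [Function.comp, Submodule.reflection_sub hxy] at h3

theorem toPunctured_radial (x y : E n) (hxy : ‖x‖ = ‖y‖) :
    toPunctured n γ ψ x = toPunctured n γ ψ y := by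
  simp only [toPunctured, hxy]

/-- In the variable `t = -log r`, the function `r^{(n+2γ)/2} (-Δ)^γ (r^{-(n-2γ)/2} ψ)`. -/
def cylinderLaplacian (γ : ℝ) (e : E n) (ψ : ℝ → ℂ) (t : ℝ) : ℂ :=
  ((rexp (-(t * (n / 2 + γ))) : ℝ) : ℂ) * fracLaplacian γ (toPunctured n γ ψ) (rexp (-t) • e)

theorem cylinderLaplacian_continuous [Nontrivial (E n)] (hγ0 : 0 < γ) (hn : 2 * γ < n)
    (hψ : ContDiff ℝ ∞ ψ) (hc : HasCompactSupport ψ) (e : E n) :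
    Continuous (cylinderLaplacian γ e ψ) := by
  have h := isPuncturedTestFunction_toPunctured hn hψ hc
  have h1 := fracLaplacian_continuous hγ0 h.smooth h.compact
  exact (by fun_prop : Continuous fun t : ℝ => ((rexp (-(t * (n / 2 + γ))) : ℝ) : ℂ)).mul
    (h1.comp (by fun_prop))

/-- The same rate arises at both ends: as `r → 0` from boundedness times `r^{n/2+γ}`, as `r → ∞`
from `r^{n/2+γ}` times `r^{-(n+2γ)}`. -/
theorem cylinderLaplacian_norm_le [Nontrivial (E n)] (hγ0 : 0 < γ) (hγ1 : γ < 1) (hn : 2 * γ < n)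
    (hψ : ContDiff ℝ ∞ ψ) (hc : HasCompactSupport ψ) {e : E n} (he : ‖e‖ = 1) :
    ∃ C, 0 ≤ C ∧ ∀ t, ‖cylinderLaplacian γ e ψ t‖ ≤ C * rexp (-((n / 2 + γ) * |t|)) := by
  have h := isPuncturedTestFunction_toPunctured hn hψ hc
  obtain ⟨C, hC0, hC⟩ := fracLaplacian_norm_le_one_add hγ0 hγ1 h.smooth h.compact
  refine ⟨C, hC0, fun t => ?_⟩
  have hn0 : (0 : ℝ) ≤ n := Nat.cast_nonneg n
  have h1 := hC (rexp (-t) • e)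
  rw [norm_smul, he, mul_one, Real.norm_of_nonneg (Real.exp_pos _).le] at h1
  rw [cylinderLaplacian, norm_mul, Complex.norm_real, Real.norm_of_nonneg (Real.exp_pos _).le]
  refine (mul_le_mul_of_nonneg_left h1 (Real.exp_pos _).le).trans ?_
  rw [mul_left_comm]
  refine mul_le_mul_of_nonneg_left ?_ hC0
  have hexp := Real.exp_pos (-t)
  rcases le_total 0 t with ht | ht
  · rw [abs_of_nonneg ht, mul_comm t]
    refine mul_le_of_le_one_right (Real.exp_pos _).le
      (Real.rpow_le_one_of_one_le_of_nonpos (by linarith) (by linarith))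
  · rw [abs_of_nonpos ht]
    calc rexp (-(t * (n / 2 + γ))) * (1 + rexp (-t)) ^ (-((n : ℝ) + 2 * γ))
        ≤ rexp (-(t * (n / 2 + γ))) * rexp (-t) ^ (-((n : ℝ) + 2 * γ)) := by
          refine mul_le_mul_of_nonneg_left ?_ (Real.exp_pos _).le
          exact Real.rpow_le_rpow_of_nonpos hexp (by linarith) (by linarith)
      _ = rexp (-((n / 2 + γ) * -t)) := by
          rw [← Real.exp_mul, ← Real.exp_add]
          congr 1
          ring

theorem fracLaplacian_toPunctured {e : E n} (he : ‖e‖ = 1) (x : E n) :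
    fracLaplacian γ (toPunctured n γ ψ) x = fracLaplacian γ (toPunctured n γ ψ) (‖x‖ • e) :=
  fracLaplacian_radial toPunctured_radial (by rw [norm_smul, he, mul_one, norm_norm])

theorem cylinderLaplacian_comp_sub (hn : 2 * γ < n) (e : E n) (s t : ℝ) :
    cylinderLaplacian γ e (fun t => ψ (t - s)) t = cylinderLaplacian γ e ψ (t - s) := by
  rw [cylinderLaplacian, cylinderLaplacian, toPunctured_comp_sub hn, fracLaplacian_const_mul]
  beta_reduce
  rw [fracLaplacian_comp_smul (Real.exp_pos s), smul_smul, ← Real.exp_add, ← Real.exp_mul,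
    ← mul_assoc, ← mul_assoc, ← Complex.ofReal_mul, ← Complex.ofReal_mul, ← Real.exp_add,
    ← Real.exp_add]
  congr 3
  · ring
  · congr 1
    ring

theorem radialConst_ne_zero [Nontrivial (E n)] :
    ((n * (volume : Measure (E n)).real (Metric.ball 0 1) : ℝ) : ℂ) ≠ 0 := by
  have hn : n ≠ 0 := by
    rintro rfl
    exact not_subsingleton (E 0) inferInstance
  have h : 0 < (volume : Measure (E n)).real (Metric.ball 0 1) :=
    ENNReal.toReal_pos (Metric.measure_ball_pos _ _ one_pos).ne' measure_ball_lt_top.ne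
  exact_mod_cast mul_ne_zero (Nat.cast_ne_zero.2 hn) h.ne'

theorem exp_cpow (a : ℝ) (z : ℂ) : ((rexp a : ℝ) : ℂ) ^ z = Complex.exp (a * z) := by
  rw [Complex.cpow_def_of_ne_zero (by exact_mod_cast (Real.exp_pos a).ne'), Complex.ofReal_exp,
    ← Complex.ofReal_exp, ← Complex.ofReal_log (Real.exp_pos a).le, Real.log_exp]

theorem integral_cylinderLaplacian_mul_exp [Nontrivial (E n)] (hγ0 : 0 < γ) (hγ1 : γ < 1)
    (hn : 2 * γ < n) (hψ : ContDiff ℝ ∞ ψ) (hc : HasCompactSupport ψ) {e : E n} (he : ‖e‖ = 1)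
    (ξ : ℝ) :
    ∫ t : ℝ, cylinderLaplacian γ e ψ t * Complex.exp (ξ * t * Complex.I) =
      symbol n γ ξ * ∫ t : ℝ, ψ t * Complex.exp (ξ * t * Complex.I) := by
  have h := integral_fracLaplacian_mul_cpow hγ0 hγ1 hn
    (isPuncturedTestFunction_toPunctured hn hψ hc) ξ
  have h1 := integral_norm_eq_integral_exp (n := n) fun r =>
    fracLaplacian γ (toPunctured n γ ψ) (r • e) *
      (r : ℂ) ^ (-((n : ℂ) / 2 - γ + ξ * Complex.I))
  simp only [← fracLaplacian_toPunctured he] at h1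
  have h2 := integral_norm_eq_integral_exp (n := n) fun r =>
    ((r ^ (-(((n : ℝ) - 2 * γ) / 2)) : ℝ) : ℂ) * ψ (-Real.log r) *
      (r : ℂ) ^ (-((n : ℂ) / 2 + γ + ξ * Complex.I))
  rw [h1] at h
  simp only [toPunctured] at h
  rw [h2, mul_left_comm] at h
  have h3 := mul_left_cancel₀ radialConst_ne_zero h
  have h4 : ∀ t : ℝ, ((rexp (-(n * t)) : ℝ) : ℂ) * (((rexp (-t) ^ (-(((n : ℝ) - 2 * γ) / 2)) : ℝ) : ℂ) *
      ψ (-Real.log (rexp (-t))) * ((rexp (-t) : ℝ) : ℂ) ^ (-((n : ℂ) / 2 + γ + ξ * Complex.I))) =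
      ψ t * Complex.exp (ξ * t * Complex.I) := by
    intro t
    rw [Real.log_exp, neg_neg, exp_cpow, ← Real.exp_mul, Complex.ofReal_exp, Complex.ofReal_exp]
    have h5 : Complex.exp (ξ * t * Complex.I) = Complex.exp ((-(n * t) : ℝ) : ℂ) *
        Complex.exp ((-t * (-(((n : ℝ) - 2 * γ) / 2)) : ℝ) : ℂ) *
          Complex.exp ((-t : ℝ) * (-((n : ℂ) / 2 + γ + ξ * Complex.I))) := by
      rw [← Complex.exp_add, ← Complex.exp_add]
      congr 1
      push_cast
      ring
    rw [h5]
    ring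
  simp only [h4] at h3
  rw [← h3]
  refine integral_congr_ae (.of_forall fun t => ?_)
  simp only
  rw [exp_cpow, cylinderLaplacian, Complex.ofReal_exp, Complex.ofReal_exp]
  have h5 : Complex.exp ((-(n * t) : ℝ) : ℂ) *
      Complex.exp ((-t : ℝ) * (-((n : ℂ) / 2 - γ + ξ * Complex.I))) =
      Complex.exp ((-(t * (n / 2 + γ)) : ℝ) : ℂ) * Complex.exp (ξ * t * Complex.I) := by
    rw [← Complex.exp_add, ← Complex.exp_add]
    congr 1
    push_cast
    ring
  have h6 : ∀ a b c d x : ℂ, a * b = c * d → c * x * d = a * (x * b) := fun a b c d x hab => by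
    linear_combination -x * hab
  exact h6 _ _ _ _ _ h5

/-- The equation `𝓛_* w = 0` in its weak form on the line. -/
theorem SolvesLStar.weak_cylinder [Nontrivial (E n)] {p : ℝ} {u w : ℝ → ℝ} (hn : 2 * γ < n)
    (hw : SolvesLStar n γ p u w) (hψ : ContDiff ℝ ∞ ψ) (hc : HasCompactSupport ψ) {e : E n}
    (he : ‖e‖ = 1) :
    ∫ t : ℝ, (w t : ℂ) * cylinderLaplacian γ e ψ t =
      ∫ t : ℝ, ((potential n γ p u t * w t : ℝ) : ℂ) * ψ t := by
  have h := hw.weak _ (isPuncturedTestFunction_toPunctured hn hψ hc)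
  have h1 := integral_norm_eq_integral_exp (n := n) fun r =>
    ((r ^ (-(((n : ℝ) - 2 * γ) / 2)) * w (-Real.log r) : ℝ) : ℂ) *
      fracLaplacian γ (toPunctured n γ ψ) (r • e)
  simp only [← fracLaplacian_toPunctured he] at h1
  have h2 := integral_norm_eq_integral_exp (n := n) fun r =>
    ((r ^ (-(2 * γ)) * potential n γ p u (-Real.log r) *
      (r ^ (-(((n : ℝ) - 2 * γ) / 2)) * w (-Real.log r)) : ℝ) : ℂ) *
      (((r ^ (-(((n : ℝ) - 2 * γ) / 2)) : ℝ) : ℂ) * ψ (-Real.log r))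
  simp only [fromCylinder, toPunctured] at h h1 h2
  rw [h1, h2] at h
  have h3 := mul_left_cancel₀ radialConst_ne_zero h
  have h4 : ∀ t : ℝ, rexp (-(n * t)) * rexp (-t) ^ (-(((n : ℝ) - 2 * γ) / 2)) =
      rexp (-(t * (n / 2 + γ))) := by
    intro t
    rw [← Real.exp_mul, ← Real.exp_add]
    congr 1
    ring
  have h5 : ∀ t : ℝ, rexp (-(t * (n / 2 + γ))) * rexp (-t) ^ (-(2 * γ)) *
      rexp (-t) ^ (-(((n : ℝ) - 2 * γ) / 2)) = 1 := by
    intro t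
    rw [← Real.exp_mul, ← Real.exp_mul, ← Real.exp_add, ← Real.exp_add, Real.exp_eq_one_iff]
    ring
  convert h3 using 1
  · refine integral_congr_ae (.of_forall fun t => ?_)
    simp only [cylinderLaplacian, ← h4, Real.log_exp, neg_neg]
    push_cast
    unfold toPunctured
    ring
  · refine integral_congr_ae (.of_forall fun t => ?_)
    have h6 : ((rexp (-(n * t)) : ℝ) : ℂ) * ((rexp (-t) ^ (-(((n : ℝ) - 2 * γ) / 2)) : ℝ) : ℂ) *
        ((rexp (-t) ^ (-(2 * γ)) : ℝ) : ℂ) * ((rexp (-t) ^ (-(((n : ℝ) - 2 * γ) / 2)) : ℝ) : ℂ) = 1 := by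
      rw [← Complex.ofReal_mul, ← Complex.ofReal_mul, ← Complex.ofReal_mul, h4, h5,
        Complex.ofReal_one]
    simp only [Real.log_exp, neg_neg]
    rw [← mul_one (((potential n γ p u t * w t : ℝ) : ℂ) * ψ t), ← h6]
    push_cast
    ring

/-- For a test function `ψ` on the line, the conformal fractional Laplacian `g` of `ψ`, with its
Fourier transform and the weak form of the equation `𝓛_* w = 0`. -/
theorem exists_conformal_laplacian [Nontrivial (E n)] (hγ0 : 0 < γ) (hγ1 : γ < 1)
    (hn : 2 * γ < n) (hψ : ContDiff ℝ ∞ ψ) (hc : HasCompactSupport ψ) :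
    ∃ g : ℝ → ℂ, Continuous g ∧
      (∃ C, 0 ≤ C ∧ ∀ t, ‖g t‖ ≤ C * rexp (-((n / 2 + γ) * |t|))) ∧
      (∀ ξ : ℝ, ∫ t : ℝ, g t * Complex.exp (ξ * t * Complex.I) =
        symbol n γ ξ * ∫ t : ℝ, ψ t * Complex.exp (ξ * t * Complex.I)) ∧
      ∀ (p : ℝ) (u w : ℝ → ℝ), SolvesLStar n γ p u w → ∀ s,
        ∫ t : ℝ, (w t : ℂ) * g (t - s) =
          ∫ t : ℝ, ((potential n γ p u t * w t : ℝ) : ℂ) * ψ (t - s) := by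
  obtain ⟨e, he⟩ := exists_norm_eq (E n) zero_le_one
  refine ⟨cylinderLaplacian γ e ψ, cylinderLaplacian_continuous hγ0 hn hψ hc e,
    cylinderLaplacian_norm_le hγ0 hγ1 hn hψ hc he,
    integral_cylinderLaplacian_mul_exp hγ0 hγ1 hn hψ hc he, fun p u w hw s => ?_⟩
  -- The equation is tested with the translate of `ψ`; by `cylinderLaplacian_comp_sub` this
  -- translates the same function `g`.
  have h := hw.weak_cylinder hn (ψ := fun t => ψ (t - s)) (hψ.comp (by fun_prop))
    (hc.comp_homeomorph (Homeomorph.subRight s)) he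
  simp only [cylinderLaplacian_comp_sub hn] at h
  exact h

end Cylinder

/-! ### Convolution with `e^{-σ|t|}`. -/

section ExponentialConvolution

variable {F : Type*} [NormedAddCommGroup F] [NormedSpace ℝ F] {σ b C : ℝ} {h : ℝ → F}

theorem integrable_exp_neg_mul_abs (hσ : 0 < σ) : Integrable fun s : ℝ => rexp (-(σ * |s|)) := by
  rw [← integrableOn_univ, ← Iic_union_Ioi (a := (0 : ℝ))]
  refine IntegrableOn.union ?_ ?_
  · exact (integrableOn_exp_mul_Iic hσ 0).congr_fun
      (fun s hs => by simp only [abs_of_nonpos (mem_Iic.1 hs), mul_neg, neg_neg]) measurableSet_Iic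
  · exact (integrableOn_exp_mul_Ioi (neg_lt_zero.2 hσ) 0).congr_fun
      (fun s hs => by simp only [abs_of_pos (mem_Ioi.1 hs), neg_mul]) measurableSet_Ioi

theorem integral_exp_neg_mul_abs (hσ : 0 < σ) : ∫ s : ℝ, rexp (-(σ * |s|)) = 2 / σ := by
  rw [integral_comp_abs (f := fun s => rexp (-(σ * s)))]
  have := integral_exp_mul_Ioi (neg_lt_zero.2 hσ) 0
  simp only [neg_mul, mul_zero, Real.exp_zero] at this
  rw [this]
  field_simp

/-- The convolution of `h` with `e^{-σ|t|}`. -/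
def expConv (σ : ℝ) (h : ℝ → F) (t : ℝ) : F := ∫ s, rexp (-(σ * |t - s|)) • h s

/-- Since `|s|` and `|t|` differ by at most `|t - s|`, replacing `e^{b|s|}` by `e^{b|t|}` costs only
`|b|` in the exponential rate. -/
theorem norm_exp_smul_le (hb : ∀ s, ‖h s‖ ≤ C * rexp (b * |s|)) (t s : ℝ) :
    ‖rexp (-(σ * |t - s|)) • h s‖ ≤ C * rexp (b * |t|) * rexp (-((σ - |b|) * |t - s|)) := by
  have hC : 0 ≤ C := by
    have := (norm_nonneg _).trans (hb 0)
    exact nonneg_of_mul_nonneg_left this (Real.exp_pos _)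
  rw [norm_smul, Real.norm_of_nonneg (Real.exp_pos _).le]
  refine (mul_le_mul_of_nonneg_left (hb s) (Real.exp_pos _).le).trans ?_
  rw [mul_left_comm, mul_assoc, ← Real.exp_add, ← Real.exp_add]
  refine mul_le_mul_of_nonneg_left (Real.exp_le_exp.2 ?_) hC
  have h1 : b * (|s| - |t|) ≤ |b| * |t - s| := by
    refine (le_abs_self _).trans ?_
    rw [abs_mul]
    refine mul_le_mul_of_nonneg_left ?_ (abs_nonneg b)
    rw [abs_sub_comm]
    exact (abs_abs_sub_abs_le_abs_sub _ _).trans (by rw [abs_sub_comm])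
  linarith

theorem integrable_expConv (hh : Continuous h) (hb : ∀ s, ‖h s‖ ≤ C * rexp (b * |s|))
    (hσ : |b| < σ) (t : ℝ) : Integrable fun s => rexp (-(σ * |t - s|)) • h s := by
  refine (((integrable_exp_neg_mul_abs (sub_pos.2 hσ)).comp_sub_left t).const_mul
    (C * rexp (b * |t|))).mono' ?_ (.of_forall fun s => norm_exp_smul_le hb t s)
  exact Continuous.aestronglyMeasurable (by fun_prop)

theorem integral_norm_expConv_le (hh : Continuous h) (hb : ∀ s, ‖h s‖ ≤ C * rexp (b * |s|))
    (hσ : |b| < σ) (t : ℝ) :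
    ∫ s, ‖rexp (-(σ * |t - s|)) • h s‖ ≤ C * rexp (b * |t|) * (2 / (σ - |b|)) := by
  have h1 := integral_exp_neg_mul_abs (sub_pos.2 hσ)
  rw [← integral_sub_left_eq_self _ volume t] at h1
  rw [← h1, ← integral_const_mul]
  exact integral_mono (integrable_expConv hh hb hσ t).norm
    (((integrable_exp_neg_mul_abs (sub_pos.2 hσ)).comp_sub_left t).const_mul _)
    fun s => norm_exp_smul_le hb t s

theorem norm_expConv_le (hh : Continuous h) (hb : ∀ s, ‖h s‖ ≤ C * rexp (b * |s|))
    (hσ : |b| < σ) (t : ℝ) : ‖expConv σ h t‖ ≤ C * rexp (b * |t|) * (2 / (σ - |b|)) :=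
  (norm_integral_le_integral_norm _).trans (integral_norm_expConv_le hh hb hσ t)

/-- The part of `expConv` over `(-∞, t]`. -/
def expConvLeft (σ : ℝ) (h : ℝ → F) (t : ℝ) : F := ∫ s in Iic t, rexp (-(σ * |t - s|)) • h s

/-- The part of `expConv` over `(t, ∞)`. -/
def expConvRight (σ : ℝ) (h : ℝ → F) (t : ℝ) : F := ∫ s in Ioi t, rexp (-(σ * |t - s|)) • h s

theorem expConv_eq (hh : Continuous h) (hb : ∀ s, ‖h s‖ ≤ C * rexp (b * |s|)) (hσ : |b| < σ)
    (t : ℝ) : expConv σ h t = expConvLeft σ h t + expConvRight σ h t :=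
  (intervalIntegral.integral_Iic_add_Ioi (integrable_expConv hh hb hσ t).integrableOn
    (integrable_expConv hh hb hσ t).integrableOn).symm

theorem norm_expConvLeft_add_le (hh : Continuous h) (hb : ∀ s, ‖h s‖ ≤ C * rexp (b * |s|))
    (hσ : |b| < σ) (t : ℝ) :
    ‖expConvLeft σ h t‖ + ‖expConvRight σ h t‖ ≤ C * rexp (b * |t|) * (2 / (σ - |b|)) := by
  refine le_trans ?_ (integral_norm_expConv_le hh hb hσ t)
  rw [← intervalIntegral.integral_Iic_add_Ioi (integrable_expConv hh hb hσ t).norm.integrableOn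
    (integrable_expConv hh hb hσ t).norm.integrableOn]
  exact add_le_add (norm_integral_le_integral_norm _) (norm_integral_le_integral_norm _)

/-- The derivative of `expConv`. -/
def expConvDeriv (σ : ℝ) (h : ℝ → F) (t : ℝ) : F := σ • (expConvRight σ h t - expConvLeft σ h t)

theorem norm_expConvDeriv_le (hh : Continuous h) (hb : ∀ s, ‖h s‖ ≤ C * rexp (b * |s|))
    (hσ : |b| < σ) (t : ℝ) :
    ‖expConvDeriv σ h t‖ ≤ σ * (C * rexp (b * |t|) * (2 / (σ - |b|))) := by
  have hσ0 : 0 < σ := (abs_nonneg b).trans_lt hσ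
  rw [expConvDeriv, norm_smul, Real.norm_of_nonneg hσ0.le]
  refine mul_le_mul_of_nonneg_left ((norm_sub_le _ _).trans ?_) hσ0.le
  rw [add_comm]
  exact norm_expConvLeft_add_le hh hb hσ t

theorem expConvRight_eq (σ : ℝ) (h : ℝ → F) (t : ℝ) :
    expConvRight σ h t = expConvLeft σ (fun s => h (-s)) (-t) := by
  have := integral_comp_neg_Iic (-t) fun s => rexp (-(σ * |t - s|)) • h s
  rw [neg_neg] at this
  rw [expConvRight, ← this, expConvLeft]
  refine setIntegral_congr_fun measurableSet_Iic fun s _ => ?_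
  rw [← abs_neg (-t - s)]
  congr 5
  ring

variable [CompleteSpace F]

/-- On `s ≤ t` the kernel factors as `e^{-σt} e^{σs}`, so the product rule and the fundamental
theorem of calculus apply. -/
theorem hasDerivAt_expConvLeft (hh : Continuous h) (hb : ∀ s, ‖h s‖ ≤ C * rexp (b * |s|))
    (hσ : |b| < σ) (t : ℝ) :
    HasDerivAt (expConvLeft σ h) (h t - σ • expConvLeft σ h t) t := by
  have hcont : Continuous fun s => rexp (σ * s) • h s := by fun_prop
  have hint : ∀ t, IntegrableOn (fun s => rexp (σ * s) • h s) (Iic t) := fun t => by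
    have h0 : IntegrableOn (fun s => rexp (σ * t) • rexp (-(σ * |t - s|)) • h s) (Iic t) :=
      ((integrable_expConv hh hb hσ t).smul (rexp (σ * t))).integrableOn
    refine h0.congr_fun (fun s hs => ?_) measurableSet_Iic
    simp only [smul_smul, ← Real.exp_add, abs_of_nonneg (sub_nonneg.2 (mem_Iic.1 hs))]
    congr 2
    ring
  have heq : expConvLeft σ h = fun t => rexp (-(σ * t)) •
      ((∫ s in Iic (0 : ℝ), rexp (σ * s) • h s) + ∫ s in (0 : ℝ)..t, rexp (σ * s) • h s) := by
    funext t
    rw [← intervalIntegral.integral_Iic_sub_Iic (hint 0) (hint t), add_sub_cancel, ← integral_smul]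
    refine setIntegral_congr_fun measurableSet_Iic fun s hs => ?_
    simp only [smul_smul, ← Real.exp_add, abs_of_nonneg (sub_nonneg.2 (mem_Iic.1 hs))]
    congr 2
    ring
  have h1 : HasDerivAt (fun t => (∫ s in Iic (0 : ℝ), rexp (σ * s) • h s) +
      ∫ s in (0 : ℝ)..t, rexp (σ * s) • h s) (rexp (σ * t) • h t) t :=
    (hcont.integral_hasStrictDerivAt 0 t).hasDerivAt.const_add _
  have h2 : HasDerivAt (fun t : ℝ => rexp (-(σ * t))) (-σ * rexp (-(σ * t))) t := by
    have := ((hasDerivAt_id t).const_mul (-σ)).exp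
    simp only [id, neg_mul, mul_one] at this
    convert! this using 1
    ring
  have h3 := h2.smul h1
  rw [heq]
  convert! h3 using 1
  rw [smul_smul, smul_smul, ← Real.exp_add, neg_add_cancel, Real.exp_zero, one_smul, neg_mul,
    neg_smul, sub_eq_add_neg]

theorem hasDerivAt_expConvRight (hh : Continuous h) (hb : ∀ s, ‖h s‖ ≤ C * rexp (b * |s|))
    (hσ : |b| < σ) (t : ℝ) :
    HasDerivAt (expConvRight σ h) (σ • expConvRight σ h t - h t) t := by
  have h1 := hasDerivAt_expConvLeft (h := fun s => h (-s)) (hh.comp continuous_neg)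
    (fun s => by simpa using hb (-s)) hσ (-t)
  have h2 := h1.scomp t (hasDerivAt_neg t)
  rw [neg_neg, ← expConvRight_eq] at h2
  convert! h2 using 1
  · funext t
    exact expConvRight_eq σ h t
  · rw [neg_smul, one_smul, neg_sub]

theorem hasDerivAt_expConv (hh : Continuous h) (hb : ∀ s, ‖h s‖ ≤ C * rexp (b * |s|))
    (hσ : |b| < σ) (t : ℝ) : HasDerivAt (expConv σ h) (expConvDeriv σ h t) t := by
  have h1 := (hasDerivAt_expConvLeft hh hb hσ t).add (hasDerivAt_expConvRight hh hb hσ t)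
  convert! h1 using 1
  · funext t
    exact expConv_eq hh hb hσ t
  · rw [expConvDeriv, smul_sub]
    abel

/-- The second-order equation of a component. The two halves of the convolution each contribute `h
t` once, multiplied by `σ`, because the kernel has a corner at `s = t`. -/
theorem hasDerivAt_expConvDeriv (hh : Continuous h) (hb : ∀ s, ‖h s‖ ≤ C * rexp (b * |s|))
    (hσ : |b| < σ) (t : ℝ) :
    HasDerivAt (expConvDeriv σ h) (σ ^ 2 • expConv σ h t - (2 * σ) • h t) t := by
  have h1 := ((hasDerivAt_expConvRight hh hb hσ t).sub (hasDerivAt_expConvLeft hh hb hσ t)).const_smul σ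
  convert! h1 using 1
  rw [expConv_eq hh hb hσ t]
  module

theorem expConv_continuous (hh : Continuous h) (hb : ∀ s, ‖h s‖ ≤ C * rexp (b * |s|))
    (hσ : |b| < σ) : Continuous (expConv σ h) :=
  continuous_iff_continuousAt.2 fun t => (hasDerivAt_expConv hh hb hσ t).continuousAt

end ExponentialConvolution

/-! ### Duality and Fourier transform for `e^{-σ|t|}`. -/

section Pairing

variable {a f : ℝ → ℂ} {b b' σ C C' : ℝ}

theorem integrable_exp_neg_prod {A B : ℝ} (hA : 0 < A) (hB : 0 < B) :
    Integrable (fun p : ℝ × ℝ => rexp (-(B * |p.2|)) * rexp (-(A * |p.1 - p.2|)))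
      (volume.prod volume) :=
  (integrable_exp_neg_mul_abs hB).convolution_integrand (ContinuousLinearMap.mul ℝ ℝ)
    (integrable_exp_neg_mul_abs hA)

theorem nonneg_of_exp_bound (hb : ∀ s, ‖a s‖ ≤ C * rexp (b * |s|)) : 0 ≤ C :=
  nonneg_of_mul_nonneg_left ((norm_nonneg _).trans (hb 0)) (Real.exp_pos _)

theorem integral_mul_expConv (ha : Continuous a) (hab : ∀ s, ‖a s‖ ≤ C * rexp (b * |s|))
    (hf : Continuous f) (hfb : ∀ s, ‖f s‖ ≤ C' * rexp (-b' * |s|)) (hb0 : 0 ≤ b) (hbb : b < b')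
    (hbσ : b < σ) : ∫ t, a t * expConv σ f t = ∫ t, expConv σ a t * f t := by
  have hC := nonneg_of_exp_bound hab
  have hC' := nonneg_of_exp_bound hfb
  have hint : Integrable (Function.uncurry fun t s => a t * (rexp (-(σ * |t - s|)) • f s))
      (volume.prod volume) := by
    refine ((integrable_exp_neg_prod (sub_pos.2 hbσ) (sub_pos.2 hbb)).const_mul (C * C')).mono' ?_
      (.of_forall fun p => ?_)
    · exact Continuous.aestronglyMeasurable (by unfold Function.uncurry; fun_prop)
    · simp only [Function.uncurry]
      rw [norm_mul, norm_smul, Real.norm_of_nonneg (Real.exp_pos _).le]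
      calc ‖a p.1‖ * (rexp (-(σ * |p.1 - p.2|)) * ‖f p.2‖) ≤
          (C * rexp (b * |p.1|)) * (rexp (-(σ * |p.1 - p.2|)) * (C' * rexp (-b' * |p.2|))) := by
            gcongr
            · exact hab _
            · exact hfb _
        _ = C * C' * rexp (b * |p.1| + -(σ * |p.1 - p.2|) + -b' * |p.2|) := by
            rw [Real.exp_add, Real.exp_add]
            ring
        _ ≤ _ := by
            rw [← Real.exp_add]
            refine mul_le_mul_of_nonneg_left (Real.exp_le_exp.2 ?_) (by positivity)
            have : |p.1| ≤ |p.1 - p.2| + |p.2| := by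
              simpa using abs_add_le (p.1 - p.2) p.2
            nlinarith
  have h1 := integral_integral_swap hint
  simp only [integral_const_mul] at h1
  refine h1.trans (integral_congr_ae (.of_forall fun s => ?_))
  simp only [expConv]
  rw [← integral_mul_const]
  refine integral_congr_ae (.of_forall fun t => ?_)
  simp only [abs_sub_comm t s, Complex.real_smul]
  ring

/-- Expresses the pairing of `a` with a convolution through the correlations `s ↦ ∫ a (t) f (t -
s)`. These are exactly the quantities controlled when a weak equation is tested against translates.
-/
theorem integral_exp_mul_integral (ha : Continuous a) (hab : ∀ s, ‖a s‖ ≤ C * rexp (b * |s|))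
    (hf : Continuous f) (hfb : ∀ s, ‖f s‖ ≤ C' * rexp (-b' * |s|)) (hb0 : 0 ≤ b) (hbb : b < b')
    (hbσ : b < σ) :
    ∫ s, ((rexp (-(σ * |s|)) : ℝ) : ℂ) * ∫ t, a t * f (t - s) = ∫ t, a t * expConv σ f t := by
  have hC := nonneg_of_exp_bound hab
  have hC' := nonneg_of_exp_bound hfb
  have hint : Integrable (Function.uncurry fun t s =>
      ((rexp (-(σ * |s|)) : ℝ) : ℂ) * (a t * f (t - s))) (volume.prod volume) := by
    refine ((integrable_exp_neg_prod (sub_pos.2 hbb) (sub_pos.2 hbσ)).const_mul (C * C')).mono' ?_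
      (.of_forall fun p => ?_)
    · exact Continuous.aestronglyMeasurable (by unfold Function.uncurry; fun_prop)
    · simp only [Function.uncurry]
      rw [norm_mul, norm_mul, Complex.norm_real, Real.norm_of_nonneg (Real.exp_pos _).le]
      calc rexp (-(σ * |p.2|)) * (‖a p.1‖ * ‖f (p.1 - p.2)‖) ≤
          rexp (-(σ * |p.2|)) * ((C * rexp (b * |p.1|)) * (C' * rexp (-b' * |p.1 - p.2|))) := by
            gcongr
            · exact hab _
            · exact hfb _
        _ = C * C' * rexp (b * |p.1| + -(σ * |p.2|) + -b' * |p.1 - p.2|) := by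
            rw [Real.exp_add, Real.exp_add]
            ring
        _ ≤ _ := by
            rw [← Real.exp_add]
            refine mul_le_mul_of_nonneg_left (Real.exp_le_exp.2 ?_) (by positivity)
            have : |p.1| ≤ |p.1 - p.2| + |p.2| := by
              simpa using abs_add_le (p.1 - p.2) p.2
            nlinarith
  have h1 := integral_integral_swap hint
  simp only [integral_const_mul] at h1
  rw [← h1]
  refine integral_congr_ae (.of_forall fun t => ?_)
  simp only [mul_left_comm _ (a t), integral_const_mul]
  congr 1
  rw [expConv, ← integral_sub_left_eq_self _ volume t]
  refine integral_congr_ae (.of_forall fun s => ?_)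
  simp [Complex.real_smul]

/-- Splitting the integral at the origin gives `1/(σ - iξ) + 1/(σ + iξ)`. -/
theorem expConv_cexp (hσ : 0 < σ) (ξ t : ℝ) :
    expConv σ (fun s : ℝ => Complex.exp (ξ * s * Complex.I)) t =
      ((2 * σ / (σ ^ 2 + ξ ^ 2) : ℝ) : ℂ) * Complex.exp (ξ * t * Complex.I) := by
  have hl : (((σ : ℂ) - ξ * Complex.I)).re = σ := by simp
  have hr : (-((σ : ℂ) + ξ * Complex.I)).re = -σ := by simp
  have hl0 : (σ : ℂ) - ξ * Complex.I ≠ 0 := fun h => by simp [h] at hl; linarith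
  have hr0 : (σ : ℂ) + ξ * Complex.I ≠ 0 := fun h => by simp [h] at hr; linarith
  have h1 : ∀ u ∈ Iic (0 : ℝ), Complex.exp (((σ : ℂ) - ξ * Complex.I) * u) =
      rexp (-(σ * |u|)) • Complex.exp (ξ * (-u : ℝ) * Complex.I) := fun u hu => by
    rw [abs_of_nonpos hu, Complex.real_smul, Complex.ofReal_exp, ← Complex.exp_add]
    congr 1
    push_cast
    ring
  have h2 : ∀ u ∈ Ioi (0 : ℝ), Complex.exp (-((σ : ℂ) + ξ * Complex.I) * u) =
      rexp (-(σ * |u|)) • Complex.exp (ξ * (-u : ℝ) * Complex.I) := fun u hu => by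
    rw [abs_of_pos hu, Complex.real_smul, Complex.ofReal_exp, ← Complex.exp_add]
    congr 1
    push_cast
    ring
  have h3 := intervalIntegral.integral_Iic_add_Ioi
    ((integrableOn_exp_mul_complex_Iic (by rwa [hl]) 0).congr_fun h1 measurableSet_Iic)
    ((integrableOn_exp_mul_complex_Ioi (by rw [hr]; linarith) 0).congr_fun h2 measurableSet_Ioi)
  rw [← setIntegral_congr_fun measurableSet_Iic h1, ← setIntegral_congr_fun measurableSet_Ioi h2,
    integral_exp_mul_complex_Iic (by rwa [hl]), integral_exp_mul_complex_Ioi (by rw [hr]; linarith)]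
    at h3
  rw [expConv, ← integral_sub_left_eq_self _ volume t]
  have h4 : ∀ s : ℝ, rexp (-(σ * |t - (t - s)|)) • Complex.exp (ξ * (t - s : ℝ) * Complex.I) =
      rexp (-(σ * |s|)) • Complex.exp (ξ * (-s : ℝ) * Complex.I) *
        Complex.exp (ξ * t * Complex.I) := fun s => by
    rw [sub_sub_cancel, smul_mul_assoc, ← Complex.exp_add]
    congr 2
    push_cast
    ring
  simp only [h4]
  rw [integral_mul_const, ← h3]
  congr 1
  have h5 : (σ : ℂ) ^ 2 + (ξ : ℂ) ^ 2 = ((σ : ℂ) - ξ * Complex.I) * (σ + ξ * Complex.I) := by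
    linear_combination (ξ : ℂ) ^ 2 * Complex.I_sq
  push_cast
  rw [h5]
  simp only [mul_zero, Complex.exp_zero]
  field_simp
  ring

end Pairing

/-! ### The Green's function `∑ c_j e^{-σ_j|t|}`. -/

section GreenSeries

theorem eq_zero_of_integral_mul_exp_eq_zero {D : ℝ → ℂ} (hD : Continuous D) (hDi : Integrable D)
    (h : ∀ ξ : ℝ, ∫ t, D t * Complex.exp (ξ * t * Complex.I) = 0) : D = 0 := by
  have h1 : 𝓕 D = 0 := by
    funext ξ
    rw [Real.fourier_real_eq_integral_exp_smul, Pi.zero_apply, ← h (-2 * π * ξ)]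
    refine integral_congr_ae (.of_forall fun t => ?_)
    simp only [smul_eq_mul]
    rw [mul_comm]
    congr 3
    push_cast
    ring
  rw [← hD.fourierInv_fourier_eq hDi (by rw [h1]; exact integrable_zero _ _ _), h1]
  funext t
  simp [Real.fourierInv_eq]

theorem hasSum_integral_of_exp_bound {A : ℕ → ℝ → ℂ} {D : ℕ → ℝ} {d : ℝ} (hd : 0 < d)
    (hA : ∀ j, Continuous (A j)) (hAD : ∀ j t, ‖A j t‖ ≤ D j * rexp (-(d * |t|)))
    (hD : Summable D) : HasSum (fun j => ∫ t, A j t) (∫ t, ∑' j, A j t) := by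
  have hint : ∀ j, Integrable (A j) := fun j =>
    ((integrable_exp_neg_mul_abs hd).const_mul (D j)).mono' (hA j).aestronglyMeasurable
      (.of_forall (hAD j))
  refine hasSum_integral_of_summable_integral_norm hint
    ((hD.mul_right (2 / d)).of_nonneg_of_le (fun j => integral_nonneg fun t => norm_nonneg _)
      fun j => ?_)
  rw [← integral_exp_neg_mul_abs hd, ← integral_const_mul]
  exact integral_mono (hint j).norm ((integrable_exp_neg_mul_abs hd).const_mul (D j)) (hAD j)

/-- Exponents and coefficients of a summable Green's function `∑ⱼ c_j e^{-σ_j|t|}`. -/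
structure IsGreenData (σ c : ℕ → ℝ) : Prop where
  pos : ∀ j, 0 < σ j
  mono : Monotone σ
  nonneg : ∀ j, 0 ≤ c j
  summable : Summable fun j => c j / σ j

/-- The convolution of `h` with `∑ⱼ c_j e^{-σ_j|t|}`. -/
def greenConv {F : Type*} [NormedAddCommGroup F] [NormedSpace ℝ F] (σ c : ℕ → ℝ) (h : ℝ → F)
    (t : ℝ) : F := ∑' j, c j • expConv (σ j) h t

namespace IsGreenData

variable {σ c : ℕ → ℝ} (H : IsGreenData σ c) {b C : ℝ}
include H

theorem abs_lt (hb : |b| < σ 0) (j : ℕ) : |b| < σ j := hb.trans_le (H.mono (Nat.zero_le j))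

/-- `1 - |b|/σ_j ≥ 1 - |b|/σ_0`: the loss in the rate is uniform in `j`, and summability of
`c_j/σ_j` is preserved. -/
theorem inv_sub_le (hb : |b| < σ 0) (j : ℕ) :
    (σ j - |b|)⁻¹ ≤ σ 0 / (σ 0 - |b|) * (σ j)⁻¹ := by
  have h1 := sub_pos.2 (H.abs_lt hb j)
  have h2 := sub_pos.2 hb
  have h3 := H.pos j
  rw [← div_eq_mul_inv, inv_eq_one_div, div_div, div_le_div_iff₀ h1 (by positivity)]
  nlinarith [H.mono (Nat.zero_le j), abs_nonneg b]

theorem summable_div_sub (hb : |b| < σ 0) : Summable fun j => c j / (σ j - |b|) := by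
  refine (H.summable.mul_left (σ 0 / (σ 0 - |b|))).of_nonneg_of_le
    (fun j => div_nonneg (H.nonneg j) (sub_pos.2 (H.abs_lt hb j)).le) fun j => ?_
  rw [div_eq_mul_inv, div_eq_mul_inv (c j), mul_left_comm]
  exact mul_le_mul_of_nonneg_left (H.inv_sub_le hb j) (H.nonneg j)

variable {F : Type*} [NormedAddCommGroup F] [NormedSpace ℝ F] [CompleteSpace F] {h : ℝ → F}

omit [CompleteSpace F] in
theorem norm_term_le (hh : Continuous h) (hbd : ∀ s, ‖h s‖ ≤ C * rexp (b * |s|))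
    (hb : |b| < σ 0) (j : ℕ) (t : ℝ) :
    ‖c j • expConv (σ j) h t‖ ≤ 2 * C * (c j / (σ j - |b|)) * rexp (b * |t|) := by
  rw [norm_smul, Real.norm_of_nonneg (H.nonneg j)]
  refine (mul_le_mul_of_nonneg_left (norm_expConv_le hh hbd (H.abs_lt hb j) t)
    (H.nonneg j)).trans (le_of_eq ?_)
  ring

theorem summable_term (hh : Continuous h) (hbd : ∀ s, ‖h s‖ ≤ C * rexp (b * |s|))
    (hb : |b| < σ 0) (t : ℝ) : Summable fun j => c j • expConv (σ j) h t :=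
  (((H.summable_div_sub hb).mul_left (2 * C)).mul_right (rexp (b * |t|))).of_norm_bounded
    fun j => H.norm_term_le hh hbd hb j t

omit [CompleteSpace F] in
theorem norm_greenConv_le (hh : Continuous h) (hbd : ∀ s, ‖h s‖ ≤ C * rexp (b * |s|))
    (hb : |b| < σ 0) (t : ℝ) :
    ‖greenConv σ c h t‖ ≤ (∑' j, 2 * C * (c j / (σ j - |b|))) * rexp (b * |t|) := by
  rw [← tsum_mul_right]
  exact tsum_of_norm_bounded (((H.summable_div_sub hb).mul_left (2 * C)).mul_right _).hasSum
    fun j => H.norm_term_le hh hbd hb j t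

/-- After multiplication by `e^{-b|t|}` the terms have a summable majorant independent of `t`. -/
theorem continuous_greenConv (hh : Continuous h) (hbd : ∀ s, ‖h s‖ ≤ C * rexp (b * |s|))
    (hb : |b| < σ 0) : Continuous (greenConv σ c h) := by
  have h1 : Continuous fun t => ∑' j, rexp (-(b * |t|)) • c j • expConv (σ j) h t := by
    refine continuous_tsum (fun j => ?_) ((H.summable_div_sub hb).mul_left (2 * C)) fun j t => ?_
    · have := expConv_continuous hh hbd (H.abs_lt hb j)
      fun_prop
    · rw [norm_smul, Real.norm_of_nonneg (Real.exp_pos _).le]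
      refine (mul_le_mul_of_nonneg_left (H.norm_term_le hh hbd hb j t)
        (Real.exp_pos _).le).trans (le_of_eq ?_)
      rw [mul_left_comm, ← Real.exp_add, neg_add_cancel, Real.exp_zero, mul_one]
  have h2 : greenConv σ c h = fun t => rexp (b * |t|) •
      ∑' j, rexp (-(b * |t|)) • c j • expConv (σ j) h t := by
    funext t
    rw [(H.summable_term hh hbd hb t).tsum_const_smul, smul_smul, ← Real.exp_add, add_neg_cancel,
      Real.exp_zero, one_smul, greenConv]
  rw [h2]
  exact (by fun_prop : Continuous fun t : ℝ => rexp (b * |t|)).smul h1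

/-- Applied with `f = (P - κ)ψ` and `m = 1/(Θ₀ - κ)`, where it says that the Green's function
inverts `P - κ` on test functions. Both sides are continuous and integrable, and their Fourier
transforms agree, the left one being computed term by term with `expConv_cexp`. -/
theorem greenConv_eq {f ψ : ℝ → ℂ} {b' : ℝ} (hf : Continuous f)
    (hfb : ∀ s, ‖f s‖ ≤ C * rexp (-b' * |s|)) (hb0 : 0 < b') (hb : b' < σ 0)
    (hψ : Continuous ψ) (hψi : Integrable ψ) {m : ℝ → ℂ}
    (hm : ∀ ξ : ℝ, HasSum (fun j => ((2 * c j * σ j / (σ j ^ 2 + ξ ^ 2) : ℝ) : ℂ)) (m ξ))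
    (hfψ : ∀ ξ : ℝ, m ξ * ∫ t : ℝ, f t * Complex.exp (ξ * t * Complex.I) =
      ∫ t : ℝ, ψ t * Complex.exp (ξ * t * Complex.I)) : greenConv σ c f = ψ := by
  have hb1 : |-b'| < σ 0 := by rwa [abs_neg, abs_of_pos hb0]
  have hcont := H.continuous_greenConv hf hfb hb1
  have hint : Integrable (greenConv σ c f) := by
    refine ((integrable_exp_neg_mul_abs hb0).const_mul (∑' j, 2 * C * (c j / (σ j - |-b'|)))).mono'
      hcont.aestronglyMeasurable (.of_forall fun t => ?_)
    rw [← neg_mul]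
    exact H.norm_greenConv_le hf hfb hb1 t
  have hexp : ∀ ξ t : ℝ, ‖Complex.exp (ξ * t * Complex.I)‖ = 1 := fun ξ t => by
    rw [← Complex.ofReal_mul, Complex.norm_exp_ofReal_mul_I]
  have hexpi : ∀ {G : ℝ → ℂ} (ξ : ℝ), Integrable G →
      Integrable fun t : ℝ => G t * Complex.exp (ξ * t * Complex.I) := fun {G} ξ hG => by
    refine (hG.bdd_mul (c := 1) (f := fun t : ℝ => Complex.exp (ξ * t * Complex.I)) ?_
      (.of_forall fun t => (hexp ξ t).le)).congr (.of_forall fun t => mul_comm _ _)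
    exact Continuous.aestronglyMeasurable (by fun_prop)
  have h0 : (fun t => greenConv σ c f t - ψ t) = 0 := by
    refine eq_zero_of_integral_mul_exp_eq_zero (hcont.sub hψ) (hint.sub hψi) fun ξ => ?_
    simp only [sub_mul]
    rw [integral_sub (hexpi ξ hint) (hexpi ξ hψi), sub_eq_zero, ← hfψ]
    have h1 := hasSum_integral_of_exp_bound
      (A := fun j t => c j • expConv (σ j) f t * Complex.exp (ξ * t * Complex.I)) hb0
      (fun j => by
        have := expConv_continuous hf hfb (H.abs_lt hb1 j)
        fun_prop)
      (fun j t => by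
        rw [norm_mul, hexp, mul_one, ← neg_mul]
        exact H.norm_term_le hf hfb hb1 j t)
      ((H.summable_div_sub hb1).mul_left (2 * C))
    have h2 : ∀ j, ∫ t : ℝ, c j • expConv (σ j) f t * Complex.exp (ξ * t * Complex.I) =
        ((2 * c j * σ j / (σ j ^ 2 + ξ ^ 2) : ℝ) : ℂ) *
          ∫ t : ℝ, f t * Complex.exp (ξ * t * Complex.I) := fun j => by
      have h3 := integral_mul_expConv (a := fun t : ℝ => Complex.exp (ξ * t * Complex.I))
        (σ := σ j) (b := 0) (C := 1) (by fun_prop) (fun t => by simp [hexp]) hf hfb le_rfl hb0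
        (H.pos j)
      simp only [expConv_cexp (H.pos j)] at h3
      simp only [smul_mul_assoc]
      rw [integral_smul]
      simp only [mul_comm (expConv _ _ _)]
      rw [h3, ← integral_const_mul, ← integral_smul]
      refine integral_congr_ae (.of_forall fun t => ?_)
      simp only [Complex.real_smul]
      push_cast
      ring
    simp only [h2] at h1
    have h4 := h1.unique ((hm ξ).mul_right _)
    rw [← h4]
    refine integral_congr_ae (.of_forall fun t => ?_)
    simp only [greenConv]
    rw [tsum_mul_right]
  funext t
  exact sub_eq_zero.1 (congrFun h0 t)

/-- For each `j` both pairings reduce to correlations by `integral_exp_mul_integral`, and these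
agree by `heq`. The condition `b < b'` makes the integrands decay, so that the sum over `j` may be
taken outside. -/
theorem integral_mul_greenConv {w h f ψ : ℝ → ℂ} {b' C₁ C₂ C₃ C₄ : ℝ} (hb0 : 0 ≤ b)
    (hbb : b < b') (hb' : b' < σ 0) (hw : Continuous w) (hwb : ∀ s, ‖w s‖ ≤ C₁ * rexp (b * |s|))
    (hh : Continuous h) (hhb : ∀ s, ‖h s‖ ≤ C₂ * rexp (b * |s|))
    (hf : Continuous f) (hfb : ∀ s, ‖f s‖ ≤ C₃ * rexp (-b' * |s|))
    (hψ : Continuous ψ) (hψb : ∀ s, ‖ψ s‖ ≤ C₄ * rexp (-b' * |s|))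
    (heq : ∀ s, ∫ t, w t * f (t - s) = ∫ t, h t * ψ (t - s)) :
    ∫ t, w t * greenConv σ c f t = ∫ t, greenConv σ c h t * ψ t := by
  have hb1 : |-b'| < σ 0 := by rwa [abs_neg, abs_of_pos (hb0.trans_lt hbb)]
  have hb2 : |b| < σ 0 := by rw [abs_of_nonneg hb0]; exact hbb.trans hb'
  have hσ : ∀ j, b < σ j := fun j => (le_abs_self b).trans_lt (H.abs_lt hb2 j)
  have hexp : ∀ x y t : ℝ, x * rexp (b * |t|) * (y * rexp (-b' * |t|)) =
      x * y * rexp (-((b' - b) * |t|)) := fun x y t => by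
    rw [mul_mul_mul_comm, ← Real.exp_add]
    congr 2
    ring
  have h1 := hasSum_integral_of_exp_bound (A := fun j t => w t * c j • expConv (σ j) f t)
    (D := fun j => C₁ * (2 * C₃ * (c j / (σ j - |-b'|)))) (sub_pos.2 hbb)
    (fun j => by
      have := expConv_continuous hf hfb (H.abs_lt hb1 j)
      fun_prop)
    (fun j t => by
      rw [norm_mul, ← hexp]
      exact mul_le_mul (hwb t) (H.norm_term_le hf hfb hb1 j t) (norm_nonneg _)
        ((norm_nonneg _).trans (hwb t)))
    (((H.summable_div_sub hb1).mul_left _).mul_left _)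
  have h2 := hasSum_integral_of_exp_bound (A := fun j t => c j • expConv (σ j) h t * ψ t)
    (D := fun j => 2 * C₂ * (c j / (σ j - |b|)) * C₄) (sub_pos.2 hbb)
    (fun j => by
      have := expConv_continuous hh hhb (H.abs_lt hb2 j)
      fun_prop)
    (fun j t => by
      rw [norm_mul, ← hexp]
      exact mul_le_mul (H.norm_term_le hh hhb hb2 j t) (hψb t) (norm_nonneg _)
        ((norm_nonneg _).trans (H.norm_term_le hh hhb hb2 j t)))
    (((H.summable_div_sub hb2).mul_left _).mul_right _)
  have h3 : ∀ j, ∫ t, w t * c j • expConv (σ j) f t = ∫ t, c j • expConv (σ j) h t * ψ t := by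
    intro j
    simp only [mul_smul_comm, smul_mul_assoc]
    rw [integral_smul, integral_smul, ← integral_exp_mul_integral hw hwb hf hfb hb0 hbb (hσ j),
      ← integral_mul_expConv hh hhb hψ hψb hb0 hbb (hσ j),
      ← integral_exp_mul_integral hh hhb hψ hψb hb0 hbb (hσ j)]
    simp only [heq]
  simp only [h3] at h1
  have h4 := h1.unique h2
  simp only [tsum_mul_left, tsum_mul_right] at h4
  exact h4

end IsGreenData

end GreenSeries

/-! ### Bounds for solutions and their representation by the Green's function. -/

section Wronskian

theorem exists_forall_abs_le_of_isBigO {f g : ℝ → ℝ} (hf : Continuous f) (hg : Continuous g)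
    (hg0 : ∀ t, 0 < g t) (h : f =O[cocompact ℝ] g) : ∃ C, 0 ≤ C ∧ ∀ t, |f t| ≤ C * g t := by
  obtain ⟨c, hc⟩ := h.bound
  obtain ⟨K, hK, hKc⟩ := mem_cocompact.1 hc
  obtain ⟨D, hD⟩ := hK.exists_bound_of_continuousOn
    (hf.div₀ hg fun t => (hg0 t).ne').continuousOn
  refine ⟨max (max c D) 0, le_max_right _ _, fun t => ?_⟩
  by_cases ht : t ∈ K
  · have h1 := hD t ht
    rw [norm_div, Real.norm_of_nonneg (hg0 t).le, div_le_iff₀ (hg0 t)] at h1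
    exact h1.trans (mul_le_mul_of_nonneg_right ((le_max_right _ _).trans (le_max_left _ _))
      (hg0 t).le)
  · have h1 : ‖f t‖ ≤ c * ‖g t‖ := hKc ht
    rw [Real.norm_of_nonneg (hg0 t).le] at h1
    exact h1.trans (mul_le_mul_of_nonneg_right ((le_max_left _ _).trans (le_max_left _ _))
      (hg0 t).le)

variable {n : ℕ} {γ p κ : ℝ} {u w : ℝ → ℝ}

theorem one_lt_of_mem_Ioo (hγ0 : 0 < γ) (hn : 2 * γ < n)
    (hp : p ∈ Ioo ((n : ℝ) / (n - 2 * γ)) ((n + 2 * γ) / (n - 2 * γ))) : 1 < p := by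
  refine lt_of_le_of_lt ?_ hp.1
  rw [one_le_div (by linarith)]
  linarith

/-- The lower bound on `p` in the form that makes `r^{2γ/(p-1)} u_*` tend to `0` at infinity, where
`u_*` decays like `r^{-(n-2γ)}`. -/
theorem decay_exponent_lt (hγ0 : 0 < γ) (hn : 2 * γ < n)
    (hp : p ∈ Ioo ((n : ℝ) / (n - 2 * γ)) ((n + 2 * γ) / (n - 2 * γ))) :
    2 * γ / (p - 1) < n - 2 * γ := by
  have h1 := one_lt_of_mem_Ioo hγ0 hn hp
  have h2 := hp.1
  rw [div_lt_iff₀ (by linarith)] at h2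
  rw [div_lt_iff₀ (by linarith)]
  linarith

namespace IsFastDecaySolution

variable (hu : IsFastDecaySolution n γ p u)
include hu

theorem continuous_emdenFowler :
    Continuous fun t : ℝ => rexp (-t) ^ (2 * γ / (p - 1)) * u (rexp (-t)) := by
  refine ((by fun_prop : Continuous fun t : ℝ => rexp (-t)).rpow_const fun t =>
    Or.inl (Real.exp_pos _).ne').mul ?_
  exact hu.continuousOn.comp_continuous (by fun_prop) fun t => Real.exp_pos _

theorem continuous_potential (h1 : 1 < p) : Continuous (potential n γ p u) :=
  continuous_const.mul (hu.continuous_emdenFowler.rpow_const fun _ => Or.inr (by linarith))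

theorem exists_potential_bound (h1 : 1 < p) (h2 : 2 * γ / (p - 1) < n - 2 * γ) :
    ∃ M, 0 ≤ M ∧ ∀ t, |potential n γ p u t| ≤ M := by
  have hexp0 : Tendsto (fun t : ℝ => rexp (-t)) atTop (𝓝[>] 0) :=
    tendsto_nhdsWithin_iff.2 ⟨Real.tendsto_exp_neg_atTop_nhds_zero, .of_forall fun t =>
      Real.exp_pos _⟩
  have hexp1 : Tendsto (fun t : ℝ => rexp (-t)) atBot atTop :=
    Real.tendsto_exp_atTop.comp tendsto_neg_atBot_atTop
  have htop : Tendsto (fun t : ℝ => rexp (-t) ^ (2 * γ / (p - 1)) * u (rexp (-t))) atTop (𝓝 1) := by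
    simpa only [Function.comp_def, mul_comm] using hu.at_zero.comp hexp0
  have hbot : Tendsto (fun t : ℝ => rexp (-t) ^ (2 * γ / (p - 1)) * u (rexp (-t))) atBot (𝓝 0) := by
    have h3 : Tendsto (fun r : ℝ => r ^ (2 * γ / (p - 1)) * u r) atTop (𝓝 0) := by
      have h4 := hu.at_infty.mul (tendsto_rpow_neg_atTop (sub_pos.2 h2))
      rw [mul_zero] at h4
      refine h4.congr' ?_
      filter_upwards [eventually_gt_atTop 0] with r hr
      rw [mul_assoc, ← Real.rpow_add hr, mul_comm]
      congr 2
      ring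
    exact h3.comp hexp1
  have hO : (fun t : ℝ => rexp (-t) ^ (2 * γ / (p - 1)) * u (rexp (-t))) =O[cocompact ℝ]
      fun _ => (1 : ℝ) := by
    rw [cocompact_eq_atBot_atTop]
    exact (hbot.isBigO_one ℝ).sup (htop.isBigO_one ℝ)
  obtain ⟨C, hC0, hC⟩ := exists_forall_abs_le_of_isBigO hu.continuous_emdenFowler continuous_const
    (fun _ => one_pos) hO
  refine ⟨|p * constA n p γ| * C ^ (p - 1), by positivity, fun t => ?_⟩
  have h5 : 0 ≤ rexp (-t) ^ (2 * γ / (p - 1)) * u (rexp (-t)) :=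
    mul_nonneg (Real.rpow_nonneg (Real.exp_pos _).le _) (hu.nonneg _ (Real.exp_pos _))
  have h6 := hC t
  rw [mul_one, abs_of_nonneg h5] at h6
  rw [potential, abs_mul, abs_of_nonneg (Real.rpow_nonneg h5 _)]
  exact mul_le_mul_of_nonneg_left (Real.rpow_le_rpow h5 h6 (by linarith)) (abs_nonneg _)

end IsFastDecaySolution

/-- Continuity and exponential bounds for `w` and its source `(𝒱_* - κ) w`. -/
structure HasExpBound (n : ℕ) (γ p κ : ℝ) (u w : ℝ → ℝ) (b C : ℝ) : Prop where
  continuous : Continuous w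
  bound : ∀ s, ‖w s‖ ≤ C * rexp (b * |s|)
  source_continuous : Continuous (source n γ p κ u w)
  source_bound : ∀ s, ‖source n γ p κ u w s‖ ≤ C * rexp (b * |s|)

theorem HasExpBound.mono {b b' C C' : ℝ} (h : HasExpBound n γ p κ u w b C) (hb : b ≤ b')
    (hC0 : 0 ≤ C) (hC : C ≤ C') : HasExpBound n γ p κ u w b' C' := by
  have h1 : ∀ s : ℝ, C * rexp (b * |s|) ≤ C' * rexp (b' * |s|) := fun s => by
    have := hC0.trans hC
    gcongr
  exact ⟨h.continuous, fun s => (h.bound s).trans (h1 s), h.source_continuous,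
    fun s => (h.source_bound s).trans (h1 s)⟩

theorem IsAdmissibleSolution.exists_hasExpBound (hγ0 : 0 < γ) (hn : 2 * γ < n)
    (hp : p ∈ Ioo ((n : ℝ) / (n - 2 * γ)) ((n + 2 * γ) / (n - 2 * γ)))
    (hu : IsFastDecaySolution n γ p u) (hσ : 0 < sigma n γ κ 0)
    (hw : IsAdmissibleSolution n γ p κ u w) :
    ∃ b C, 0 ≤ b ∧ b < sigma n γ κ 0 ∧ 0 ≤ C ∧ HasExpBound n γ p κ u w b C := by
  have h1 := one_lt_of_mem_Ioo hγ0 hn hp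
  obtain ⟨M, hM0, hM⟩ := hu.exists_potential_bound h1 (decay_exponent_lt hγ0 hn hp)
  obtain ⟨α, hα, hwα⟩ := hw.growth
  obtain ⟨C, hC0, hC⟩ := exists_forall_abs_le_of_isBigO hw.continuous (by fun_prop)
    (fun t => Real.exp_pos _) hwα
  have hwb : ∀ s, |w s| ≤ C * rexp (max (-α) 0 * |s|) := fun s => (hC s).trans (by
    rw [← neg_mul]
    gcongr
    exact le_max_left _ _)
  -- The rate must be nonnegative for the duality lemmas, so decaying solutions receive the rate
  -- `0`.
  refine ⟨max (-α) 0, max C ((M + |κ|) * C), le_max_right _ _, max_lt (by linarith) hσ,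
    hC0.trans (le_max_left _ _), hw.continuous, fun s => (hwb s).trans ?_,
    ((hu.continuous_potential h1).sub continuous_const).mul hw.continuous, fun s => ?_⟩
  · gcongr
    exact le_max_left _ _
  · rw [source, norm_mul]
    calc ‖potential n γ p u s - κ‖ * ‖w s‖ ≤ (M + |κ|) * (C * rexp (max (-α) 0 * |s|)) := by
          refine mul_le_mul ((norm_sub_le _ _).trans ?_) (hwb s) (norm_nonneg _) (by positivity)
          exact add_le_add (hM s) le_rfl
      _ ≤ _ := by
          rw [← mul_assoc]
          gcongr
          exact le_max_right _ _

theorem IsSpectral.isGreenData (h : IsSpectral n γ κ) :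
    IsGreenData (sigma n γ κ) (coeff n γ κ) :=
  ⟨h.pos, h.strictMono.monotone, h.coeff_nonneg, h.summable⟩

theorem expConv_ofReal (σ : ℝ) (h : ℝ → ℝ) (t : ℝ) :
    expConv σ (fun s => (h s : ℂ)) t = ((expConv σ h t : ℝ) : ℂ) := by
  rw [expConv, expConv, ← integral_complex_ofReal]
  refine integral_congr_ae (.of_forall fun s => ?_)
  simp

theorem greenConv_ofReal (σ c : ℕ → ℝ) (h : ℝ → ℝ) (t : ℝ) :
    greenConv σ c (fun s => (h s : ℂ)) t = ((greenConv σ c h t : ℝ) : ℂ) := by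
  rw [greenConv, greenConv, Complex.ofReal_tsum]
  simp only [expConv_ofReal, Complex.real_smul, smul_eq_mul, Complex.ofReal_mul]

/-- An admissible solution is the convolution of the Green's function with its source. -/
theorem eq_greenConv_source [Nontrivial (E n)] (hγ0 : 0 < γ) (hγ1 : γ < 1) (hn : 2 * γ < n)
    (hS : IsSpectral n γ κ) (hw : SolvesLStar n γ p u w) {b C : ℝ} (hb0 : 0 ≤ b)
    (hb : b < sigma n γ κ 0) (hwb : HasExpBound n γ p κ u w b C) (t : ℝ) :
    w t = greenConv (sigma n γ κ) (coeff n γ κ) (source n γ p κ u w) t := by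
  have H := hS.isGreenData
  have hb2 : |b| < sigma n γ κ 0 := by rwa [abs_of_nonneg hb0]
  have hcont := H.continuous_greenConv hwb.source_continuous hwb.source_bound hb2
  -- Two continuous functions with equal integrals against all test functions coincide.
  refine congrFun ((hwb.continuous.ae_eq_iff_eq volume hcont).1
    (ae_eq_of_integral_contDiff_smul_eq hwb.continuous.locallyIntegrable hcont.locallyIntegrable
      fun φ hφ hφc => ?_)) t
  set ψ : ℝ → ℂ := fun t => (φ t : ℂ) with hψdef
  have hψ : ContDiff ℝ ∞ ψ := Complex.ofRealCLM.contDiff.comp hφ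
  have hψc : HasCompactSupport ψ := hφc.comp_left (g := fun x : ℝ => (x : ℂ)) Complex.ofReal_zero
  obtain ⟨g, hg, ⟨D, hD0, hD⟩, hgψ, hweak⟩ := exists_conformal_laplacian hγ0 hγ1 hn hψ hψc
  -- A decay rate for the test side: large enough to absorb the growth of `w`, yet below `σ_0` as
  -- the Green's series requires.
  obtain ⟨b', hbb, hb'⟩ := exists_between hb
  obtain ⟨D', hD'0, hψb⟩ : ∃ D', 0 ≤ D' ∧ ∀ s, ‖ψ s‖ ≤ D' * rexp (-b' * |s|) := by
    have h1 : (fun s => ‖ψ s‖) =O[cocompact ℝ] fun s => rexp (-b' * |s|) := by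
      refine EventuallyEq.trans_isBigO (f₂ := fun _ => (0 : ℝ)) ?_ (isBigO_zero _ _)
      have h2 := hasCompactSupport_iff_eventuallyEq.1 hψc.norm
      rwa [coclosedCompact_eq_cocompact] at h2
    obtain ⟨D', h2, h3⟩ := exists_forall_abs_le_of_isBigO hψ.continuous.norm (by fun_prop)
      (fun t => Real.exp_pos _) h1
    exact ⟨D', h2, fun s => by simpa using h3 s⟩
  have hψi : Integrable ψ := hψ.continuous.integrable_of_hasCompactSupport hψc
  -- Here `b' < σ_0 ≤ n/2 - γ < n/2 + γ`, the decay rate of `g`.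
  have hgb : ∀ s, ‖g s‖ ≤ D * rexp (-b' * |s|) := fun s => (hD s).trans (by
    rw [← neg_mul]
    have := hS.le
    gcongr
    linarith)
  -- This is `(P - κ)ψ`, whose Fourier transform is `Θ₀ - κ` times that of `ψ`.
  set f : ℝ → ℂ := fun t => g t - κ * ψ t with hfdef
  have hf : Continuous f := hg.sub (continuous_const.mul hψ.continuous)
  have hfb : ∀ s, ‖f s‖ ≤ (D + |κ| * D') * rexp (-b' * |s|) := fun s => by
    refine (norm_sub_le _ _).trans ?_
    rw [norm_mul, Complex.norm_real, add_mul, mul_assoc]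
    exact add_le_add (hgb s) (mul_le_mul_of_nonneg_left (hψb s) (abs_nonneg _))
  have hbound : ∀ {G : ℝ → ℂ} {K : ℝ}, Continuous G → (∀ s, ‖G s‖ ≤ K * rexp (-b' * |s|)) →
      ∀ {A : ℝ → ℂ} {L a : ℝ}, Continuous A → (∀ s, ‖A s‖ ≤ L * rexp (a * |s|)) → 0 ≤ a → a < b' →
      ∀ s, Integrable fun t => A t * G (t - s) := by
    intro G K hG hGb A L a hA hAb ha hab s
    have hL := nonneg_of_exp_bound hAb
    have hK := nonneg_of_exp_bound hGb
    refine ((integrable_exp_neg_mul_abs (sub_pos.2 hab)).comp_sub_right s |>.const_mul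
      (L * K * rexp (a * |s|))).mono' (hA.mul (hG.comp (by fun_prop))).aestronglyMeasurable
      (.of_forall fun t => ?_)
    rw [norm_mul]
    calc ‖A t‖ * ‖G (t - s)‖ ≤ (L * rexp (a * |t|)) * (K * rexp (-b' * |t - s|)) :=
          mul_le_mul (hAb _) (hGb _) (norm_nonneg _) (by positivity)
      _ = L * K * rexp (a * |t| + -b' * |t - s|) := by
          rw [Real.exp_add]
          ring
      _ ≤ L * K * rexp (a * |s| + -((b' - a) * |t - s|)) := by
          refine mul_le_mul_of_nonneg_left (Real.exp_le_exp.2 ?_) (by positivity)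
          have : |t| ≤ |t - s| + |s| := by simpa using abs_add_le (t - s) s
          nlinarith
      _ = _ := by rw [Real.exp_add, ← mul_assoc]
  have hb'0 : 0 < b' := hb0.trans_lt hbb
  have hfψ : greenConv (sigma n γ κ) (coeff n γ κ) f = ψ := by
    refine H.greenConv_eq hf hfb hb'0 hb' hψ.continuous hψi hS.hasSum fun ξ => ?_
    have hE : ∀ s : ℝ, ‖Complex.exp (ξ * s * Complex.I)‖ ≤ 1 * rexp (0 * |s|) := fun s => by
      rw [← Complex.ofReal_mul, Complex.norm_exp_ofReal_mul_I]
      simp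
    have h1 := hbound hg hgb (A := fun s : ℝ => Complex.exp (ξ * s * Complex.I)) (by fun_prop) hE
      le_rfl hb'0 0
    have h2 := hbound hψ.continuous hψb (A := fun s : ℝ => Complex.exp (ξ * s * Complex.I))
      (by fun_prop) hE le_rfl hb'0 0
    simp only [sub_zero, mul_comm (Complex.exp _)] at h1 h2
    have h3 : ∫ t : ℝ, f t * Complex.exp (ξ * t * Complex.I) =
        (symbol n γ ξ - κ) * ∫ t : ℝ, ψ t * Complex.exp (ξ * t * Complex.I) := by
      simp only [hfdef, sub_mul, mul_assoc (κ : ℂ)]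
      rw [integral_sub h1 (h2.const_mul _), integral_const_mul, hgψ]
    rw [h3, ← mul_assoc, inv_mul_cancel₀ (hS.symbol_ne ξ), one_mul]
  have hwc : Continuous fun t => (w t : ℂ) := Complex.continuous_ofReal.comp hwb.continuous
  have hsc : Continuous fun t => (source n γ p κ u w t : ℂ) :=
    Complex.continuous_ofReal.comp hwb.source_continuous
  have hwbd : ∀ s, ‖(w s : ℂ)‖ ≤ C * rexp (b * |s|) := fun s => by
    rw [Complex.norm_real]
    exact hwb.bound s
  have hsbd : ∀ s, ‖(source n γ p κ u w s : ℂ)‖ ≤ C * rexp (b * |s|) := fun s => by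
    rw [Complex.norm_real]
    exact hwb.source_bound s
  -- The weak equation against the translate by `s`, with `κ w` subtracted from both sides.
  have heq : ∀ s, ∫ t, (w t : ℂ) * f (t - s) = ∫ t, (source n γ p κ u w t : ℂ) * ψ (t - s) := by
    intro s
    have h1 := hbound hg hgb hwc hwbd hb0 hbb s
    have h2 := hbound hψ.continuous hψb hwc hwbd hb0 hbb s
    have h3 := hbound hψ.continuous hψb hsc hsbd hb0 hbb s
    have h4 : ∀ t, ((potential n γ p u t * w t : ℝ) : ℂ) * ψ (t - s) =
        (source n γ p κ u w t : ℂ) * ψ (t - s) + κ * ((w t : ℂ) * ψ (t - s)) := fun t => by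
      rw [source]
      push_cast
      ring
    have h5 := hweak p u w hw s
    simp only [h4] at h5
    rw [integral_add h3 (h2.const_mul _), integral_const_mul] at h5
    simp only [hfdef, mul_sub, mul_left_comm _ (κ : ℂ)]
    rw [integral_sub h1 (h2.const_mul _), integral_const_mul, h5]
    ring
  have hfin := H.integral_mul_greenConv hb0 hbb hb' hwc hwbd hsc hsbd hf hfb hψ.continuous hψb heq
  simp only [hfψ, greenConv_ofReal, hψdef, ← Complex.ofReal_mul] at hfin
  rw [integral_complex_ofReal, integral_complex_ofReal, Complex.ofReal_inj] at hfin
  simpa only [smul_eq_mul, mul_comm (φ _)] using hfin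

end Wronskian

/-! ### Conservation of the weighted Wronskian. -/

section Conservation

variable {n : ℕ} {γ p κ : ℝ} {u w w₁ w₂ : ℝ → ℝ} {b C : ℝ}

theorem component_eq (n : ℕ) (γ p κ : ℝ) (u w : ℝ → ℝ) (j : ℕ) :
    component n γ p κ u w j = expConv (sigma n γ κ j) (source n γ p κ u w) := rfl

theorem HasExpBound.hasDerivAt_component (hS : IsSpectral n γ κ) (hb : |b| < sigma n γ κ 0)
    (h : HasExpBound n γ p κ u w b C) (j : ℕ) (t : ℝ) :
    HasDerivAt (component n γ p κ u w j)
      (expConvDeriv (sigma n γ κ j) (source n γ p κ u w) t) t :=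
  hasDerivAt_expConv h.source_continuous h.source_bound (hS.isGreenData.abs_lt hb j) t

theorem wronskianAt_eq (hS : IsSpectral n γ κ) (hb : |b| < sigma n γ κ 0)
    (h₁ : HasExpBound n γ p κ u w₁ b C) (h₂ : HasExpBound n γ p κ u w₂ b C) (j : ℕ) (t : ℝ) :
    wronskianAt n γ p κ u w₁ w₂ j t =
      expConv (sigma n γ κ j) (source n γ p κ u w₁) t *
        expConvDeriv (sigma n γ κ j) (source n γ p κ u w₂) t -
      expConvDeriv (sigma n γ κ j) (source n γ p κ u w₁) t *
        expConv (sigma n γ κ j) (source n γ p κ u w₂) t := by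
  rw [wronskianAt, (h₁.hasDerivAt_component hS hb j t).deriv,
    (h₂.hasDerivAt_component hS hb j t).deriv, component_eq, component_eq]

/-- By `w_j'' = σ_j² w_j - 2σ_j h` the quadratic terms cancel. The weight `c_j/σ_j` removes the
remaining factor `σ_j`, leaving exactly the terms of the Green's series. -/
theorem hasDerivAt_wronskianAt (hS : IsSpectral n γ κ) (hb : |b| < sigma n γ κ 0)
    (h₁ : HasExpBound n γ p κ u w₁ b C) (h₂ : HasExpBound n γ p κ u w₂ b C) (j : ℕ) (t : ℝ) :
    HasDerivAt (fun t => coeff n γ κ j / sigma n γ κ j * wronskianAt n γ p κ u w₁ w₂ j t)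
      (-2 * ((coeff n γ κ j • expConv (sigma n γ κ j) (source n γ p κ u w₁) t) *
          source n γ p κ u w₂ t -
        source n γ p κ u w₁ t *
          (coeff n γ κ j • expConv (sigma n γ κ j) (source n γ p κ u w₂) t))) t := by
  have hσ := hS.isGreenData.abs_lt hb j
  have hσ0 := (hS.pos j).ne'
  simp only [wronskianAt_eq hS hb h₁ h₂]
  have hd := (((hasDerivAt_expConv h₁.source_continuous h₁.source_bound hσ t).mul
    (hasDerivAt_expConvDeriv h₂.source_continuous h₂.source_bound hσ t)).sub
    ((hasDerivAt_expConvDeriv h₁.source_continuous h₁.source_bound hσ t).mul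
    (hasDerivAt_expConv h₂.source_continuous h₂.source_bound hσ t))).const_mul
    (coeff n γ κ j / sigma n γ κ j)
  convert! hd using 1
  simp only [smul_eq_mul]
  field_simp
  ring

/-- At fixed `t`, `w_j` is of size `1/(σ_j - |b|)` and its derivative of size `σ_j/(σ_j - |b|)`.
With the weight this gives `c_j/(σ_j - |b|)²`; one factor is bounded by its value at `j = 0`, and
the other leaves a summable series. -/
theorem summable_wronskianAt (hS : IsSpectral n γ κ) (hb : |b| < sigma n γ κ 0)
    (h₁ : HasExpBound n γ p κ u w₁ b C) (h₂ : HasExpBound n γ p κ u w₂ b C) (t : ℝ) :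
    Summable fun j => coeff n γ κ j / sigma n γ κ j * wronskianAt n γ p κ u w₁ w₂ j t := by
  have H := hS.isGreenData
  have hd0 := sub_pos.2 hb
  set B := C * rexp (b * |t|) with hB
  have hB0 : 0 ≤ B := (norm_nonneg _).trans (h₁.source_bound t)
  refine ((H.summable_div_sub hb).mul_right
    (2 * (B * 2 * (B * (2 / (sigma n γ κ 0 - |b|)))))).of_norm_bounded fun j => ?_
  have hσ := H.abs_lt hb j
  have hσ0 := H.pos j
  have hdj := sub_pos.2 hσ
  have hK₁ := norm_expConv_le h₁.source_continuous h₁.source_bound hσ t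
  have hK₂ := norm_expConv_le h₂.source_continuous h₂.source_bound hσ t
  have hD₁ := norm_expConvDeriv_le h₁.source_continuous h₁.source_bound hσ t
  have hD₂ := norm_expConvDeriv_le h₂.source_continuous h₂.source_bound hσ t
  rw [← hB] at hK₁ hK₂ hD₁ hD₂
  have hW : ‖wronskianAt n γ p κ u w₁ w₂ j t‖ ≤
      2 * (B * (2 / (sigma n γ κ j - |b|)) *
        (sigma n γ κ j * (B * (2 / (sigma n γ κ j - |b|))))) := by
    rw [wronskianAt_eq hS hb h₁ h₂, two_mul]
    refine (norm_sub_le _ _).trans (add_le_add ?_ ?_)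
    · rw [norm_mul]
      exact mul_le_mul hK₁ hD₂ (norm_nonneg _) (by positivity)
    · rw [norm_mul, mul_comm]
      exact mul_le_mul hK₂ hD₁ (norm_nonneg _) (by positivity)
  have hc := div_nonneg (H.nonneg j) hσ0.le
  rw [norm_mul, Real.norm_of_nonneg hc]
  calc coeff n γ κ j / sigma n γ κ j * ‖wronskianAt n γ p κ u w₁ w₂ j t‖ ≤
      coeff n γ κ j / sigma n γ κ j * (2 * (B * (2 / (sigma n γ κ j - |b|)) *
        (sigma n γ κ j * (B * (2 / (sigma n γ κ j - |b|)))))) :=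
        mul_le_mul_of_nonneg_left hW hc
    _ = coeff n γ κ j / (sigma n γ κ j - |b|) *
        (2 * (B * 2 * (B * (2 / (sigma n γ κ j - |b|))))) := by
        field_simp
    _ ≤ _ := by
        have := H.nonneg j
        have := H.mono (Nat.zero_le j)
        gcongr

/-- The weighted Wronskian of two solutions is constant. -/
theorem hasDerivAt_wronskian [Nontrivial (E n)] (hγ0 : 0 < γ) (hγ1 : γ < 1) (hn : 2 * γ < n)
    (hS : IsSpectral n γ κ) (hw₁ : SolvesLStar n γ p u w₁) (hw₂ : SolvesLStar n γ p u w₂)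
    (hb0 : 0 ≤ b) (hb : b < sigma n γ κ 0)
    (h₁ : HasExpBound n γ p κ u w₁ b C) (h₂ : HasExpBound n γ p κ u w₂ b C) (t : ℝ) :
    HasDerivAt (wronskian n γ p κ u w₁ w₂) 0 t := by
  have H := hS.isGreenData
  have hb' : |b| < sigma n γ κ 0 := by rwa [abs_of_nonneg hb0]
  have hC : 0 ≤ C := nonneg_of_mul_nonneg_left ((norm_nonneg _).trans (h₁.bound 0)) (Real.exp_pos _)
  set T := |t| + 1 with hT
  have hball : ∀ s ∈ Metric.ball (0 : ℝ) T, C * rexp (b * |s|) ≤ C * rexp (b * T) := by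
    intro s hs
    rw [mem_ball_zero_iff, Real.norm_eq_abs] at hs
    gcongr
  have ht : t ∈ Metric.ball (0 : ℝ) T := by
    rw [mem_ball_zero_iff, Real.norm_eq_abs]
    linarith
  set B := C * rexp (b * T) with hB
  have hB0 : 0 ≤ B := by positivity
  have hd : HasDerivAt (wronskian n γ p κ u w₁ w₂)
      (∑' j, -2 * ((coeff n γ κ j • expConv (sigma n γ κ j) (source n γ p κ u w₁) t) *
          source n γ p κ u w₂ t -
        source n γ p κ u w₁ t *
          (coeff n γ κ j • expConv (sigma n γ κ j) (source n γ p κ u w₂) t))) t := by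
    -- Termwise differentiation on a ball containing `t`, where `e^{b|s|}` is at most `e^{bT}` and
    -- the derivatives are dominated by multiples of `c_j/(σ_j - |b|)`.
    refine hasDerivAt_tsum_of_isPreconnected
      (u := fun j => 2 * (2 * C * (coeff n γ κ j / (sigma n γ κ j - |b|)) * rexp (b * T) * B +
        2 * C * (coeff n γ κ j / (sigma n γ κ j - |b|)) * rexp (b * T) * B))
      ?_ Metric.isOpen_ball (convex_ball (0 : ℝ) T).isPreconnected
      (fun j s _ => hasDerivAt_wronskianAt hS hb' h₁ h₂ j s) (fun j s hs => ?_) ht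
      (summable_wronskianAt hS hb' h₁ h₂ t) ht
    · have h := (((H.summable_div_sub hb').mul_left (2 * C)).mul_right (rexp (b * T))).mul_right B
      exact (h.add h).mul_left 2
    · have hK₁ := H.norm_term_le h₁.source_continuous h₁.source_bound hb' j s
      have hK₂ := H.norm_term_le h₂.source_continuous h₂.source_bound hb' j s
      have hs₁ := (h₁.source_bound s).trans (hball s hs)
      have hs₂ := (h₂.source_bound s).trans (hball s hs)
      have hcj := div_nonneg (H.nonneg j) (sub_pos.2 (H.abs_lt hb' j)).le
      have hexp : 2 * C * (coeff n γ κ j / (sigma n γ κ j - |b|)) * rexp (b * |s|) ≤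
          2 * C * (coeff n γ κ j / (sigma n γ κ j - |b|)) * rexp (b * T) := by
        rw [mem_ball_zero_iff, Real.norm_eq_abs] at hs
        gcongr
      rw [norm_mul, norm_neg, Real.norm_of_nonneg zero_le_two]
      refine mul_le_mul_of_nonneg_left ((norm_sub_le _ _).trans (add_le_add ?_ ?_)) zero_le_two
      · rw [norm_mul]
        exact mul_le_mul (hK₁.trans hexp) hs₂ (norm_nonneg _) (by positivity)
      · rw [norm_mul, mul_comm]
        exact mul_le_mul (hK₂.trans hexp) hs₁ (norm_nonneg _) (by positivity)
  convert! hd using 1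
  have hs₁ := H.summable_term h₁.source_continuous h₁.source_bound hb' t
  have hs₂ := H.summable_term h₂.source_continuous h₂.source_bound hb' t
  rw [tsum_mul_left, (hs₁.mul_right _).tsum_sub (hs₂.mul_left _), tsum_mul_right, tsum_mul_left]
  -- The two series sum to `w₁ t` and `w₂ t`. Both products then equal `(𝒱_* - κ) w₁ w₂` and cancel.
  have e₁ := eq_greenConv_source hγ0 hγ1 hn hS hw₁ hb0 hb h₁ t
  have e₂ := eq_greenConv_source hγ0 hγ1 hn hS hw₂ hb0 hb h₂ t
  rw [greenConv] at e₁ e₂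
  rw [← e₁, ← e₂, source, source]
  ring

end Conservation

end NonlocalODE

end

/-! ### The main theorem. -/

theorem mainTheorem8 (n : ℕ) (γ p κ : ℝ) (hγ0 : 0 < γ) (hγ1 : γ < 1) (hn : 2 * γ < n)
    (hp : p ∈ Set.Ioo ((n : ℝ) / (n - 2 * γ)) ((n + 2 * γ) / (n - 2 * γ)))
    (hκ0 : 0 ≤ κ) (hκ1 : κ < NonlocalODE.hardyConst n γ)
    (hτ : ∀ z : ℂ, NonlocalODE.IsPole n γ κ z → z.re = 0)
    (u : ℝ → ℝ) (hu : NonlocalODE.IsFastDecaySolution n γ p u)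
    (w₁ w₂ : ℝ → ℝ) (hw₁ : NonlocalODE.IsAdmissibleSolution n γ p κ u w₁)
    (hw₂ : NonlocalODE.IsAdmissibleSolution n γ p κ u w₂) :
    (∀ v ∈ ({w₁, w₂} : Set (ℝ → ℝ)), ∀ j : ℕ,
      (∀ t, MeasureTheory.Integrable (fun s =>
        Real.exp (-(NonlocalODE.sigma n γ κ j * |t - s|)) * NonlocalODE.source n γ p κ u v s)) ∧
      Differentiable ℝ (NonlocalODE.component n γ p κ u v j)) ∧
    ∀ t : ℝ,
      Summable (fun j => NonlocalODE.coeff n γ κ j / NonlocalODE.sigma n γ κ j *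
        NonlocalODE.wronskianAt n γ p κ u w₁ w₂ j t) ∧
      HasDerivAt (NonlocalODE.wronskian n γ p κ u w₁ w₂) 0 t := by
  have hS := NonlocalODE.isSpectral hγ0 hγ1 hn hκ0 hκ1
  have hn0 : n ≠ 0 := by
    rintro rfl
    rw [Nat.cast_zero] at hn
    linarith
  have : NeZero n := ⟨hn0⟩
  have : Nontrivial (NonlocalODE.E n) := inferInstance
  obtain ⟨b₁, C₁, hb₁, hbσ₁, hC₁, h₁⟩ := hw₁.exists_hasExpBound hγ0 hn hp hu (hS.pos 0)
  obtain ⟨b₂, C₂, hb₂, hbσ₂, hC₂, h₂⟩ := hw₂.exists_hasExpBound hγ0 hn hp hu (hS.pos 0)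
  -- The two solutions are given a common rate and constant, as the Wronskian lemmas require.
  have hb0 : 0 ≤ max b₁ b₂ := hb₁.trans (le_max_left _ _)
  have hbσ : max b₁ b₂ < NonlocalODE.sigma n γ κ 0 := max_lt hbσ₁ hbσ₂
  have hb : |max b₁ b₂| < NonlocalODE.sigma n γ κ 0 := by rwa [abs_of_nonneg hb0]
  have h₁' := h₁.mono (le_max_left b₁ b₂) hC₁ (le_max_left C₁ C₂)
  have h₂' := h₂.mono (le_max_right b₁ b₂) hC₂ (le_max_right C₁ C₂)
  refine ⟨fun v hv j => ?_, fun t => ⟨NonlocalODE.summable_wronskianAt hS hb h₁' h₂' t,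
    NonlocalODE.hasDerivAt_wronskian hγ0 hγ1 hn hS hw₁.solves hw₂.solves hb0 hbσ h₁' h₂' t⟩⟩
  have h : NonlocalODE.HasExpBound n γ p κ u v (max b₁ b₂) (max C₁ C₂) := by
    rcases hv with rfl | rfl
    · exact h₁'
    · exact h₂'
  exact ⟨fun t => NonlocalODE.integrable_expConv h.source_continuous h.source_bound
    (hS.isGreenData.abs_lt hb j) t, fun t => (h.hasDerivAt_component hS hb j t).differentiableAt⟩
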